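/- **Theorem (Morawetz bulk estimate on Schwarzschild).** Let $M>0$ and consider the Schwarzschild exterior $\mathbb{R}_t\times(2M,\infty)_r\times S^2$ with metric $$g=(1-\tfrac{2M}{r})\,dt^2-(1-\tfrac{2M}{r})^{-1}dr^2-r^2(d\theta^2+\sin^2\theta\,d\phi^2),$$ Levi-Civita connection $\nabla$, Hodge dual $*$ (so ${*}F_{ab}=\tfrac12\epsilon_{abcd}F^{cd}$) and volume measure $d\mu$. Let $F_{ab}$ be a smooth real $2$-form on the exterior with $\nabla^aF_{ab}=0$ and $\nabla_{[a}F_{bc]}=0$. Put $Y_{ab}=-2r^3\sin\theta\,d\theta_{[a}d\phi_{b]}$, $U_a=-r^{-1}\nabla_a r$ and $$Z_{ab}=-\tfrac43\,{*}F_{[a}{}^{c}Y_{b]c},\qquad \beta_a=-\tfrac12U^bZ_{ab}-\tfrac12 i\,U^b{*}Z_{ab}-\tfrac12\nabla_bZ_a{}^b-\tfrac12 i\,\nabla_b{*}Z_a{}^b,$$ $$\mathbf H_{ab}=\beta_{(a}\bar\beta_{b)}-\tfrac12g_{ab}\beta^c\bar\beta_c,\qquad \mathbf W_{ab}=-\tfrac12Z_a{}^cZ_{bc}+\tfrac18g_{ab}Z_{cd}Z^{cd}.$$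 With $$A^a=\frac{(r-3M)(r-2M)}{2r^2}(\partial_r)^a,\qquad q=\frac{9M^2(r-2M)(2r-3M)}{4r^5},$$ let $\mathbf P_a$ be the (real) Morawetz current $$\mathbf P_a=\mathbf H_{ab}A^b+\tfrac14q\beta^bZ_{ab}+\tfrac14q\bar\beta^bZ_{ab}-\tfrac14iq\beta^b{*}Z_{ab}+\tfrac14iq\bar\beta^b{*}Z_{ab}+\tfrac1{16}Z_{bc}Z^{bc}\nabla_aq-\tfrac14Z_a{}^cZ_{bc}\nabla^bq .$$ Let $\widehat T=(1-\frac{2M}{r})^{-1/2}\partial_t$, $\widehat X=r^{-1}\partial_\theta$, $\widehat Y=r^{-1}\csc\theta\,\partial_\phi$, $\widehat Z=(1-\frac{2M}{r})^{1/2}\partial_r$, write $\beta_\nu=\beta_a\nu^a$, and set $$|\beta|^2_{1,\mathrm{deg}}=\frac{(r-3M)^2}{r^3}\bigl(|\beta_{\widehat X}|^2+|\beta_{\widehat Y}|^2\bigr)+\frac{M(r-2M)}{r^3}|\beta_{\widehat Z}|^2+\frac{M(r-3M)^2(r-2M)}{r^5}|\beta_{\widehat T}|^2,$$ $$|\Theta|^2_2=\frac{r-2M}{r}\,\mathbf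 W_{\widehat T\widehat T}.$$ Then for every spherically symmetric measurable region $\Omega$ of the exterior (a union of spheres of constant $t$ and $r$) on which $\nabla^a\mathbf P_a$ is integrable, the function $\tfrac18|\beta|^2_{1,\mathrm{deg}}+\tfrac{M}{100r^4}|\Theta|_2^2$ is integrable on $\Omega$ and $$\int_\Omega-\nabla^a\mathbf P_a\,d\mu\;\ge\;\int_\Omega\Bigl(\tfrac18|\beta|^2_{1,\mathrm{deg}}+\frac{M}{100\,r^4}|\Theta|^2_2\Bigr)d\mu .$$ Moreover, without any integrability assumption, in $[0,\infty]$, $$\int_\Omega\Bigl(\tfrac18|\beta|^2_{1,\mathrm{deg}}+\frac{M}{100\,r^4}|\Theta|^2_2\Bigr)d\mu+\int_\Omega(\nabla^a\mathbf P_a)_+\,d\mu\;\le\;\int_\Omega(-\nabla^a\mathbf P_a)_+\,d\mu ,$$ where $(x)_+=\max(x,0)$. -/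

import Mathlib

open MeasureTheory
open scoped ContDiff

noncomputable section

namespace Schwarzschild

/-! ### The exterior region

The exterior `ℝ × (2M, ∞) × S²` is covered by the single global chart
`(t, x¹, x², x³) = (t, r sin θ cos φ, r sin θ sin φ, r cos θ)`, which is smooth across the axis
`θ ∈ {0, π}`.  All tensor fields below are given by their components in this chart; index `0` is
`t` and the indices `1, 2, 3` are spatial. -/

/-- Coordinates `(t, x¹, x², x³)`. -/
abbrev Pt : Type := Fin 4 → ℝ

/-- The area radius `r`. -/
def rad (p : Pt) : ℝ := Real.sqrt (p 1 ^ 2 + p 2 ^ 2 + p 3 ^ 2)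

/-- The exterior region `r > 2M`. -/
def exterior (M : ℝ) : Set Pt := {p | 2 * M < rad p}

/-- The coordinate partial derivative `∂_a f`. -/
def pd (a : Fin 4) (f : Pt → ℝ) (p : Pt) : ℝ := fderiv ℝ f p (Pi.single a 1)

/-- The metric `g = (1-2M/r) dt² - (1-2M/r)⁻¹ dr² - r² (dθ² + sin² θ dφ²)`, where
`r² (dθ² + sin² θ dφ²) = (dx¹)² + (dx²)² + (dx³)² - dr²`. -/
def metric (M : ℝ) (p : Pt) : Matrix (Fin 4) (Fin 4) ℝ := Matrix.of fun a b =>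
  (1 - 2 * M / rad p) * (if a = 0 ∧ b = 0 then 1 else 0)
    - (1 - 2 * M / rad p)⁻¹ * (pd a rad p * pd b rad p)
    - ((if a = b ∧ a ≠ 0 then 1 else 0) - pd a rad p * pd b rad p)

/-- The inverse metric `g^{ab}`. -/
def invMetric (M : ℝ) (p : Pt) : Matrix (Fin 4) (Fin 4) ℝ := (metric M p)⁻¹

/-- The spacetime volume measure `dμ = √|det g| dt dx¹ dx² dx³`. -/
def vol (M : ℝ) : Measure Pt :=
  (volume : Measure Pt).withDensity fun p => ENNReal.ofReal (Real.sqrt |(metric M p).det|)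

/-- A set is spherically symmetric when it is a union of orbits of the rotation group, i.e. of
spheres on which `t` and `r` are constant. -/
def SphericallySymmetric (Ω : Set Pt) : Prop :=
  ∀ p q : Pt, p 0 = q 0 → rad p = rad q → p ∈ Ω → q ∈ Ω

/-! ### Tensor calculus of the Levi-Civita connection -/

/-- The Christoffel symbol `Γ^c_{ab}`. -/
def christoffel (M : ℝ) (p : Pt) (c a b : Fin 4) : ℝ :=
  (1 / 2) * ∑ d, invMetric M p c d *
    (pd a (fun x => metric M x b d) p + pd b (fun x => metric M x a d) p
      - pd d (fun x => metric M x a b) p)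

/-- `∇_b w_a` for a real `1`-form `w`. -/
def nabla1 (M : ℝ) (w : Pt → Fin 4 → ℝ) (p : Pt) (b a : Fin 4) : ℝ :=
  pd b (fun x => w x a) p - ∑ d, christoffel M p d b a * w p d

/-- `∇_c w_{ab}` for a real covariant `2`-tensor `w`. -/
def nabla2 (M : ℝ) (w : Pt → Fin 4 → Fin 4 → ℝ) (p : Pt) (c a b : Fin 4) : ℝ :=
  pd c (fun x => w x a b) p
    - ∑ d, (christoffel M p d c a * w p d b + christoffel M p d c b * w p a d)

/-- `∇^a w_a` for a real `1`-form `w`. -/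
def div1 (M : ℝ) (w : Pt → Fin 4 → ℝ) (p : Pt) : ℝ :=
  ∑ a, ∑ b, invMetric M p a b * nabla1 M w p a b

/-- `∇_b w_a{}^b` for a real covariant `2`-tensor `w`. -/
def div2 (M : ℝ) (w : Pt → Fin 4 → Fin 4 → ℝ) (p : Pt) (a : Fin 4) : ℝ :=
  ∑ b, ∑ c, invMetric M p b c * nabla2 M w p b a c

/-- The permutation symbol `[abcd]`, with `[0123] = 1`. -/
def permSymbol (a b c d : Fin 4) : ℤ :=
  (Matrix.of fun i j : Fin 4 => if ![a, b, c, d] i = j then (1 : ℤ) else 0).det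

/-- The volume form `ε_{abcd}`, for the orientation in which `(∂_t, ∂_1, ∂_2, ∂_3)` is positive. -/
def volForm (M : ℝ) (p : Pt) (a b c d : Fin 4) : ℝ :=
  Real.sqrt |(metric M p).det| * (permSymbol a b c d : ℝ)

/-- The Hodge dual `*w_{ab} = ½ ε_{abcd} w^{cd}`. -/
def hodge (M : ℝ) (w : Pt → Fin 4 → Fin 4 → ℝ) (p : Pt) (a b : Fin 4) : ℝ :=
  (1 / 2) * ∑ c, ∑ d, ∑ e, ∑ f,
    volForm M p a b c d * invMetric M p c e * invMetric M p d f * w p e f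

/-! ### Maxwell fields and the derived fields `Z_{ab}`, `β_a` -/

/-- A smooth real `2`-form `F_{ab}` on the exterior with `∇^a F_{ab} = 0` and
`∇_{[a} F_{bc]} = 0`. -/
structure IsMaxwellField (M : ℝ) (F : Pt → Fin 4 → Fin 4 → ℝ) : Prop where
  smooth : ∀ a b, ContDiffOn ℝ ∞ (fun p => F p a b) (exterior M)
  antisymm : ∀ p ∈ exterior M, ∀ a b, F p a b = - F p b a
  div_eq_zero : ∀ p ∈ exterior M, ∀ b,
    ∑ a, ∑ c, invMetric M p a c * nabla2 M F p c a b = 0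
  closed : ∀ p ∈ exterior M, ∀ a b c,
    nabla2 M F p a b c + nabla2 M F p b c a + nabla2 M F p c a b = 0

/-- The Killing-Yano tensor `Y_{ab} = - 2 r³ sin θ dθ_{[a} dφ_{b]} = - r (r² sin θ dθ ∧ dφ)_{ab}`.
In the chart, `r² sin θ dθ ∧ dφ = r⁻¹ (x¹ dx² ∧ dx³ + x² dx³ ∧ dx¹ + x³ dx¹ ∧ dx²)`. -/
def killingYano (p : Pt) (a b : Fin 4) : ℝ := - ∑ c, (permSymbol 0 a b c : ℝ) * p c

/-- `Z_{ab} = - (4/3) *F_{[a}{}^c Y_{b]c}`. -/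
def fieldZ (M : ℝ) (F : Pt → Fin 4 → Fin 4 → ℝ) (p : Pt) (a b : Fin 4) : ℝ :=
  - (4 / 3) * ((1 / 2) * ∑ c, ∑ d, invMetric M p c d *
    (hodge M F p a d * killingYano p b c - hodge M F p b d * killingYano p a c))

/-- `U_a = - r⁻¹ ∇_a r`. -/
def fieldU (p : Pt) (a : Fin 4) : ℝ := - (rad p)⁻¹ * pd a rad p

/-- `U^b w_{ab}`. -/
def contractU (M : ℝ) (w : Pt → Fin 4 → Fin 4 → ℝ) (p : Pt) (a : Fin 4) : ℝ :=
  ∑ b, ∑ c, invMetric M p b c * fieldU p c * w p a b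

/-- `β_a = - ½ U^b Z_{ab} - ½ i U^b *Z_{ab} - ½ ∇_b Z_a{}^b - ½ i ∇_b *Z_a{}^b`. -/
def fieldβ (M : ℝ) (F : Pt → Fin 4 → Fin 4 → ℝ) (p : Pt) (a : Fin 4) : ℂ :=
  - (1 / 2) * (contractU M (fieldZ M F) p a : ℂ)
    - (1 / 2) * Complex.I * (contractU M (hodge M (fieldZ M F)) p a : ℂ)
    - (1 / 2) * (div2 M (fieldZ M F) p a : ℂ)
    - (1 / 2) * Complex.I * (div2 M (hodge M (fieldZ M F)) p a : ℂ)

/-- `β^a`. -/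
def fieldβUp (M : ℝ) (F : Pt → Fin 4 → Fin 4 → ℝ) (p : Pt) (a : Fin 4) : ℂ :=
  ∑ b, (invMetric M p a b : ℂ) * fieldβ M F p b

/-- The superenergy tensor `H_{ab} = β_{(a} β̄_{b)} - ½ g_{ab} β^c β̄_c`. -/
def superH (M : ℝ) (F : Pt → Fin 4 → Fin 4 → ℝ) (p : Pt) (a b : Fin 4) : ℂ :=
  (1 / 2) * (fieldβ M F p a * star (fieldβ M F p b) + fieldβ M F p b * star (fieldβ M F p a))
    - (1 / 2) * (metric M p a b : ℂ) *
      ∑ c, ∑ d, (invMetric M p c d : ℂ) * fieldβ M F p c * star (fieldβ M F p d)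

/-- `Z_a{}^c Z_{bc}`. -/
def squareZ (M : ℝ) (F : Pt → Fin 4 → Fin 4 → ℝ) (p : Pt) (a b : Fin 4) : ℝ :=
  ∑ c, ∑ d, invMetric M p c d * fieldZ M F p a d * fieldZ M F p b c

/-- `Z_{cd} Z^{cd}`. -/
def normZ (M : ℝ) (F : Pt → Fin 4 → Fin 4 → ℝ) (p : Pt) : ℝ :=
  ∑ a, ∑ b, invMetric M p a b * squareZ M F p a b

/-- The superenergy tensor `W_{ab} = - ½ Z_a{}^c Z_{bc} + ⅛ g_{ab} Z_{cd} Z^{cd}`. -/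
def superW (M : ℝ) (F : Pt → Fin 4 → Fin 4 → ℝ) (p : Pt) (a b : Fin 4) : ℝ :=
  - (1 / 2) * squareZ M F p a b + (1 / 8) * metric M p a b * normZ M F p

/-! ### The Morawetz current -/

/-- The current
`P_a = H_{ab} A^b + ¼ q β^b Z_{ab} + ¼ q β̄^b Z_{ab} - ¼ i q β^b *Z_{ab} + ¼ i q β̄^b *Z_{ab}`
`      + (1/16) Z_{bc} Z^{bc} ∇_a q - ¼ Z_a{}^c Z_{bc} ∇^b q`
of a real vector field `A` and a real scalar field `q`, as a complex expression. -/
def currentℂ (M : ℝ) (F : Pt → Fin 4 → Fin 4 → ℝ) (A : Pt → Fin 4 → ℝ) (q : Pt → ℝ)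
    (p : Pt) (a : Fin 4) : ℂ :=
  (∑ b, superH M F p a b * (A p b : ℂ))
    + (1 / 4) * (q p : ℂ) * ∑ b, fieldβUp M F p b * (fieldZ M F p a b : ℂ)
    + (1 / 4) * (q p : ℂ) * ∑ b, star (fieldβUp M F p b) * (fieldZ M F p a b : ℂ)
    - (1 / 4) * Complex.I * (q p : ℂ) *
        ∑ b, fieldβUp M F p b * (hodge M (fieldZ M F) p a b : ℂ)
    + (1 / 4) * Complex.I * (q p : ℂ) *
        ∑ b, star (fieldβUp M F p b) * (hodge M (fieldZ M F) p a b : ℂ)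
    + (1 / 16) * (normZ M F p : ℂ) * (pd a q p : ℂ)
    - (1 / 4) * ((∑ b, ∑ d, squareZ M F p a b * (invMetric M p b d * pd d q p) : ℝ) : ℂ)

/-- The same current as a real `1`-form. -/
def current (M : ℝ) (F : Pt → Fin 4 → Fin 4 → ℝ) (A : Pt → Fin 4 → ℝ) (q : Pt → ℝ)
    (p : Pt) (a : Fin 4) : ℝ := (currentℂ M F A q p a).re

theorem invMetric_symm (M : ℝ) (p : Pt) (a b : Fin 4) :
    invMetric M p a b = invMetric M p b a := by
  have h : (metric M p).transpose = metric M p := by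
    ext i j
    simp only [Matrix.transpose_apply, metric, Matrix.of_apply]
    have h1 : (j = 0 ∧ i = 0) ↔ (i = 0 ∧ j = 0) := and_comm
    have h2 : (j = i ∧ j ≠ 0) ↔ (i = j ∧ i ≠ 0) := by
      constructor <;> (rintro ⟨rfl, h⟩; exact ⟨rfl, h⟩)
    simp only [h1, h2, mul_comm (pd j rad p)]
  have h' : (invMetric M p).transpose = invMetric M p := by
    unfold invMetric
    rw [Matrix.transpose_nonsing_inv, h]
  exact congrFun (congrFun h' b) a

theorem star_superH (M : ℝ) (F : Pt → Fin 4 → Fin 4 → ℝ) (p : Pt) (a b : Fin 4) :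
    star (superH M F p a b) = superH M F p a b := by
  have hs : star (∑ c, ∑ d, (invMetric M p c d : ℂ) * fieldβ M F p c * star (fieldβ M F p d))
      = ∑ c, ∑ d, (invMetric M p c d : ℂ) * fieldβ M F p c * star (fieldβ M F p d) := by
    rw [star_sum, Finset.sum_comm]
    simp only [star_sum]
    rw [Finset.sum_comm]
    conv_rhs => rw [Finset.sum_comm]
    refine Finset.sum_congr rfl fun c _ => Finset.sum_congr rfl fun d _ => ?_
    rw [invMetric_symm M p c d]
    simp
    ring
  unfold superH
  rw [star_sub, star_mul, star_mul, hs]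
  simp
  ring

/-- The current is real: its complex expression equals the real `1`-form `current`. -/
theorem ofReal_current (M : ℝ) (F : Pt → Fin 4 → Fin 4 → ℝ) (A : Pt → Fin 4 → ℝ) (q : Pt → ℝ)
    (p : Pt) (a : Fin 4) : (current M F A q p a : ℂ) = currentℂ M F A q p a := by
  have h : star (currentℂ M F A q p a) = currentℂ M F A q p a := by
    unfold currentℂ
    simp only [star_add, star_sub, star_mul, star_sum, star_superH, star_star]
    simp [mul_comm]
    ring
  exact Complex.conj_eq_iff_re.mp h

/-- `A = (r-3M)(r-2M)/(2r²) ∂_r`, where `∂_r = (x^i / r) ∂_i`. -/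
def morawetzA (M : ℝ) (p : Pt) (a : Fin 4) : ℝ :=
  (rad p - 3 * M) * (rad p - 2 * M) / (2 * rad p ^ 2) * (if a = 0 then 0 else p a / rad p)

/-- `q = 9M²(r-2M)(2r-3M)/(4r⁵)`. -/
def morawetzq (M : ℝ) (p : Pt) : ℝ :=
  9 * M ^ 2 * (rad p - 2 * M) * (2 * rad p - 3 * M) / (4 * rad p ^ 5)

/-- The Morawetz current `P_a` for the above choice of `A` and `q`. -/
def morawetzP (M : ℝ) (F : Pt → Fin 4 → Fin 4 → ℝ) : Pt → Fin 4 → ℝ :=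
  current M F (morawetzA M) (morawetzq M)

/-! ### The orthonormal frame and the degenerate norms -/

/-- The distance `r sin θ` to the axis. -/
def axisDist (p : Pt) : ℝ := Real.sqrt (p 1 ^ 2 + p 2 ^ 2)

/-- `T̂ = (1-2M/r)^{-1/2} ∂_t`. -/
def frameT (M : ℝ) (p : Pt) : Fin 4 → ℝ := ![(Real.sqrt (1 - 2 * M / rad p))⁻¹, 0, 0, 0]

/-- `X̂ = r⁻¹ ∂_θ = (0, cos θ cos φ, cos θ sin φ, - sin θ)`; on the axis, a null set where `∂_θ` is
not defined, the value is irrelevant. -/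
def frameX (p : Pt) : Fin 4 → ℝ :=
  ![0, p 3 / rad p * (p 1 / axisDist p), p 3 / rad p * (p 2 / axisDist p), - (axisDist p / rad p)]

/-- `Ŷ = r⁻¹ csc θ ∂_φ = (0, - sin φ, cos φ, 0)`; on the axis, a null set where `csc θ ∂_φ` is not
defined, the value is irrelevant. -/
def frameY (p : Pt) : Fin 4 → ℝ := ![0, - (p 2 / axisDist p), p 1 / axisDist p, 0]

/-- `Ẑ = (1-2M/r)^{1/2} ∂_r`. -/
def frameZ (M : ℝ) (p : Pt) : Fin 4 → ℝ :=
  fun a => Real.sqrt (1 - 2 * M / rad p) * (if a = 0 then 0 else p a / rad p)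

/-- The component `β_ν = β_a ν^a`. -/
def βAlong (M : ℝ) (F : Pt → Fin 4 → Fin 4 → ℝ) (p : Pt) (ν : Fin 4 → ℝ) : ℂ :=
  ∑ a, fieldβ M F p a * (ν a : ℂ)

/-- `|β|²_{1,deg} = (r-3M)²/r³ (|β_X̂|² + |β_Ŷ|²) + M(r-2M)/r³ |β_Ẑ|²`
`                 + M(r-3M)²(r-2M)/r⁵ |β_T̂|²`. -/
def normβDeg (M : ℝ) (F : Pt → Fin 4 → Fin 4 → ℝ) (p : Pt) : ℝ :=
  (rad p - 3 * M) ^ 2 / rad p ^ 3 *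
      (‖βAlong M F p (frameX p)‖ ^ 2 + ‖βAlong M F p (frameY p)‖ ^ 2)
    + M * (rad p - 2 * M) / rad p ^ 3 * ‖βAlong M F p (frameZ M p)‖ ^ 2
    + M * (rad p - 3 * M) ^ 2 * (rad p - 2 * M) / rad p ^ 5 *
      ‖βAlong M F p (frameT M p)‖ ^ 2

/-- `|Θ|²_2 = |Z|²_2 = (r-2M)/r W_{T̂T̂}`. -/
def normΘ (M : ℝ) (F : Pt → Fin 4 → Fin 4 → ℝ) (p : Pt) : ℝ :=
  (rad p - 2 * M) / rad p * ∑ a, ∑ b, superW M F p a b * frameT M p a * frameT M p b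

/-- The integrand `⅛ |β|²_{1,deg} + M/(100 r⁴) |Θ|²_2`. -/
def morawetzBulk (M : ℝ) (F : Pt → Fin 4 → Fin 4 → ℝ) (p : Pt) : ℝ :=
  (1 / 8) * normβDeg M F p + M / (100 * rad p ^ 4) * normΘ M F p

end Schwarzschild

end

/-!
In the global chart `(t, x)` the metric has determinant `-1`, so divergences of vector fields and of
`2`-forms are flat coordinate divergences of the raised components, and `F` is encoded by two
spatial vectors `E`, `C` that satisfy the Maxwell equations of a medium. In these terms `Z` is given
by the tangential vectors `⅔ x × C`, `-⅔ x × E`, and `β` becomes a gradient: `Re β = r⁻¹ dφ` with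
`φ = ⅓ r x · E`, and likewise for `Im β` with `C` in place of `E`. Each of the two pairs
`(Re β, Z)` and `(Im β, *Z)` thus satisfies one and the same first-order system, which contains the
wave equation for `φ`.

The Morawetz current is the sum of a flux quadratic in `β`, a mixed flux and a flux quadratic in
`Z`. Their divergences for arbitrary radial multipliers follow from the system. For the multipliers
of the theorem, `-∇·P` is a quadratic form in the components of `β` and `Z` whose only negative
coefficient is that of `|Z|²` for `r > 5M`. A Hodge estimate on the spheres, which bounds `|Z|²` by
the time and radial components of `β`, repairs this at the cost of a sum of rotational derivatives.
The integral of that sum over spherically symmetric compact regions is zero, by differentiating the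
rotated integrals at angle zero, and monotone convergence removes the compactness.
-/

noncomputable section

namespace Schwarzschild

/-! ### Calculus in the chart -/

section PartialDerivatives

variable {a b : Fin 4} {f g : Pt → ℝ} {p : Pt} {s : Set Pt}

theorem pd_add (hf : DifferentiableAt ℝ f p) (hg : DifferentiableAt ℝ g p) :
    pd a (fun x => f x + g x) p = pd a f p + pd a g p := by
  rw [pd, fderiv_fun_add hf hg]; rfl

theorem pd_sub (hf : DifferentiableAt ℝ f p) (hg : DifferentiableAt ℝ g p) :
    pd a (fun x => f x - g x) p = pd a f p - pd a g p := by
  rw [pd, fderiv_fun_sub hf hg]; rfl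

theorem pd_neg : pd a (fun x => -f x) p = -pd a f p := by
  rw [pd, fderiv_fun_neg]; rfl

theorem pd_mul (hf : DifferentiableAt ℝ f p) (hg : DifferentiableAt ℝ g p) :
    pd a (fun x => f x * g x) p = pd a f p * g p + f p * pd a g p := by
  simp only [pd, fderiv_fun_mul hf hg, add_apply, smul_apply, smul_eq_mul]
  ring

theorem pd_const {c : ℝ} : pd a (fun _ => c) p = 0 := by
  simp [pd]

theorem pd_coord : pd a (fun x => x b) p = if b = a then 1 else 0 := by
  rw [pd, HasFDerivAt.fderiv (hasFDerivAt_apply b p)]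
  simp [Pi.single_apply]

theorem pd_sum {ι : Type*} {t : Finset ι} {F : ι → Pt → ℝ}
    (hF : ∀ i ∈ t, DifferentiableAt ℝ (F i) p) :
    pd a (fun x => ∑ i ∈ t, F i x) p = ∑ i ∈ t, pd a (F i) p := by
  simp only [pd, fderiv_fun_sum hF, sum_apply]

theorem pd_comp {φ : ℝ → ℝ} {φ' : ℝ} (hφ : HasDerivAt φ φ' (f p))
    (hf : DifferentiableAt ℝ f p) : pd a (fun x => φ (f x)) p = φ' * pd a f p := by
  rw [pd, HasFDerivAt.fderiv (f := fun x => φ (f x)) (hφ.comp_hasFDerivAt p hf.hasFDerivAt)]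
  rfl

theorem pd_inv (hf : DifferentiableAt ℝ f p) (h0 : f p ≠ 0) :
    pd a (fun x => (f x)⁻¹) p = -pd a f p / f p ^ 2 := by
  rw [pd_comp (hasDerivAt_inv h0) hf]; field_simp

theorem pd_congr (hs : IsOpen s) (hp : p ∈ s) (h : ∀ x ∈ s, f x = g x) :
    pd a f p = pd a g p := by
  rw [pd, pd, Filter.EventuallyEq.fderiv_eq]
  filter_upwards [hs.mem_nhds hp] with x hx using h x hx

theorem contDiffOn_pd (hs : IsOpen s) (hf : ContDiffOn ℝ ∞ f s) :
    ContDiffOn ℝ ∞ (pd a f) s :=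
  (hf.fderiv_of_isOpen (m := ∞) hs (by simp)).clm_apply contDiffOn_const

theorem pd_comm (hs : IsOpen s) (hf : ContDiffOn ℝ ∞ f s) (hp : p ∈ s) :
    pd a (pd b f) p = pd b (pd a f) p := by
  have hc : ContDiffAt ℝ ∞ f p := hf.contDiffAt (hs.mem_nhds hp)
  have hd : DifferentiableAt ℝ (fderiv ℝ f) p :=
    (hc.fderiv_right (m := ∞) (by simp)).differentiableAt (by simp)
  have pd_pd (c d : Fin 4) : pd c (pd d f) p
      = fderiv ℝ (fderiv ℝ f) p (Pi.single c 1) (Pi.single d 1) := by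
    have : pd d f = fun x => fderiv ℝ f x (Pi.single d 1) := rfl
    rw [pd, this, fderiv_clm_apply hd (differentiableAt_const _)]
    simp
  have hsymm : IsSymmSndFDerivAt ℝ f p :=
    hc.isSymmSndFDerivAt (by
      simp only [minSmoothness_of_isRCLikeNormedField]
      exact WithTop.coe_le_coe.mpr le_top)
  rw [pd_pd, pd_pd, hsymm.eq]

end PartialDerivatives

/-! ### Spatial vector calculus -/

/-- The Euclidean inner product of the spatial parts of two vectors. -/
def dot (v w : Fin 4 → ℝ) : ℝ := v 1 * w 1 + v 2 * w 2 + v 3 * w 3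

/-- The cross product of the spatial parts of two vectors, with vanishing time component. -/
def cross (v w : Fin 4 → ℝ) : Fin 4 → ℝ :=
  ![0, v 2 * w 3 - v 3 * w 2, v 3 * w 1 - v 1 * w 3, v 1 * w 2 - v 2 * w 1]

/-- The coordinate derivative `∂_a V` of the components of a vector field. -/
def pdVec (a : Fin 4) (V : Pt → Fin 4 → ℝ) (p : Pt) : Fin 4 → ℝ := fun b => pd a (fun x => V x b) p

/-- The gradient of a function, including its time component. -/
def grad (φ : Pt → ℝ) (p : Pt) : Fin 4 → ℝ := fun a => pd a φ p

/-- The divergence of the spatial part of a vector field with respect to the flat metric of the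
chart. -/
def spaceDiv (V : Pt → Fin 4 → ℝ) (p : Pt) : ℝ :=
  pdVec 1 V p 1 + pdVec 2 V p 2 + pdVec 3 V p 3

/-- The curl of the spatial part of a vector field with respect to the flat metric of the chart,
with vanishing time component. -/
def curl (V : Pt → Fin 4 → ℝ) (p : Pt) : Fin 4 → ℝ :=
  ![0, pdVec 2 V p 3 - pdVec 3 V p 2, pdVec 3 V p 1 - pdVec 1 V p 3,
    pdVec 1 V p 2 - pdVec 2 V p 1]

theorem dot_comm (v w : Fin 4 → ℝ) : dot v w = dot w v := by
  simp only [dot]; ring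

theorem dot_add (v w w' : Fin 4 → ℝ) : dot v (w + w') = dot v w + dot v w' := by
  simp only [dot, Pi.add_apply]; ring

theorem dot_sub (v w w' : Fin 4 → ℝ) : dot v (w - w') = dot v w - dot v w' := by
  simp only [dot, Pi.sub_apply]; ring

theorem dot_smul (k : ℝ) (v w : Fin 4 → ℝ) : dot v (k • w) = k * dot v w := by
  simp only [dot, Pi.smul_apply, smul_eq_mul]; ring

theorem dot_neg (v w : Fin 4 → ℝ) : dot v (-w) = -dot v w := by
  simp only [dot, Pi.neg_apply]; ring

theorem dot_congr {w w' : Fin 4 → ℝ} (h : ∀ a, a ≠ 0 → w a = w' a) (v : Fin 4 → ℝ) :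
    dot v w = dot v w' := by
  rw [dot, dot, h 1 (by simp), h 2 (by simp), h 3 (by simp)]

theorem dot_cross_self (v w : Fin 4 → ℝ) : dot v (cross v w) = 0 := by
  simp [dot, cross]; ring

theorem cross_single_zero (w : Fin 4 → ℝ) : cross (Pi.single 0 1) w = 0 := by
  ext a; fin_cases a <;> simp [cross]

section VectorFields

variable {a b : Fin 4} {φ : Pt → ℝ} {V W : Pt → Fin 4 → ℝ} {p : Pt}

theorem pd_dot (hV : DifferentiableAt ℝ V p) (hW : DifferentiableAt ℝ W p) :
    pd a (fun x => dot (V x) (W x)) p = dot (pdVec a V p) (W p) + dot (V p) (pdVec a W p) := by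
  simp (disch := fun_prop) only [dot, pdVec, pd_add, pd_mul]
  ring

theorem differentiableAt_cross (hV : DifferentiableAt ℝ V p) (hW : DifferentiableAt ℝ W p) :
    DifferentiableAt ℝ (fun x => cross (V x) (W x)) p := by
  have hV' (a : Fin 4) : DifferentiableAt ℝ (fun x => V x a) p := by fun_prop
  have hW' (a : Fin 4) : DifferentiableAt ℝ (fun x => W x a) p := by fun_prop
  refine differentiableAt_pi.2 fun a => ?_
  fin_cases a
  exacts [differentiableAt_const _, ((hV' 2).mul (hW' 3)).sub ((hV' 3).mul (hW' 2)),
    ((hV' 3).mul (hW' 1)).sub ((hV' 1).mul (hW' 3)),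
    ((hV' 1).mul (hW' 2)).sub ((hV' 2).mul (hW' 1))]

theorem differentiableAt_dot (hV : DifferentiableAt ℝ V p) (hW : DifferentiableAt ℝ W p) :
    DifferentiableAt ℝ (fun x => dot (V x) (W x)) p := by
  unfold dot; fun_prop

theorem pdVec_cross (hV : DifferentiableAt ℝ V p) (hW : DifferentiableAt ℝ W p) :
    pdVec a (fun x => cross (V x) (W x)) p
      = cross (pdVec a V p) (W p) + cross (V p) (pdVec a W p) := by
  ext b
  fin_cases b <;>
    simp (disch := fun_prop) [cross, pdVec, pd_sub, pd_mul, pd_const] <;> ring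

theorem pdVec_coord : pdVec a (fun x => x) p = Pi.single a 1 := by
  ext b; simp [pdVec, pd_coord, Pi.single_apply]

theorem curl_coord : curl (fun x => x) p = 0 := by
  ext b; fin_cases b <;> simp [curl, pdVec_coord]

theorem pdVec_smul {k : ℝ} (hV : DifferentiableAt ℝ V p) :
    pdVec a (fun x => k • V x) p = k • pdVec a V p := by
  ext b
  simp (disch := fun_prop) only [pdVec, Pi.smul_apply, smul_eq_mul, pd_mul, pd_const]
  ring

theorem pdVec_neg : pdVec a (fun x => -V x) p = -pdVec a V p := by
  ext b; exact pd_neg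

theorem curl_smul {k : ℝ} (hV : DifferentiableAt ℝ V p) :
    curl (fun x => k • V x) p = k • curl V p := by
  ext b; fin_cases b <;> simp [curl, pdVec_smul hV] <;> ring

theorem curl_neg : curl (fun x => -V x) p = -curl V p := by
  ext b; fin_cases b <;> simp [curl, pdVec_neg] <;> ring

theorem spaceDiv_neg : spaceDiv (fun x => -V x) p = -spaceDiv V p := by
  simp only [spaceDiv, pdVec_neg, Pi.neg_apply]; ring

theorem spaceDiv_congr {s : Set Pt} (hs : IsOpen s) (hp : p ∈ s)
    (h : ∀ x ∈ s, ∀ a, a ≠ 0 → V x a = W x a) : spaceDiv V p = spaceDiv W p := by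
  have pdVec_eq (a : Fin 4) (ha : a ≠ 0) : pdVec a V p a = pdVec a W p a :=
    pd_congr hs hp fun x hx => h x hx a ha
  rw [spaceDiv, spaceDiv, pdVec_eq 1 (by simp), pdVec_eq 2 (by simp), pdVec_eq 3 (by simp)]

theorem spaceDiv_smul (hφ : DifferentiableAt ℝ φ p) (hV : DifferentiableAt ℝ V p) :
    spaceDiv (fun x => φ x • V x) p = dot (grad φ p) (V p) + φ p * spaceDiv V p := by
  simp (disch := fun_prop) only [spaceDiv, pdVec, Pi.smul_apply, smul_eq_mul, pd_mul, dot, grad]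
  ring

theorem spaceDiv_add (hV : DifferentiableAt ℝ V p) (hW : DifferentiableAt ℝ W p) :
    spaceDiv (fun x => V x + W x) p = spaceDiv V p + spaceDiv W p := by
  simp (disch := fun_prop) only [spaceDiv, pdVec, Pi.add_apply, pd_add]
  ring

theorem spaceDiv_cross (hV : DifferentiableAt ℝ V p) (hW : DifferentiableAt ℝ W p) :
    spaceDiv (fun x => cross (V x) (W x)) p = dot (curl V p) (W p) - dot (V p) (curl W p) := by
  simp only [spaceDiv, pdVec_cross hV hW]
  simp [cross, curl, dot]
  ring

theorem cross_curl_sub_curl_cross (hV : DifferentiableAt ℝ V p) (ha : a ≠ 0) :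
    cross p (curl V p) a - curl (fun x => cross x (V x)) p a
      = grad (fun x => dot x (V x)) p a + V p a - spaceDiv V p * p a := by
  simp only [grad, pd_dot differentiableAt_fun_id hV, curl, pdVec_cross differentiableAt_fun_id hV,
    pdVec_coord, spaceDiv]
  fin_cases a <;> simp [cross, dot] at ha ⊢ <;> ring

theorem spaceDiv_curl {s : Set Pt} (hs : IsOpen s) (hV : ContDiffOn ℝ ∞ V s) (hp : p ∈ s) :
    spaceDiv (curl V) p = 0 := by
  have hV' : ∀ b, ContDiffOn ℝ ∞ (fun x => V x b) s := fun b => by fun_prop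
  have hd : ∀ a b, DifferentiableAt ℝ (pd a (fun x => V x b)) p := fun a b =>
    ((contDiffOn_pd hs (hV' b)).contDiffAt (hs.mem_nhds hp)).differentiableAt (by simp)
  simp only [spaceDiv, pdVec, curl, Matrix.cons_val]
  simp only [pd_sub (hd _ _) (hd _ _), pd_comm (a := 2) (b := 1) hs (hV' _) hp,
    pd_comm (a := 3) (b := 1) hs (hV' _) hp, pd_comm (a := 3) (b := 2) hs (hV' _) hp]
  ring

end VectorFields

/-! ### The radius and the radial unit vector -/

theorem rad_sq (p : Pt) : rad p ^ 2 = p 1 ^ 2 + p 2 ^ 2 + p 3 ^ 2 :=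
  Real.sq_sqrt (by positivity)

theorem rad_nonneg (p : Pt) : 0 ≤ rad p := Real.sqrt_nonneg _

theorem continuous_rad : Continuous rad := by unfold rad; fun_prop

theorem isOpen_exterior (M : ℝ) : IsOpen (exterior M) :=
  isOpen_lt continuous_const continuous_rad

theorem differentiableAt_of_contDiffOn_exterior {M : ℝ} {V : Type*} [NormedAddCommGroup V]
    [NormedSpace ℝ V] {f : Pt → V} (hf : ContDiffOn ℝ ∞ f (exterior M)) {p : Pt}
    (hp : p ∈ exterior M) : DifferentiableAt ℝ f p :=
  (hf.contDiffAt ((isOpen_exterior M).mem_nhds hp)).differentiableAt (by simp)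

theorem rad_pos {M : ℝ} (hM : 0 < M) {p : Pt} (hp : p ∈ exterior M) : 0 < rad p := by
  have : 2 * M < rad p := hp
  linarith

/-- The radial unit vector `n = ∂_r`, with vanishing time component. -/
def normal (p : Pt) (a : Fin 4) : ℝ := if a = 0 then 0 else p a / rad p

/-- The radial component `n · w` of the spatial part of `w`. -/
def radial (p : Pt) (w : Fin 4 → ℝ) : ℝ := dot (normal p) w

/-- The projection `π_{ab} = δ_{ij} - n_i n_j` to the tangent spaces of the spheres. -/
def sphProj (p : Pt) (a b : Fin 4) : ℝ :=
  (if a = b ∧ a ≠ 0 then 1 else 0) - normal p a * normal p b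

theorem normal_zero (p : Pt) : normal p 0 = 0 := rfl

theorem radial_eq (p : Pt) (w : Fin 4 → ℝ) :
    radial p w = normal p 1 * w 1 + normal p 2 * w 2 + normal p 3 * w 3 := rfl

theorem radial_add (p : Pt) (v w : Fin 4 → ℝ) : radial p (v + w) = radial p v + radial p w :=
  dot_add _ _ _

theorem radial_smul (p : Pt) (k : ℝ) (w : Fin 4 → ℝ) : radial p (k • w) = k * radial p w :=
  dot_smul _ _ _

section Radius

variable {p : Pt}

theorem contDiffAt_rad (h : rad p ≠ 0) : ContDiffAt ℝ ∞ rad p := by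
  unfold rad
  refine ContDiffAt.sqrt (by fun_prop) ?_
  rw [← rad_sq]; positivity

theorem differentiableAt_rad (h : rad p ≠ 0) : DifferentiableAt ℝ rad p :=
  (contDiffAt_rad h).differentiableAt (by simp)

theorem normal_sq (h : rad p ≠ 0) : normal p 1 ^ 2 + normal p 2 ^ 2 + normal p 3 ^ 2 = 1 := by
  simp only [normal, Fin.reduceEq, if_false]
  field_simp
  exact (rad_sq p).symm

theorem radial_normal (h : rad p ≠ 0) : radial p (normal p) = 1 := by
  rw [radial_eq, ← normal_sq h]; ring

theorem coord_eq (h : rad p ≠ 0) {a : Fin 4} (ha : a ≠ 0) : p a = rad p * normal p a := by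
  rw [normal, if_neg ha]; field_simp

theorem dot_coord (h : rad p ≠ 0) (w : Fin 4 → ℝ) : dot p w = rad p * radial p w := by
  rw [dot_comm, dot_congr (w' := rad p • normal p) fun a ha => coord_eq h ha, dot_smul, dot_comm,
    radial]

theorem cross_coord (h : rad p ≠ 0) (w : Fin 4 → ℝ) : cross p w = rad p • cross (normal p) w := by
  ext a
  fin_cases a <;>
    simp [cross, coord_eq h (a := 1), coord_eq h (a := 2), coord_eq h (a := 3)] <;> ring

theorem radial_cross_coord (h : rad p ≠ 0) (w : Fin 4 → ℝ) : radial p (cross p w) = 0 := by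
  rw [cross_coord h, radial_smul, radial, dot_cross_self, mul_zero]

theorem pd_rad (h : rad p ≠ 0) (a : Fin 4) : pd a rad p = normal p a := by
  have hd := differentiableAt_rad h
  have pd_sq : pd a (fun x => rad x * rad x) p = 2 * rad p * pd a rad p := by
    rw [pd_mul hd hd]; ring
  have rad_mul_self : (fun x => rad x * rad x) = fun x => dot x x := by
    funext x; rw [← sq, rad_sq, dot]; ring
  have pd_dot_self : pd a (fun x => dot x x) p = 2 * dot p (pdVec a (fun x => x) p) := by
    rw [pd_dot differentiableAt_fun_id differentiableAt_fun_id, dot_comm]; ring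
  have dot_single : dot p (Pi.single a 1) = rad p * normal p a := by
    fin_cases a <;> simp [dot, normal] <;> field_simp
  rw [rad_mul_self, pd_dot_self, pdVec_coord, dot_single] at pd_sq
  linear_combination (norm := (field_simp; ring)) -(2 * rad p)⁻¹ * pd_sq

theorem pd_comp_rad {φ : ℝ → ℝ} {φ' : ℝ} (h : rad p ≠ 0) (hφ : HasDerivAt φ φ' (rad p))
    (a : Fin 4) : pd a (fun x => φ (rad x)) p = φ' * normal p a := by
  rw [pd_comp hφ (differentiableAt_rad h), pd_rad h]

theorem contDiffAt_normal (h : rad p ≠ 0) : ContDiffAt ℝ ∞ normal p := by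
  refine contDiffAt_pi.2 fun a => ?_
  unfold normal
  split_ifs
  · exact contDiffAt_const
  · exact ContDiffAt.div (by fun_prop) (contDiffAt_rad h) h

theorem differentiableAt_normal (h : rad p ≠ 0) : DifferentiableAt ℝ normal p :=
  (contDiffAt_normal h).differentiableAt (by simp)

theorem pd_normal (h : rad p ≠ 0) (a b : Fin 4) :
    pd a (fun x => normal x b) p = sphProj p a b / rad p := by
  rw [sphProj]
  by_cases hb : b = 0
  · subst hb
    simp only [normal_zero, pd_const]
    by_cases ha : a = 0 <;> simp [ha]
  · have hn : (fun x => normal x b) = fun x => x b * (rad x)⁻¹ := by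
      funext x; rw [normal, if_neg hb]; rfl
    have hi : DifferentiableAt ℝ (fun x => (rad x)⁻¹) p := (differentiableAt_rad h).inv h
    rw [hn, pd_mul (by fun_prop) hi, pd_coord, pd_inv (differentiableAt_rad h) h, pd_rad h,
      coord_eq h hb]
    by_cases hab : a = b
    · subst hab; simp only [if_true, hb, ne_eq, not_false_eq_true, and_true]; field_simp; ring
    · simp only [hab, Ne.symm hab, if_false, false_and]; field_simp; ring

theorem differentiableAt_radial (h : rad p ≠ 0) {V : Pt → Fin 4 → ℝ}
    (hV : DifferentiableAt ℝ V p) : DifferentiableAt ℝ (fun x => radial x (V x)) p := by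
  have := differentiableAt_normal h
  unfold radial dot
  fun_prop

theorem pd_radial (h : rad p ≠ 0) {V : Pt → Fin 4 → ℝ} (hV : DifferentiableAt ℝ V p)
    (a : Fin 4) :
    pd a (fun x => radial x (V x)) p
      = radial p (pdVec a V p) + dot (sphProj p a) (V p) / rad p := by
  have hn := differentiableAt_normal h
  simp only [radial]
  rw [pd_dot hn hV]
  simp only [dot, pdVec, pd_normal h]
  ring

end Radius

section Exterior

variable {M : ℝ} {p : Pt}

theorem contDiffOn_rad (hM : 0 < M) : ContDiffOn ℝ ∞ rad (exterior M) :=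
  fun _ hp => (contDiffAt_rad (rad_pos hM hp).ne').contDiffWithinAt

theorem contDiffOn_normal (hM : 0 < M) : ContDiffOn ℝ ∞ normal (exterior M) :=
  fun _ hp => (contDiffAt_normal (rad_pos hM hp).ne').contDiffWithinAt

/-- The function `f = 1 - 2M/r`. -/
def lapse (M : ℝ) (p : Pt) : ℝ := 1 - 2 * M / rad p

theorem lapse_pos (hM : 0 < M) (hp : p ∈ exterior M) : 0 < lapse M p := by
  rw [lapse, sub_pos, div_lt_one (rad_pos hM hp)]
  exact hp

theorem contDiffOn_lapse (hM : 0 < M) : ContDiffOn ℝ ∞ (lapse M) (exterior M) :=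
  contDiffOn_const.sub (contDiffOn_const.div (contDiffOn_rad hM) fun _ hp => (rad_pos hM hp).ne')

theorem differentiableAt_lapse (h : rad p ≠ 0) : DifferentiableAt ℝ (lapse M) p := by
  have : DifferentiableAt ℝ (fun x => (rad x)⁻¹) p := (differentiableAt_rad h).inv h
  change DifferentiableAt ℝ (fun x => 1 - 2 * M * (rad x)⁻¹) p
  fun_prop

theorem pd_lapse (h : rad p ≠ 0) (a : Fin 4) :
    pd a (lapse M) p = (1 - lapse M p) / rad p * normal p a := by
  have : HasDerivAt (fun r : ℝ => 1 - 2 * M / r) ((1 - lapse M p) / rad p) (rad p) :=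
    (((hasDerivAt_inv h).const_mul (2 * M)).const_sub 1).congr_deriv (by
      rw [lapse]; field_simp; ring)
  exact pd_comp_rad h this a

theorem differentiableAt_lapse_inv (hM : 0 < M) (hp : p ∈ exterior M) :
    DifferentiableAt ℝ (fun x => (lapse M x)⁻¹) p :=
  (differentiableAt_lapse (rad_pos hM hp).ne').inv (lapse_pos hM hp).ne'

theorem pd_lapse_inv (hM : 0 < M) (hp : p ∈ exterior M) (a : Fin 4) :
    pd a (fun x => (lapse M x)⁻¹) p
      = -(lapse M p)⁻¹ ^ 2 * ((1 - lapse M p) / rad p) * normal p a := by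
  have h := (rad_pos hM hp).ne'
  rw [pd_inv (differentiableAt_lapse h) (lapse_pos hM hp).ne', pd_lapse h]
  field_simp

end Exterior

/-! ### The metric and its connection -/

section Metric

variable {M : ℝ} {p : Pt}

theorem metric_apply (h : rad p ≠ 0) (a b : Fin 4) :
    metric M p a b = lapse M p * (if a = 0 ∧ b = 0 then 1 else 0)
      - (if a = b ∧ a ≠ 0 then 1 else 0) + (1 - (lapse M p)⁻¹) * (normal p a * normal p b) := by
  simp only [metric, Matrix.of_apply, pd_rad h, lapse]; ring

theorem metric_mulVec (h : rad p ≠ 0) (w : Fin 4 → ℝ) (a : Fin 4) :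
    (metric M p).mulVec w a =
      if a = 0 then lapse M p * w 0
      else -w a + (1 - (lapse M p)⁻¹) * (normal p a * radial p w) := by
  simp only [Matrix.mulVec, dotProduct, metric_apply h, Fin.sum_univ_four, radial_eq]
  fin_cases a <;> simp [normal_zero] <;> ring

theorem metric_comm (a b : Fin 4) : metric M p a b = metric M p b a := by
  by_cases hab : a = b
  · rw [hab]
  · simp only [metric, Matrix.of_apply, hab, Ne.symm hab, false_and, and_comm (a := a = 0),
      mul_comm (pd a rad p)]

theorem det_metric (hM : 0 < M) (hp : p ∈ exterior M) : (metric M p).det = -1 := by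
  have h := (rad_pos hM hp).ne'
  have hn := normal_sq h
  have hff : lapse M p * (lapse M p)⁻¹ = 1 := mul_inv_cancel₀ (lapse_pos hM hp).ne'
  rw [Matrix.det_succ_row_zero]
  simp only [Fin.sum_univ_four, Matrix.det_fin_three, Matrix.submatrix_apply, metric_apply h]
  generalize (lapse M p)⁻¹ = g at *
  simp [Fin.succAbove, normal_zero]
  linear_combination (lapse M p * (1 - g)) * hn - hff

theorem sqrt_det_metric (hM : 0 < M) (hp : p ∈ exterior M) :
    Real.sqrt |(metric M p).det| = 1 := by
  simp [det_metric hM hp]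

theorem metric_mul_invMetric (hM : 0 < M) (hp : p ∈ exterior M) :
    metric M p * invMetric M p = 1 :=
  Matrix.mul_nonsing_inv _ (by simp [det_metric hM hp])

theorem invMetric_mul_metric (hM : 0 < M) (hp : p ∈ exterior M) :
    invMetric M p * metric M p = 1 :=
  Matrix.nonsing_inv_mul _ (by simp [det_metric hM hp])

theorem invMetric_mulVec (hM : 0 < M) (hp : p ∈ exterior M) (w : Fin 4 → ℝ) (a : Fin 4) :
    (invMetric M p).mulVec w a =
      if a = 0 then (lapse M p)⁻¹ * w 0
      else -w a + (1 - lapse M p) * (normal p a * radial p w) := by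
  have h := (rad_pos hM hp).ne'
  have hf := (lapse_pos hM hp).ne'
  set v : Fin 4 → ℝ := fun a => if a = 0 then (lapse M p)⁻¹ * w 0
    else -w a + (1 - lapse M p) * (normal p a * radial p w) with hv
  have radial_v : radial p v = -lapse M p * radial p w := by
    have hn := normal_sq h
    rw [radial_eq p v]
    simp only [hv, Fin.reduceEq, if_false]
    linear_combination (1 - lapse M p) * radial p w * hn + radial_eq p w
  have metric_v : (metric M p).mulVec v = w := by
    ext b
    rw [metric_mulVec h, radial_v]
    by_cases hb : b = 0
    · simp only [hb, hv, if_true]; field_simp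
    · simp only [hb, hv, if_false]; field_simp; ring
  rw [← metric_v, Matrix.mulVec_mulVec, invMetric_mul_metric hM hp, Matrix.one_mulVec, metric_v]

theorem sum_invMetric_mul (hM : 0 < M) (hp : p ∈ exterior M) (w : Fin 4 → ℝ) (a : Fin 4) :
    ∑ b, invMetric M p a b * w b = if a = 0 then (lapse M p)⁻¹ * w 0
      else -w a + (1 - lapse M p) * (normal p a * radial p w) :=
  invMetric_mulVec hM hp w a

theorem differentiableAt_metric (hM : 0 < M) (hp : p ∈ exterior M) (a b : Fin 4) :
    DifferentiableAt ℝ (fun x => metric M x a b) p := by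
  have h := (rad_pos hM hp).ne'
  have hf := differentiableAt_lapse (M := M) h
  have hg := differentiableAt_lapse_inv hM hp
  have hn := differentiableAt_normal h
  have : (fun x => metric M x a b) =ᶠ[nhds p] fun x =>
      lapse M x * (if a = 0 ∧ b = 0 then 1 else 0)
        - (if a = b ∧ a ≠ 0 then 1 else 0)
        + (1 - (lapse M x)⁻¹) * (normal x a * normal x b) := by
    filter_upwards [(isOpen_exterior M).mem_nhds hp] with x hx
      using metric_apply (rad_pos hM hx).ne' a b
  rw [this.differentiableAt_iff]
  fun_prop

theorem pd_metric (hM : 0 < M) (hp : p ∈ exterior M) (c a b : Fin 4) :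
    pd c (fun x => metric M x a b) p =
      (1 - lapse M p) / rad p * normal p c *
        ((if a = 0 ∧ b = 0 then 1 else 0) + (lapse M p)⁻¹ ^ 2 * (normal p a * normal p b))
      + (1 - (lapse M p)⁻¹) / rad p *
        (sphProj p c a * normal p b + normal p a * sphProj p c b) := by
  have h := (rad_pos hM hp).ne'
  have hg := differentiableAt_lapse_inv hM hp
  have hf := differentiableAt_lapse (M := M) h
  have hn := differentiableAt_normal h
  rw [pd_congr (isOpen_exterior M) hp fun x hx => metric_apply (rad_pos hM hx).ne' a b]
  simp (disch := fun_prop) only [pd_add, pd_sub, pd_mul, pd_const, pd_normal h, pd_lapse h,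
    pd_lapse_inv hM hp]
  ring

theorem sum_invMetric_mul_mul (hM : 0 < M) (hp : p ∈ exterior M) (v w : Fin 4 → ℝ) :
    ∑ a, ∑ b, invMetric M p a b * (v a * w b)
      = (lapse M p)⁻¹ * (v 0 * w 0) - dot v w + (1 - lapse M p) * (radial p v * radial p w) := by
  simp only [mul_left_comm _ (v _), ← Finset.mul_sum, sum_invMetric_mul hM hp, Fin.sum_univ_four,
    Fin.reduceEq, if_true, if_false, dot, radial_eq p v]
  ring

theorem radial_sphProj (h : rad p ≠ 0) (c : Fin 4) : radial p (sphProj p c) = 0 := by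
  have hn := normal_sq h
  simp only [radial_eq, sphProj]
  fin_cases c <;> simp [normal_zero] <;> grind

theorem sum_invMetric_mul_pd_metric (hM : 0 < M) (hp : p ∈ exterior M) (c : Fin 4) :
    ∑ a, ∑ b, invMetric M p a b * pd c (fun x => metric M x a b) p = 0 := by
  have h := (rad_pos hM hp).ne'
  have hf := (lapse_pos hM hp).ne'
  have pd_metric_split (a b : Fin 4) : invMetric M p a b * pd c (fun x => metric M x a b) p
      = (1 - lapse M p) / rad p * normal p c *
          (invMetric M p a b * ((if a = 0 then 1 else 0) * (if b = 0 then 1 else 0)))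
        + (1 - lapse M p) / rad p * normal p c * (lapse M p)⁻¹ ^ 2 *
          (invMetric M p a b * (normal p a * normal p b))
        + (1 - (lapse M p)⁻¹) / rad p * (invMetric M p a b * (sphProj p c a * normal p b))
        + (1 - (lapse M p)⁻¹) / rad p * (invMetric M p a b * (normal p a * sphProj p c b)) := by
    rw [pd_metric hM hp, ite_and]
    split_ifs <;> ring
  simp only [pd_metric_split, Finset.sum_add_distrib, ← Finset.mul_sum]
  simp only [sum_invMetric_mul_mul hM hp, radial_sphProj h, radial_normal h, normal_zero,
    ← radial.eq_def, dot_comm _ (normal p)]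
  simp [dot, radial_eq]
  field_simp
  ring

end Metric

/-- The matrix `Γ_c` of the connection coefficients `Γ^a_{cb}` for the direction `c`. -/
def connMatrix (M : ℝ) (p : Pt) (c : Fin 4) : Matrix (Fin 4) (Fin 4) ℝ :=
  Matrix.of fun a b => christoffel M p a c b

/-- The entrywise coordinate derivative `∂_c A` of a matrix-valued function. -/
def pdMatrix (c : Fin 4) (A : Pt → Matrix (Fin 4) (Fin 4) ℝ) (p : Pt) :
    Matrix (Fin 4) (Fin 4) ℝ :=
  Matrix.of fun a b => pd c (fun x => A x a b) p

section MatrixCalculus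

variable {A B : Pt → Matrix (Fin 4) (Fin 4) ℝ} {V : Pt → Fin 4 → ℝ} {p : Pt} {s : Set Pt}

theorem pdMatrix_congr (hs : IsOpen s) (hp : p ∈ s) (h : ∀ x ∈ s, A x = B x) (c : Fin 4) :
    pdMatrix c A p = pdMatrix c B p := by
  ext a b
  exact pd_congr hs hp fun x hx => by rw [h x hx]

theorem pdMatrix_mul (hA : ∀ a b, DifferentiableAt ℝ (fun x => A x a b) p)
    (hB : ∀ a b, DifferentiableAt ℝ (fun x => B x a b) p) (c : Fin 4) :
    pdMatrix c (fun x => A x * B x) p = pdMatrix c A p * B p + A p * pdMatrix c B p := by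
  ext a b
  simp only [pdMatrix, Matrix.mul_apply, Matrix.of_apply, Matrix.add_apply]
  rw [pd_sum fun i _ => (hA a i).fun_mul (hB i b)]
  simp only [pd_mul (hA _ _) (hB _ _), Finset.sum_add_distrib]

theorem pdVec_mulVec (hA : ∀ a b, DifferentiableAt ℝ (fun x => A x a b) p)
    (hV : ∀ a, DifferentiableAt ℝ (fun x => V x a) p) (c : Fin 4) :
    pdVec c (fun x => (A x).mulVec (V x)) p
      = (pdMatrix c A p).mulVec (V p) + (A p).mulVec (pdVec c V p) := by
  ext a
  simp only [pdVec, pdMatrix, Matrix.mulVec, dotProduct, Matrix.of_apply, Pi.add_apply]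
  rw [pd_sum fun i _ => (hA a i).fun_mul (hV i)]
  simp only [pd_mul (hA _ _) (hV _), Finset.sum_add_distrib]

end MatrixCalculus

section Connection

variable {M : ℝ} {p : Pt}

theorem christoffel_comm (c a b : Fin 4) : christoffel M p c a b = christoffel M p c b a := by
  simp only [christoffel, metric_comm a b]
  exact congrArg _ (Finset.sum_congr rfl fun d _ => by ring)

theorem metric_mul_connMatrix (hM : 0 < M) (hp : p ∈ exterior M) (a b c : Fin 4) :
    (metric M p * connMatrix M p c) a b = 1 / 2 *
      (pd c (fun x => metric M x b a) p + pd b (fun x => metric M x c a) p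
        - pd a (fun x => metric M x c b) p) := by
  set S : Fin 4 → ℝ := fun d => 1 / 2 *
    (pd c (fun x => metric M x b d) p + pd b (fun x => metric M x c d) p
      - pd d (fun x => metric M x c b) p)
  have christoffel_eq : (fun d => connMatrix M p c d b) = (invMetric M p).mulVec S := by
    ext d
    simp only [connMatrix, christoffel, Matrix.of_apply, Finset.mul_sum, Matrix.mulVec,
      dotProduct, S]
    exact Finset.sum_congr rfl fun e _ => by ring
  calc (metric M p * connMatrix M p c) a b
      = (metric M p).mulVec (fun d => connMatrix M p c d b) a := rfl
    _ = S a := by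
      rw [christoffel_eq, Matrix.mulVec_mulVec, metric_mul_invMetric hM hp, Matrix.one_mulVec]

theorem pdMatrix_metric (hM : 0 < M) (hp : p ∈ exterior M) (c : Fin 4) :
    pdMatrix c (metric M) p
      = metric M p * connMatrix M p c + (connMatrix M p c).transpose * metric M p := by
  have metric_transpose : (metric M p).transpose = metric M p := by
    ext a b; exact metric_comm b a
  nth_rw 2 [← metric_transpose]
  rw [← Matrix.transpose_mul]
  ext a b
  rw [Matrix.add_apply, Matrix.transpose_apply, metric_mul_connMatrix hM hp,
    metric_mul_connMatrix hM hp]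
  simp only [pdMatrix, Matrix.of_apply, metric_comm b a, metric_comm c]
  ring

theorem sum_christoffel_self (hM : 0 < M) (hp : p ∈ exterior M) (c : Fin 4) :
    ∑ a, christoffel M p a a c = 0 := by
  have swap : ∑ a, ∑ b, invMetric M p a b * pd a (fun x => metric M x c b) p
      = ∑ a, ∑ b, invMetric M p a b * pd b (fun x => metric M x a c) p := by
    rw [Finset.sum_comm]
    simp only [invMetric_symm M p, metric_comm c]
  have trace := sum_invMetric_mul_pd_metric hM hp c
  simp only [christoffel, ← Finset.mul_sum, mul_sub, mul_add, Finset.sum_sub_distrib,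
    Finset.sum_add_distrib, swap, trace]
  ring

theorem nabla1_metric_mulVec (hM : 0 < M) (hp : p ∈ exterior M) {w J : Pt → Fin 4 → ℝ}
    (hw : ∀ x ∈ exterior M, w x = (metric M x).mulVec (J x))
    (hJ : ∀ a, DifferentiableAt ℝ (fun x => J x a) p) (b : Fin 4) :
    nabla1 M w p b = (metric M p).mulVec (pdVec b J p + (connMatrix M p b).mulVec (J p)) := by
  have nabla1_eq : nabla1 M w p b = pdVec b w p - (connMatrix M p b).transpose.mulVec (w p) := rfl
  have pdVec_w : pdVec b w p = pdVec b (fun x => (metric M x).mulVec (J x)) p :=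
    funext fun a => pd_congr (isOpen_exterior M) hp fun x hx => by rw [hw x hx]
  rw [nabla1_eq, pdVec_w, pdVec_mulVec (differentiableAt_metric hM hp) hJ,
    pdMatrix_metric hM hp, hw p hp, Matrix.add_mulVec, Matrix.mulVec_add]
  simp only [← Matrix.mulVec_mulVec]
  abel

theorem div1_eq_sum_pd (hM : 0 < M) (hp : p ∈ exterior M) {w J : Pt → Fin 4 → ℝ}
    (hw : ∀ x ∈ exterior M, w x = (metric M x).mulVec (J x))
    (hJ : ∀ a, DifferentiableAt ℝ (fun x => J x a) p) :
    div1 M w p = ∑ a, pd a (fun x => J x a) p := by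
  have raise (a : Fin 4) : ∑ b, invMetric M p a b * nabla1 M w p a b
      = pd a (fun x => J x a) p + ∑ d, christoffel M p a a d * J p d := by
    rw [nabla1_metric_mulVec hM hp hw hJ]
    change (invMetric M p).mulVec ((metric M p).mulVec _) a = _
    rw [Matrix.mulVec_mulVec, invMetric_mul_metric hM hp, Matrix.one_mulVec]
    rfl
  simp only [div1, raise, Finset.sum_add_distrib]
  rw [Finset.sum_comm]
  simp only [← Finset.sum_mul, sum_christoffel_self hM hp, zero_mul, Finset.sum_const_zero,
    add_zero]

theorem nabla2_metric_mul (hM : 0 < M) (hp : p ∈ exterior M) {w : Pt → Fin 4 → Fin 4 → ℝ}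
    {W : Pt → Matrix (Fin 4) (Fin 4) ℝ}
    (hw : ∀ x ∈ exterior M, Matrix.of (w x) = metric M x * W x * metric M x)
    (hW : ∀ a b, DifferentiableAt ℝ (fun x => W x a b) p) (c : Fin 4) :
    Matrix.of (nabla2 M w p c) = metric M p *
      (pdMatrix c W p + connMatrix M p c * W p + W p * (connMatrix M p c).transpose)
        * metric M p := by
  have hg := differentiableAt_metric hM hp
  have hgW (a b : Fin 4) : DifferentiableAt ℝ (fun x => (metric M x * W x) a b) p := by
    simp only [Matrix.mul_apply]
    exact DifferentiableAt.fun_sum fun i _ => (hg a i).fun_mul (hW i b)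
  have nabla2_eq : Matrix.of (nabla2 M w p c)
      = pdMatrix c (fun x => Matrix.of (w x)) p - (connMatrix M p c).transpose * Matrix.of (w p)
        - Matrix.of (w p) * connMatrix M p c := by
    ext a b
    simp only [nabla2, pdMatrix, connMatrix, Matrix.of_apply, Matrix.sub_apply, Matrix.mul_apply,
      Matrix.transpose_apply, Finset.sum_add_distrib, mul_comm (w p a _)]
    ring
  rw [nabla2_eq, pdMatrix_congr (isOpen_exterior M) hp hw, pdMatrix_mul hgW hg,
    pdMatrix_mul hg hW, pdMatrix_metric hM hp, hw p hp]
  noncomm_ring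

theorem div2_eq_mulVec_sum_pd (hM : 0 < M) (hp : p ∈ exterior M) {w : Pt → Fin 4 → Fin 4 → ℝ}
    {W : Pt → Matrix (Fin 4) (Fin 4) ℝ}
    (hw : ∀ x ∈ exterior M, Matrix.of (w x) = metric M x * W x * metric M x)
    (hW : ∀ a b, DifferentiableAt ℝ (fun x => W x a b) p)
    (antisymm : (W p).transpose = -W p) :
    div2 M w p = (metric M p).mulVec fun d => ∑ b, pd b (fun x => W x d b) p := by
  have raise (a b : Fin 4) : ∑ c, invMetric M p b c * nabla2 M w p b a c
      = ∑ d, metric M p a d * (pd b (fun x => W x d b) p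
          + ∑ e, christoffel M p d b e * W p e b + ∑ e, W p d e * christoffel M p b b e) := by
    calc ∑ c, invMetric M p b c * nabla2 M w p b a c
        = (Matrix.of (nabla2 M w p b) * invMetric M p) a b := by
          simp only [Matrix.mul_apply, Matrix.of_apply, mul_comm, invMetric_symm M p b]
      _ = (metric M p * (pdMatrix b W p + connMatrix M p b * W p
            + W p * (connMatrix M p b).transpose)) a b := by
          rw [nabla2_metric_mul hM hp hw hW, Matrix.mul_assoc, metric_mul_invMetric hM hp,
            Matrix.mul_one]
  have christoffel_antisymm (d : Fin 4) : ∑ b, ∑ e, christoffel M p d b e * W p e b = 0 := by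
    have swap : ∑ b, ∑ e, christoffel M p d b e * W p e b
        = -∑ b, ∑ e, christoffel M p d b e * W p e b := by
      nth_rw 1 [Finset.sum_comm]
      simp only [← Finset.sum_neg_distrib]
      refine Finset.sum_congr rfl fun b _ => Finset.sum_congr rfl fun e _ => ?_
      have := congrFun (congrFun antisymm e) b
      rw [Matrix.transpose_apply, Matrix.neg_apply] at this
      rw [this, christoffel_comm]; ring
    linarith
  ext a
  simp only [div2, raise, Matrix.mulVec, dotProduct]
  rw [Finset.sum_comm]
  refine Finset.sum_congr rfl fun d _ => ?_
  rw [← Finset.mul_sum, Finset.sum_add_distrib, Finset.sum_add_distrib, christoffel_antisymm,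
    Finset.sum_comm (f := fun b e => W p d e * christoffel M p b b e)]
  simp only [← Finset.mul_sum, sum_christoffel_self hM hp, mul_zero, Finset.sum_const_zero,
    add_zero]

end Connection

/-! ### Two-forms as pairs of spatial vectors -/

/-- The `2`-tensor `w` with `w_{0i} = e_i` and `w_{ij} = ε_{ijk} b_k`. -/
def twoForm (e b : Fin 4 → ℝ) : Fin 4 → Fin 4 → ℝ :=
  ![![0, e 1, e 2, e 3], ![-e 1, 0, b 3, -b 2], ![-e 2, -b 3, 0, b 1], ![-e 3, b 2, -b 1, 0]]

/-- The map `w ↦ f⁻¹ (w - (n · w) n) + (n · w) n`, which turns the electric and magnetic vectors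
of a `2`-form into those of its index-raised dual. -/
def stretch (M : ℝ) (p : Pt) (w : Fin 4 → ℝ) : Fin 4 → ℝ :=
  (lapse M p)⁻¹ • w + ((1 - (lapse M p)⁻¹) * radial p w) • normal p

/-- The `2`-form with electric vector `e` and magnetic vector `c`, i.e. with `w_{0i} = e_i` and
`(*w)_{0i} = c_i`. -/
def emForm (M : ℝ) (p : Pt) (e c : Fin 4 → ℝ) : Fin 4 → Fin 4 → ℝ := twoForm e (stretch M p c)

theorem permSymbol_eq (a b c d : Fin 4) : 12 * permSymbol a b c d =
    ((b.val : ℤ) - a.val) * ((c.val : ℤ) - a.val) * ((d.val : ℤ) - a.val) * ((c.val : ℤ) - b.val)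
      * ((d.val : ℤ) - b.val) * ((d.val : ℤ) - c.val) := by
  revert a b c d
  decide +kernel

theorem permSymbol_cast (a b c d : Fin 4) : (permSymbol a b c d : ℝ) =
    ((b.val : ℝ) - a.val) * ((c.val : ℝ) - a.val) * ((d.val : ℝ) - a.val) * ((c.val : ℝ) - b.val)
      * ((d.val : ℝ) - b.val) * ((d.val : ℝ) - c.val) / 12 := by
  have := congrArg (fun z : ℤ => (z : ℝ)) (permSymbol_eq a b c d)
  push_cast at this
  linarith

section TwoForms

variable {M : ℝ} {p : Pt}

theorem stretch_apply (w : Fin 4 → ℝ) (a : Fin 4) : stretch M p w a =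
    (lapse M p)⁻¹ * w a + (1 - (lapse M p)⁻¹) * radial p w * normal p a := rfl

theorem stretch_smul (k : ℝ) (w : Fin 4 → ℝ) : stretch M p (k • w) = k • stretch M p w := by
  simp only [stretch, radial_smul, smul_add, smul_smul]
  ring_nf

theorem stretch_neg (w : Fin 4 → ℝ) : stretch M p (-w) = -stretch M p w := by
  rw [← neg_one_smul ℝ, stretch_smul, neg_one_smul]

theorem radial_stretch (h : rad p ≠ 0) (w : Fin 4 → ℝ) :
    radial p (stretch M p w) = radial p w := by
  rw [stretch, radial_add, radial_smul, radial_smul, radial_normal h]; ring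

theorem sum_raise_emForm (hM : 0 < M) (hp : p ∈ exterior M) (e c : Fin 4 → ℝ) (a b : Fin 4) :
    ∑ d, ∑ d', invMetric M p a d * invMetric M p b d' * emForm M p e c d d'
      = twoForm (-stretch M p e) c a b := by
  have hn := normal_sq (rad_pos hM hp).ne'
  have hff : lapse M p * (lapse M p)⁻¹ = 1 := mul_inv_cancel₀ (lapse_pos hM hp).ne'
  simp only [mul_assoc, ← Finset.mul_sum, sum_invMetric_mul hM hp]
  simp only [radial_eq, emForm, twoForm, stretch_apply, Pi.neg_apply]
  generalize (lapse M p)⁻¹ = g at *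
  generalize lapse M p = f at *
  fin_cases a <;> fin_cases b <;> simp <;> grind

theorem emForm_raise (hM : 0 < M) (hp : p ∈ exterior M) (e c : Fin 4 → ℝ) :
    invMetric M p * Matrix.of (emForm M p e c) * invMetric M p
      = Matrix.of (twoForm (-stretch M p e) c) := by
  ext a b
  rw [Matrix.of_apply, ← sum_raise_emForm hM hp]
  simp only [Matrix.mul_apply, Finset.sum_mul, Matrix.of_apply]
  rw [Finset.sum_comm]
  refine Finset.sum_congr rfl fun d _ => Finset.sum_congr rfl fun d' _ => ?_
  rw [invMetric_symm M p d' b]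
  ring

theorem emForm_eq_lower (hM : 0 < M) (hp : p ∈ exterior M) (e c : Fin 4 → ℝ) :
    Matrix.of (emForm M p e c)
      = metric M p * Matrix.of (twoForm (-stretch M p e) c) * metric M p := by
  rw [← emForm_raise hM hp, ← Matrix.mul_assoc, ← Matrix.mul_assoc, metric_mul_invMetric hM hp,
    Matrix.one_mul, Matrix.mul_assoc, invMetric_mul_metric hM hp, Matrix.mul_one]

theorem hodge_emForm (hM : 0 < M) (hp : p ∈ exterior M) {w : Pt → Fin 4 → Fin 4 → ℝ}
    {e c : Fin 4 → ℝ} (hw : w p = emForm M p e c) : hodge M w p = emForm M p c (-e) := by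
  ext a b
  have h1 : hodge M w p a b = (1 / 2) * ∑ c', ∑ d, (permSymbol a b c' d : ℝ)
      * ∑ e', ∑ f, invMetric M p c' e' * invMetric M p d f * emForm M p e c e' f := by
    simp only [hodge, hw, volForm, sqrt_det_metric hM hp, one_mul, Finset.mul_sum, mul_assoc]
  simp only [h1, sum_raise_emForm hM hp]
  simp only [permSymbol_cast, Fin.sum_univ_four, emForm, stretch_neg]
  fin_cases a <;> fin_cases b <;> simp [twoForm] <;> ring

theorem differentiableAt_twoForm {e b : Pt → Fin 4 → ℝ} (he : DifferentiableAt ℝ e p)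
    (hb : DifferentiableAt ℝ b p) (c d : Fin 4) :
    DifferentiableAt ℝ (fun x => twoForm (e x) (b x) c d) p := by
  have he' (i : Fin 4) : DifferentiableAt ℝ (fun x => e x i) p := by fun_prop
  have hb' (i : Fin 4) : DifferentiableAt ℝ (fun x => b x i) p := by fun_prop
  have h0 : DifferentiableAt ℝ (fun _ : Pt => (0 : ℝ)) p := differentiableAt_const 0
  fin_cases c <;> fin_cases d
  exacts [h0, he' 1, he' 2, he' 3, (he' 1).neg, h0, hb' 3, (hb' 2).neg, (he' 2).neg,
    (hb' 3).neg, h0, hb' 1, (he' 3).neg, hb' 2, (hb' 1).neg, h0]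

theorem sum_pd_twoForm {e b : Pt → Fin 4 → ℝ} (d : Fin 4) :
    ∑ a, pd a (fun x => twoForm (-e x) (b x) d a) p
      = if d = 0 then -spaceDiv e p else pdVec 0 e p d + curl b p d := by
  fin_cases d <;> simp [twoForm, Fin.sum_univ_four, spaceDiv, curl, pdVec, pd_neg, pd_const] <;>
    ring

theorem differentiableAt_stretch (hM : 0 < M) (hp : p ∈ exterior M) {V : Pt → Fin 4 → ℝ}
    (hV : DifferentiableAt ℝ V p) : DifferentiableAt ℝ (fun x => stretch M x (V x)) p := by
  have h := (rad_pos hM hp).ne'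
  have hg := differentiableAt_lapse_inv hM hp
  have hr := differentiableAt_radial h hV
  have hn := differentiableAt_normal h
  unfold stretch
  fun_prop

theorem div2_emForm (hM : 0 < M) (hp : p ∈ exterior M) {w : Pt → Fin 4 → Fin 4 → ℝ}
    {e c : Pt → Fin 4 → ℝ} (hw : ∀ x ∈ exterior M, w x = emForm M x (e x) (c x))
    (he : DifferentiableAt ℝ e p) (hc : DifferentiableAt ℝ c p) :
    div2 M w p = (metric M p).mulVec fun d => if d = 0 then -spaceDiv (fun x => stretch M x (e x)) p
      else pdVec 0 (fun x => stretch M x (e x)) p d + curl c p d := by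
  have hS := differentiableAt_stretch hM hp he
  have hW (a b : Fin 4) : DifferentiableAt ℝ
      (fun x => Matrix.of (twoForm (-stretch M x (e x)) (c x)) a b) p :=
    differentiableAt_twoForm hS.neg hc a b
  rw [div2_eq_mulVec_sum_pd hM hp (fun x hx => by rw [hw x hx, emForm_eq_lower hM hx]) hW]
  · exact congrArg _ (funext fun d => sum_pd_twoForm d)
  · ext a b
    fin_cases a <;> fin_cases b <;> simp [twoForm]

end TwoForms

/-! ### Maxwell's equations for electric and magnetic vectors -/

section Stretch

variable {M : ℝ} {p : Pt} {V : Pt → Fin 4 → ℝ}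

theorem dot_coord_stretch (h : rad p ≠ 0) (w : Fin 4 → ℝ) : dot p (stretch M p w) = dot p w := by
  rw [dot_coord h, dot_coord h, radial_stretch h]

theorem cross_coord_stretch (h : rad p ≠ 0) (w : Fin 4 → ℝ) :
    cross p (stretch M p w) = (lapse M p)⁻¹ • cross p w := by
  rw [cross_coord h, cross_coord h]
  ext a
  fin_cases a <;> simp [cross, stretch_apply] <;> ring

theorem pdVec_zero_stretch (hM : 0 < M) (hp : p ∈ exterior M) (hV : DifferentiableAt ℝ V p) :
    pdVec 0 (fun x => stretch M x (V x)) p = stretch M p (pdVec 0 V p) := by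
  have h := (rad_pos hM hp).ne'
  have hg := differentiableAt_lapse_inv hM hp
  have hr := differentiableAt_radial h hV
  have hn := differentiableAt_normal h
  have sphProj_zero : sphProj p 0 = 0 := by ext b; simp [sphProj, normal_zero]
  ext b
  simp (disch := fun_prop) only [pdVec, stretch_apply, pd_add, pd_mul, pd_sub, pd_const,
    pd_lapse_inv hM hp, pd_normal h, pd_radial h hV, normal_zero, sphProj_zero]
  simp [dot]

theorem spaceDiv_stretch (hM : 0 < M) (hp : p ∈ exterior M) (hV : DifferentiableAt ℝ V p) :
    spaceDiv (fun x => stretch M x (V x)) p = (lapse M p)⁻¹ * spaceDiv V p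
      + (1 - (lapse M p)⁻¹) / rad p *
        (radial p (grad (fun x => dot x (V x)) p) + radial p (V p)) := by
  have h := (rad_pos hM hp).ne'
  have hg := differentiableAt_lapse_inv hM hp
  have hr := differentiableAt_rad h
  have hd : DifferentiableAt ℝ (fun x => dot x (V x)) p := by unfold dot; fun_prop
  have stretch_eq (x : Pt) (hx : x ∈ exterior M) (a : Fin 4) (ha : a ≠ 0) : stretch M x (V x) a
      = ((lapse M x)⁻¹ • V x
        + ((1 - (lapse M x)⁻¹) * ((rad x)⁻¹ * (rad x)⁻¹ * dot x (V x))) • x) a := by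
    have hx := (rad_pos hM hx).ne'
    simp only [stretch_apply, Pi.add_apply, Pi.smul_apply, smul_eq_mul, dot_coord hx,
      coord_eq hx ha]
    field_simp
  rw [spaceDiv_congr (isOpen_exterior M) hp stretch_eq, spaceDiv_add (by fun_prop) (by fun_prop),
    spaceDiv_smul hg hV, spaceDiv_smul (by fun_prop) (by fun_prop)]
  have hgrad : dot (grad (fun x => (lapse M x)⁻¹) p) (V p)
      = -(lapse M p)⁻¹ ^ 2 * ((1 - lapse M p) / rad p) * radial p (V p) := by
    simp only [dot, grad, pd_lapse_inv hM hp, radial_eq]; ring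
  have hk : grad (fun x => (1 - (lapse M x)⁻¹) * ((rad x)⁻¹ * (rad x)⁻¹ * dot x (V x))) p
      = ((lapse M p)⁻¹ ^ 2 * ((1 - lapse M p) / rad p) * ((rad p)⁻¹ * (rad p)⁻¹ * dot p (V p))
          - 2 * (1 - (lapse M p)⁻¹) * (rad p)⁻¹ ^ 3 * dot p (V p)) • normal p
        + ((1 - (lapse M p)⁻¹) * (rad p)⁻¹ ^ 2) • grad (fun x => dot x (V x)) p := by
    ext a
    simp (disch := fun_prop) only [grad, pd_mul, pd_sub, pd_const, pd_lapse_inv hM hp,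
      pd_inv hr h, pd_rad h, Pi.add_apply, Pi.smul_apply, smul_eq_mul]
    field_simp
    ring
  have hcoord : spaceDiv (fun x => x) p = 3 := by simp [spaceDiv, pdVec_coord]; norm_num
  rw [hgrad, hk, hcoord, dot_comm _ p, dot_coord h, radial_add, radial_smul, radial_smul,
    radial_normal h, dot_coord h]
  have hf := (lapse_pos hM hp).ne'
  field_simp
  ring

end Stretch

/-- The vacuum Maxwell equations for the vectors `E_i = F_{0i}` and `C_i = (*F)_{0i}`; the
displacement and the magnetic flux of the equivalent optical medium are `stretch E` and
`stretch C`. -/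
structure MaxwellPair (M : ℝ) (E C : Pt → Fin 4 → ℝ) : Prop where
  smoothE : ContDiffOn ℝ ∞ E (exterior M)
  smoothC : ContDiffOn ℝ ∞ C (exterior M)
  divE : ∀ p ∈ exterior M, spaceDiv (fun x => stretch M x (E x)) p = 0
  divC : ∀ p ∈ exterior M, spaceDiv (fun x => stretch M x (C x)) p = 0
  curlC : ∀ p ∈ exterior M, pdVec 0 (fun x => stretch M x (E x)) p = -curl C p
  curlE : ∀ p ∈ exterior M, pdVec 0 (fun x => stretch M x (C x)) p = curl E p

theorem MaxwellPair.dual {M : ℝ} {E C : Pt → Fin 4 → ℝ} (h : MaxwellPair M E C) :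
    MaxwellPair M C (fun x => -E x) where
  smoothE := h.smoothC
  smoothC := h.smoothE.neg
  divE := h.divC
  divC p hp := by simp only [stretch_neg, spaceDiv_neg, h.divE p hp, neg_zero]
  curlC p hp := by rw [h.curlE p hp, curl_neg, neg_neg]
  curlE p hp := by simp only [stretch_neg, pdVec_neg, h.curlC p hp, neg_neg]

namespace IsMaxwellField

variable {M : ℝ} {p : Pt} {F : Pt → Fin 4 → Fin 4 → ℝ}

theorem pd_antisymm (hF : IsMaxwellField M F) (hp : p ∈ exterior M) (a b c : Fin 4) :
    pd c (fun x => F x a b) p = -pd c (fun x => F x b a) p := by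
  rw [← pd_neg, pd_congr (isOpen_exterior M) hp fun x hx => hF.antisymm x hx a b]

theorem div2_eq_zero (hF : IsMaxwellField M F) (hp : p ∈ exterior M) : div2 M F p = 0 := by
  have ha := hF.antisymm p hp
  have nabla2_antisymm (a b c : Fin 4) : nabla2 M F p c a b = -nabla2 M F p c b a := by
    simp only [nabla2, Fin.sum_univ_four]
    rw [hF.pd_antisymm hp a b c, ha a 0, ha a 1, ha a 2, ha a 3, ha b 0, ha b 1, ha b 2, ha b 3]
    ring
  ext b
  rw [Pi.zero_apply, ← neg_eq_zero, ← hF.div_eq_zero p hp b, div2, ← Finset.sum_neg_distrib,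
    Finset.sum_comm]
  refine Finset.sum_congr rfl fun a _ => ?_
  rw [← Finset.sum_neg_distrib]
  refine Finset.sum_congr rfl fun c _ => ?_
  rw [nabla2_antisymm, invMetric_symm, mul_neg, neg_neg]

theorem cyclic_pd (hF : IsMaxwellField M F) (hp : p ∈ exterior M) (a b c : Fin 4) :
    pd a (fun x => F x b c) p + pd b (fun x => F x c a) p + pd c (fun x => F x a b) p = 0 := by
  rw [← hF.closed p hp a b c]
  have ha := hF.antisymm p hp
  simp only [nabla2, Fin.sum_univ_four]
  rw [christoffel_comm 0 b a, christoffel_comm 1 b a, christoffel_comm 2 b a,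
    christoffel_comm 3 b a, christoffel_comm 0 c a, christoffel_comm 1 c a,
    christoffel_comm 2 c a, christoffel_comm 3 c a, christoffel_comm 0 c b,
    christoffel_comm 1 c b, christoffel_comm 2 c b, christoffel_comm 3 c b,
    ha a 0, ha a 1, ha a 2, ha a 3, ha b 0, ha b 1, ha b 2, ha b 3, ha c 0, ha c 1, ha c 2, ha c 3]
  ring

end IsMaxwellField

/-- The vector `b` with `F_{ij} = ε_{ijk} b_k`. -/
def magB (F : Pt → Fin 4 → Fin 4 → ℝ) (p : Pt) : Fin 4 → ℝ := ![0, F p 2 3, F p 3 1, F p 1 2]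

/-- The vector `C_i = (*F)_{0i}`. -/
def magC (M : ℝ) (F : Pt → Fin 4 → Fin 4 → ℝ) (p : Pt) : Fin 4 → ℝ :=
  lapse M p • magB F p + ((1 - lapse M p) * radial p (magB F p)) • normal p

section MaxwellField

variable {M : ℝ} {p : Pt} {F : Pt → Fin 4 → Fin 4 → ℝ}

theorem stretch_magC (hM : 0 < M) (hp : p ∈ exterior M) : stretch M p (magC M F p) = magB F p := by
  have hff : (lapse M p)⁻¹ * lapse M p = 1 := inv_mul_cancel₀ (lapse_pos hM hp).ne'
  ext a
  simp only [stretch, magC, radial_add, radial_smul, radial_normal (rad_pos hM hp).ne',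
    Pi.add_apply, Pi.smul_apply, smul_eq_mul]
  linear_combination (magB F p a - radial p (magB F p) * normal p a) * hff

theorem eq_emForm (hM : 0 < M) (hF : IsMaxwellField M F) (hp : p ∈ exterior M) :
    F p = emForm M p (F p 0) (magC M F p) := by
  have h := hF.antisymm p hp
  ext a b
  rw [emForm, stretch_magC hM hp]
  fin_cases a <;> fin_cases b <;> simp [twoForm, magB] <;> linarith [h 0 0, h 1 1, h 2 2, h 3 3,
    h 0 1, h 0 2, h 0 3, h 1 2, h 1 3, h 2 3]

theorem contDiffOn_magC (hM : 0 < M) (hF : IsMaxwellField M F) :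
    ContDiffOn ℝ ∞ (magC M F) (exterior M) := by
  have hB : ContDiffOn ℝ ∞ (magB F) (exterior M) := contDiffOn_pi.2 fun a => by
    fin_cases a
    exacts [contDiffOn_const, hF.smooth 2 3, hF.smooth 3 1, hF.smooth 1 2]
  have hn := contDiffOn_normal hM
  have hf := contDiffOn_lapse hM
  unfold magC radial dot
  fun_prop

theorem maxwellPair_of_isMaxwellField (hM : 0 < M) (hF : IsMaxwellField M F) :
    MaxwellPair M (fun p => F p 0) (magC M F) := by
  have hE : ContDiffOn ℝ ∞ (fun p => F p 0) (exterior M) := contDiffOn_pi.2 fun a => hF.smooth 0 a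
  have hC := contDiffOn_magC hM hF
  have divergence (p : Pt) (hp : p ∈ exterior M) (d : Fin 4) :
      (if d = 0 then -spaceDiv (fun x => stretch M x (F x 0)) p
        else pdVec 0 (fun x => stretch M x (F x 0)) p d + curl (magC M F) p d) = 0 := by
    have h := hF.div2_eq_zero hp
    rw [div2_emForm hM hp (fun x hx => eq_emForm hM hF hx)
      (differentiableAt_of_contDiffOn_exterior hE hp)
      (differentiableAt_of_contDiffOn_exterior hC hp)] at h
    have h' := congrArg (invMetric M p).mulVec h
    rw [Matrix.mulVec_mulVec, invMetric_mul_metric hM hp, Matrix.one_mulVec,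
      Matrix.mulVec_zero] at h'
    exact congrFun h' d
  have pdVec_stretch_magC (p : Pt) (hp : p ∈ exterior M) (a b : Fin 4) :
      pdVec a (fun x => stretch M x (magC M F x)) p b = pd a (fun x => magB F x b) p :=
    pd_congr (isOpen_exterior M) hp fun x hx => congrFun (stretch_magC hM hx) b
  refine ⟨hE, hC, fun p hp => ?_, fun p hp => ?_, fun p hp => ?_, fun p hp => ?_⟩
  · simpa using divergence p hp 0
  · rw [spaceDiv, pdVec_stretch_magC p hp, pdVec_stretch_magC p hp, pdVec_stretch_magC p hp]
    exact (add_right_comm _ _ _).trans ((add_right_comm _ _ _).trans (hF.cyclic_pd hp 1 2 3))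
  · ext d
    rcases eq_or_ne d 0 with rfl | hd
    · have h00 (x : Pt) (hx : x ∈ exterior M) : stretch M x (F x 0) 0 = 0 := by
        have := hF.antisymm x hx 0 0
        rw [stretch_apply, normal_zero, self_eq_neg.1 this]; ring
      simp [pdVec, pd_congr (isOpen_exterior M) hp h00, pd_const, curl]
    · exact eq_neg_of_add_eq_zero_left (by simpa [hd] using divergence p hp d)
  · have cyclic := hF.cyclic_pd hp 0
    have antisymm := hF.pd_antisymm hp
    ext d
    rw [pdVec_stretch_magC p hp]
    fin_cases d <;> simp [magB, curl, pdVec, pd_const] <;>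
      linarith [cyclic 2 3, cyclic 3 1, cyclic 1 2, antisymm 3 0 2, antisymm 1 0 3, antisymm 2 0 1]

end MaxwellField

/-! ### The first-order system for `Re β` and `Z` -/

/-- The tangential vector field `⅔ x × V`. In terms of the vectors `E`, `C` of a Maxwell field, `Z`
has electric vector `angular C` and magnetic vector `-angular E`. -/
def angular (V : Pt → Fin 4 → ℝ) (p : Pt) : Fin 4 → ℝ := (2 / 3 : ℝ) • cross p (V p)

/-- The function `φ = ⅓ r x · E`, a potential for `r Re β`. -/
def potential (E : Pt → Fin 4 → ℝ) (p : Pt) : ℝ := 1 / 3 * rad p * dot p (E p)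

/-- The covector field `r⁻¹ dφ` of the potential `φ = ⅓ r x · E`; it is `Re β`. -/
def potentialField (E : Pt → Fin 4 → ℝ) (p : Pt) : Fin 4 → ℝ := (rad p)⁻¹ • grad (potential E) p

/-- The field `V` is tangential to the spheres of the exterior. -/
def Tangential (M : ℝ) (V : Pt → Fin 4 → ℝ) : Prop := ∀ p ∈ exterior M, radial p (V p) = 0

/-- The spatial part of `-u^a`. -/
def raised (M : ℝ) (u : Pt → Fin 4 → ℝ) (p : Pt) : Fin 4 → ℝ :=
  u p + ((lapse M p - 1) * radial p (u p)) • normal p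

/-- The first-order system satisfied by `u = Re β` and the electric and magnetic vectors `e`, `h` of
`Z`: `r u` is closed, `e` and `h` are tangential, and `u = -½ U · Z - ½ ∇ · Z`. -/
structure WaveSystem (M : ℝ) (u e h : Pt → Fin 4 → ℝ) : Prop where
  smooth_u : ContDiffOn ℝ ∞ u (exterior M)
  smooth_e : ContDiffOn ℝ ∞ e (exterior M)
  smooth_h : ContDiffOn ℝ ∞ h (exterior M)
  tangential_e : Tangential M e
  tangential_h : Tangential M h
  closed : ∀ p ∈ exterior M, ∀ a b,
    pdVec a u p b - pdVec b u p a = (normal p b * u p a - normal p a * u p b) / rad p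
  time : ∀ p ∈ exterior M, u p 0 = 1 / 2 * spaceDiv e p
  space : ∀ p ∈ exterior M, ∀ a, a ≠ 0 → raised M u p a
    = ((1 / 2 : ℝ) • ((lapse M p)⁻¹ • pdVec 0 e p + curl h p - (rad p ^ 2)⁻¹ • cross p (h p))) a

section Tangential

variable {M : ℝ} {p : Pt} {V : Pt → Fin 4 → ℝ}

theorem Tangential.radial_pdVec (hV : Tangential M V) (hM : 0 < M) (hp : p ∈ exterior M)
    (hd : DifferentiableAt ℝ V p) (a : Fin 4) :
    radial p (pdVec a V p) = if a = 0 then 0 else -(V p a / rad p) := by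
  have h := (rad_pos hM hp).ne'
  have dot_sphProj : dot (sphProj p a) (V p) = if a = 0 then 0 else V p a := by
    have h0 := hV p hp
    rw [radial_eq] at h0
    simp only [dot, sphProj]
    fin_cases a <;> simp [normal_zero] <;> linear_combination (-normal p _) * h0
  have h1 := pd_radial h hd a
  rw [pd_congr (isOpen_exterior M) hp hV, pd_const, dot_sphProj] at h1
  split_ifs at h1 ⊢ <;> linear_combination -h1

theorem contDiffOn_angular (hV : ContDiffOn ℝ ∞ V (exterior M)) :
    ContDiffOn ℝ ∞ (angular V) (exterior M) := by
  have hV' (a : Fin 4) : ContDiffOn ℝ ∞ (fun x => V x a) (exterior M) := by fun_prop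
  have hx (a : Fin 4) : ContDiffOn ℝ ∞ (fun x : Pt => x a) (exterior M) := by fun_prop
  refine (contDiffOn_pi.2 fun a => ?_).const_smul (2 / 3 : ℝ)
  fin_cases a
  exacts [contDiffOn_const, ((hx 2).mul (hV' 3)).sub ((hx 3).mul (hV' 2)),
    ((hx 3).mul (hV' 1)).sub ((hx 1).mul (hV' 3)), ((hx 1).mul (hV' 2)).sub ((hx 2).mul (hV' 1))]

theorem tangential_angular (hM : 0 < M) : Tangential M (angular V) := fun p hp => by
  rw [angular, radial_smul, radial_cross_coord (rad_pos hM hp).ne', mul_zero]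

theorem Tangential.neg (hV : Tangential M V) : Tangential M fun x => -V x := fun p hp => by
  rw [radial, dot_neg, ← radial, hV p hp, neg_zero]

theorem cross_coord_cross_coord (w : Fin 4 → ℝ) {a : Fin 4} (ha : a ≠ 0) :
    cross p (cross p w) a = dot p w * p a - rad p ^ 2 * w a := by
  rw [rad_sq, dot]
  fin_cases a <;> simp [cross] at ha ⊢ <;> ring

end Tangential

namespace MaxwellPair

variable {M : ℝ} {p : Pt} {E C : Pt → Fin 4 → ℝ}

theorem contDiffOn_potential (hM : 0 < M) (hE : ContDiffOn ℝ ∞ E (exterior M)) :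
    ContDiffOn ℝ ∞ (potential E) (exterior M) := by
  have hr := contDiffOn_rad hM
  unfold potential dot
  fun_prop

theorem contDiffOn_potentialField (hM : 0 < M) (hE : ContDiffOn ℝ ∞ E (exterior M)) :
    ContDiffOn ℝ ∞ (potentialField E) (exterior M) :=
  ((contDiffOn_rad hM).inv fun _ hx => (rad_pos hM hx).ne').smul <| contDiffOn_pi.2 fun _ =>
    contDiffOn_pd (isOpen_exterior M) (contDiffOn_potential hM hE)

theorem pdVec_potentialField_sub (hM : 0 < M) (hE : ContDiffOn ℝ ∞ E (exterior M))
    (hp : p ∈ exterior M) (a b : Fin 4) :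
    pdVec a (potentialField E) p b - pdVec b (potentialField E) p a
      = (normal p b * potentialField E p a - normal p a * potentialField E p b) / rad p := by
  have h := (rad_pos hM hp).ne'
  have hφ := contDiffOn_potential hM hE
  have hr := differentiableAt_rad h
  have hd (b : Fin 4) : DifferentiableAt ℝ (pd b (potential E)) p :=
    differentiableAt_of_contDiffOn_exterior (contDiffOn_pd (isOpen_exterior M) hφ) hp
  have hi : DifferentiableAt ℝ (fun x => (rad x)⁻¹) p := hr.inv h
  simp only [potentialField, pdVec, grad, Pi.smul_apply, smul_eq_mul]
  rw [pd_mul hi (hd b), pd_mul hi (hd a), pd_inv hr h, pd_inv hr h, pd_rad h, pd_rad h,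
    pd_comm (isOpen_exterior M) hφ hp]
  field_simp
  ring

theorem potentialField_eq (hM : 0 < M) (hE : ContDiffOn ℝ ∞ E (exterior M))
    (hp : p ∈ exterior M) : potentialField E p
      = (1 / 3 : ℝ) • (radial p (E p) • normal p + grad (fun x => dot x (E x)) p) := by
  have h := (rad_pos hM hp).ne'
  have hr := differentiableAt_rad h
  have hE := differentiableAt_of_contDiffOn_exterior hE hp
  have hd : DifferentiableAt ℝ (fun x => dot x (E x)) p :=
    differentiableAt_dot differentiableAt_fun_id hE
  ext a
  unfold potentialField potential grad
  simp (disch := fun_prop) only [pd_mul, pd_const, pd_rad h,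
    Pi.smul_apply, Pi.add_apply, smul_eq_mul, dot_coord h]
  field_simp
  ring

theorem potentialField_time (hM : 0 < M) (hEC : MaxwellPair M E C) (hp : p ∈ exterior M) :
    potentialField E p 0 = 1 / 2 * spaceDiv (angular C) p := by
  have h := (rad_pos hM hp).ne'
  have hE := differentiableAt_of_contDiffOn_exterior hEC.smoothE hp
  have hC := differentiableAt_of_contDiffOn_exterior hEC.smoothC hp
  have hx : DifferentiableAt ℝ (fun x : Pt => x) p := differentiableAt_fun_id
  have div_cross : spaceDiv (fun x => cross x (C x)) p = -dot p (curl C p) := by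
    rw [spaceDiv_cross hx hC, curl_coord]
    simp [dot]
  have hφ : grad (fun x => dot x (E x)) p 0 = -dot p (curl C p) := by
    rw [grad, pd_dot hx hE, ← dot_coord_stretch h (M := M), ← pdVec_zero_stretch hM hp hE,
      hEC.curlC p hp, pdVec_coord, dot_neg]
    simp [dot]
  have div_angular : spaceDiv (angular C) p = 2 / 3 * spaceDiv (fun x => cross x (C x)) p := by
    unfold angular
    rw [spaceDiv_smul (differentiableAt_const _) (differentiableAt_cross hx hC)]
    simp [grad, pd_const, dot]
  rw [potentialField_eq hM hEC.smoothE hp, div_angular, div_cross]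
  simp only [Pi.smul_apply, Pi.add_apply, smul_eq_mul, normal_zero, hφ]
  ring

theorem potentialField_space (hM : 0 < M) (hEC : MaxwellPair M E C) (hp : p ∈ exterior M)
    {a : Fin 4} (ha : a ≠ 0) : raised M (potentialField E) p a =
      ((1 / 2 : ℝ) • ((lapse M p)⁻¹ • pdVec 0 (angular C) p + curl (fun x => -angular E x) p
        - (rad p ^ 2)⁻¹ • cross p (-angular E p))) a := by
  have h := (rad_pos hM hp).ne'
  have hf := (lapse_pos hM hp).ne'
  have hE := differentiableAt_of_contDiffOn_exterior hEC.smoothE hp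
  have hC := differentiableAt_of_contDiffOn_exterior hEC.smoothC hp
  have hx : DifferentiableAt ℝ (fun x : Pt => x) p := differentiableAt_fun_id
  have time_deriv : (lapse M p)⁻¹ • pdVec 0 (angular C) p
      = (2 / 3 : ℝ) • cross p (curl E p) := by
    unfold angular
    rw [pdVec_smul (differentiableAt_cross hx hC), pdVec_cross hx hC, pdVec_coord,
      cross_single_zero, zero_add, smul_comm, ← cross_coord_stretch h,
      ← pdVec_zero_stretch hM hp hC, hEC.curlE p hp]
  have curl_angular : curl (fun x => -angular E x) p
      = -(2 / 3 : ℝ) • curl (fun x => cross x (E x)) p := by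
    unfold angular
    rw [curl_neg, curl_smul (differentiableAt_cross hx hE), neg_smul]
  have cross_angular : cross p (-angular E p) a
      = -(2 / 3) * (rad p * radial p (E p) * p a - rad p ^ 2 * E p a) := by
    rw [← dot_coord h, ← cross_coord_cross_coord _ ha]
    fin_cases a <;> simp [angular, cross] <;> ring
  have gauss : rad p * spaceDiv E p = (1 - lapse M p)
      * (radial p (grad (fun x => dot x (E x)) p) + radial p (E p)) := by
    have := hEC.divE p hp
    rw [spaceDiv_stretch hM hp hE] at this
    field_simp at this
    linear_combination this
  have h1 := cross_curl_sub_curl_cross hE ha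
  rw [time_deriv, curl_angular, raised, potentialField_eq hM hEC.smoothE hp]
  simp only [radial_add, radial_smul, radial_normal h, Pi.add_apply, Pi.sub_apply, Pi.smul_apply,
    smul_eq_mul, cross_angular]
  rw [coord_eq h ha] at h1 ⊢
  field_simp
  linear_combination -h1 + normal p a * gauss

theorem waveSystem (hM : 0 < M) (hEC : MaxwellPair M E C) :
    WaveSystem M (potentialField E) (angular C) (fun x => -angular E x) where
  smooth_u := contDiffOn_potentialField hM hEC.smoothE
  smooth_e := contDiffOn_angular hEC.smoothC
  smooth_h := (contDiffOn_angular hEC.smoothE).neg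
  tangential_e := tangential_angular hM
  tangential_h := (tangential_angular hM).neg
  closed _ hp := pdVec_potentialField_sub hM hEC.smoothE hp
  time _ hp := potentialField_time hM hEC hp
  space _ hp _ ha := potentialField_space hM hEC hp ha

end MaxwellPair

/-! ### The fields `Z` and `β` -/

section FieldZ

variable {M : ℝ} {p : Pt}

theorem fieldZ_eq_emForm (hM : 0 < M) (hp : p ∈ exterior M) {F : Pt → Fin 4 → Fin 4 → ℝ}
    {E C : Fin 4 → ℝ} (hF : F p = emForm M p E C) :
    fieldZ M F p = emForm M p ((2 / 3 : ℝ) • cross p C) (-(2 / 3 : ℝ) • cross p E) := by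
  have h := (rad_pos hM hp).ne'
  have hn := normal_sq h
  have hff : lapse M p * (lapse M p)⁻¹ = 1 := mul_inv_cancel₀ (lapse_pos hM hp).ne'
  ext a b
  have fieldZ_eq : fieldZ M F p a b = -(2 / 3) *
      (∑ c, (∑ d, invMetric M p c d * hodge M F p a d) * killingYano p b c
        - ∑ c, (∑ d, invMetric M p c d * hodge M F p b d) * killingYano p a c) := by
    simp only [fieldZ, mul_sub, Finset.sum_sub_distrib, Finset.sum_mul, Finset.mul_sum]
    congr 1 <;>
    · refine Finset.sum_congr rfl fun c _ => Finset.sum_congr rfl fun d _ => ?_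
      ring
  rw [fieldZ_eq]
  simp only [sum_invMetric_mul hM hp, hodge_emForm hM hp hF, killingYano, permSymbol_cast,
    Fin.sum_univ_four, emForm, twoForm, radial_eq, stretch_apply, cross]
  rw [coord_eq h (a := 1) (by simp), coord_eq h (a := 2) (by simp), coord_eq h (a := 3) (by simp)]
  generalize (lapse M p)⁻¹ = g at *
  generalize normal p = n at *
  clear fieldZ_eq
  fin_cases a <;> fin_cases b <;> simp <;> grind

theorem sum_invMetric_mul_normal (hM : 0 < M) (hp : p ∈ exterior M) (a : Fin 4) :
    ∑ b, invMetric M p a b * normal p b = -lapse M p * normal p a := by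
  rw [sum_invMetric_mul hM hp, radial_normal (rad_pos hM hp).ne']
  split_ifs with ha
  · subst ha; simp [normal_zero]
  · ring

theorem contractU_emForm (hM : 0 < M) (hp : p ∈ exterior M) {w : Pt → Fin 4 → Fin 4 → ℝ}
    {e c : Fin 4 → ℝ} (hw : w p = emForm M p e c) (he : radial p e = 0) (hc : radial p c = 0) :
    contractU M w p = (rad p)⁻¹ • cross (normal p) c := by
  have hff : lapse M p * (lapse M p)⁻¹ = 1 := mul_inv_cancel₀ (lapse_pos hM hp).ne'
  ext a
  have contractU_eq : contractU M w p a = -(rad p)⁻¹ *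
      ∑ b, (∑ d, invMetric M p b d * normal p d) * emForm M p e c a b := by
    simp only [contractU, fieldU, pd_rad (rad_pos hM hp).ne', hw, Finset.sum_mul, Finset.mul_sum]
    refine Finset.sum_congr rfl fun c _ => Finset.sum_congr rfl fun d _ => ?_
    ring
  rw [contractU_eq]
  simp only [sum_invMetric_mul_normal hM hp, Fin.sum_univ_four, emForm, twoForm, stretch_apply, hc,
    cross, Pi.smul_apply, smul_eq_mul]
  rw [radial_eq] at he
  fin_cases a <;> simp [normal_zero] <;> grind

end FieldZ

namespace WaveSystem

variable {M : ℝ} {p : Pt} {u e h : Pt → Fin 4 → ℝ}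

theorem radial_raised (h : rad p ≠ 0) : radial p (raised M u p) = lapse M p * radial p (u p) := by
  rw [raised, radial_add, radial_smul, radial_normal h]; ring

theorem radial_u (hS : WaveSystem M u e h) (hM : 0 < M) (hp : p ∈ exterior M) :
    lapse M p * radial p (u p) = 1 / 2 * radial p (curl h p) := by
  have hr := (rad_pos hM hp).ne'
  have he := differentiableAt_of_contDiffOn_exterior hS.smooth_e hp
  rw [← radial_raised hr, radial, dot_congr (hS.space p hp), ← radial, radial_smul, sub_eq_add_neg,
    radial_add, radial_add, radial_smul, hS.tangential_e.radial_pdVec hM hp he, ← neg_smul,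
    radial_smul, radial_cross_coord hr]
  simp

theorem contractU_add_div2 (hS : WaveSystem M u e h) (hM : 0 < M) (hp : p ∈ exterior M)
    {Z : Pt → Fin 4 → Fin 4 → ℝ} (hZ : ∀ x ∈ exterior M, Z x = emForm M x (e x) (h x))
    (a : Fin 4) : -(1 / 2) * contractU M Z p a - 1 / 2 * div2 M Z p a = u p a := by
  have hr := (rad_pos hM hp).ne'
  have hf := (lapse_pos hM hp).ne'
  have hff : lapse M p * (lapse M p)⁻¹ = 1 := mul_inv_cancel₀ hf
  have he := differentiableAt_of_contDiffOn_exterior hS.smooth_e hp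
  have hh := differentiableAt_of_contDiffOn_exterior hS.smooth_h hp
  have hrad := hS.radial_u hM hp
  have stretch_e (x : Pt) (hx : x ∈ exterior M) :
      stretch M x (e x) = (lapse M x)⁻¹ • e x := by
    ext b; simp [stretch_apply, hS.tangential_e x hx]
  have spaceDiv_stretch_e : spaceDiv (fun x => stretch M x (e x)) p
      = (lapse M p)⁻¹ * spaceDiv e p := by
    have he0 : dot (normal p) (e p) = 0 := hS.tangential_e p hp
    rw [spaceDiv_congr (isOpen_exterior M) hp fun x hx a _ => congrFun (stretch_e x hx) a,
      spaceDiv_smul (differentiableAt_lapse_inv hM hp) he]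
    simp only [dot, grad, pd_lapse_inv hM hp] at he0 ⊢
    linear_combination (-(((lapse M p)⁻¹) ^ 2 * ((1 - lapse M p) / rad p))) * he0
  have radial_pdVec_e : radial p (pdVec 0 e p) = 0 := hS.tangential_e.radial_pdVec hM hp he 0
  rw [contractU_emForm hM hp (hZ p hp) (hS.tangential_e p hp) (hS.tangential_h p hp),
    div2_emForm hM hp hZ he hh, metric_mulVec hr]
  by_cases ha : a = 0
  · subst ha
    rw [spaceDiv_stretch_e, hS.time p hp]
    simp only [Pi.smul_apply, cross, Matrix.cons_val_zero, smul_zero, if_true, mul_neg]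
    linear_combination 1 / 2 * spaceDiv e p * hff
  · rw [pdVec_zero_stretch hM hp he]
    have radial_current : radial p (fun d => if d = 0 then
        -spaceDiv (fun x => stretch M x (e x)) p else stretch M p (pdVec 0 e p) d + curl h p d)
        = 2 * (lapse M p * radial p (u p)) := by
      rw [hrad, radial, dot_congr (w' := stretch M p (pdVec 0 e p) + curl h p)
        fun d hd => by simp only [if_neg hd, Pi.add_apply], ← radial, radial_add,
        radial_stretch hr, radial_pdVec_e]
      ring
    have hspace := hS.space p hp a ha
    rw [radial_current]
    simp only [raised, cross_coord hr, Pi.add_apply, Pi.sub_apply, Pi.smul_apply, smul_eq_mul,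
      stretch_apply, radial_pdVec_e, if_neg ha] at hspace ⊢
    field_simp at hspace ⊢
    linear_combination -hspace

end WaveSystem

theorem fieldβ_eq {M : ℝ} (hM : 0 < M) {F : Pt → Fin 4 → Fin 4 → ℝ} (hF : IsMaxwellField M F)
    {p : Pt} (hp : p ∈ exterior M) (a : Fin 4) :
    fieldβ M F p a = (potentialField (fun p => F p 0) p a : ℂ)
      + Complex.I * (potentialField (magC M F) p a : ℂ) := by
  have hEC := maxwellPair_of_isMaxwellField hM hF
  have hZ (x : Pt) (hx : x ∈ exterior M) : fieldZ M F x
      = emForm M x (angular (magC M F) x) (-angular (fun p => F p 0) x) := by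
    rw [fieldZ_eq_emForm hM hx (eq_emForm hM hF hx), neg_smul, angular, angular]
  have hZ' (x : Pt) (hx : x ∈ exterior M) : hodge M (fieldZ M F) x
      = emForm M x (angular (fun p => -F p 0) x) (-angular (magC M F) x) := by
    have angular_neg : angular (fun p => -F p 0) x = -angular (fun p => F p 0) x := by
      ext b; fin_cases b <;> simp [angular, cross] <;> ring
    rw [hodge_emForm hM hx (hZ x hx), angular_neg]
  rw [fieldβ, ← (hEC.waveSystem hM).contractU_add_div2 hM hp hZ a,
    ← (hEC.dual.waveSystem hM).contractU_add_div2 hM hp hZ' a]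
  push_cast
  ring

/-! ### The wave equation for `Re β` -/

section Divergence

variable {M : ℝ} {p : Pt} {V W : Pt → Fin 4 → ℝ}

/-- The divergence `∂_a V^a` in the chart. As the chart has unit volume density, it is also the
divergence of the vector field `V^a`. -/
def fourDiv (V : Pt → Fin 4 → ℝ) (p : Pt) : ℝ := pdVec 0 V p 0 + spaceDiv V p

/-- The derivative of the components of a vector field along the Euclidean unit radial field. -/
def normalDeriv (V : Pt → Fin 4 → ℝ) (p : Pt) : Fin 4 → ℝ :=
  fun b => radial p (grad (fun x => V x b) p)

theorem fourDiv_add (hV : DifferentiableAt ℝ V p) (hW : DifferentiableAt ℝ W p) :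
    fourDiv (fun x => V x + W x) p = fourDiv V p + fourDiv W p := by
  rw [fourDiv, spaceDiv_add hV hW, pdVec]
  simp (disch := fun_prop) only [Pi.add_apply, pd_add, fourDiv, pdVec]
  ring

theorem fourDiv_smul_comp_rad (h : rad p ≠ 0) {φ : ℝ → ℝ} {φ' : ℝ}
    (hφ : HasDerivAt φ φ' (rad p)) (hV : DifferentiableAt ℝ V p) :
    fourDiv (fun x => φ (rad x) • V x) p = φ' * radial p (V p) + φ (rad p) * fourDiv V p := by
  have hd : DifferentiableAt ℝ (fun x => φ (rad x)) p :=
    hφ.differentiableAt.comp p (differentiableAt_rad h)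
  have hV0 : DifferentiableAt ℝ (fun x => V x 0) p := by fun_prop
  rw [fourDiv, spaceDiv_smul hd hV, pdVec]
  simp only [Pi.smul_apply, smul_eq_mul]
  rw [pd_mul hd hV0]
  simp only [dot, grad, pd_comp_rad h hφ, normal_zero, radial_eq, fourDiv, pdVec]
  ring

theorem spaceDiv_normal (h : rad p ≠ 0) : spaceDiv normal p = 2 / rad p := by
  simp only [spaceDiv, pdVec, pd_normal h, sphProj]
  simp only [Fin.reduceEq, ne_eq, not_false_eq_true, and_self, if_true]
  field_simp
  linear_combination -normal_sq h

theorem spaceDiv_pdVec {s : Set Pt} (hs : IsOpen s) (hV : ContDiffOn ℝ ∞ V s) (hp : p ∈ s)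
    (a : Fin 4) : spaceDiv (pdVec a V) p = pd a (spaceDiv V) p := by
  have hV' (b : Fin 4) : ContDiffOn ℝ ∞ (fun x => V x b) s := by fun_prop
  have hd (a b : Fin 4) : DifferentiableAt ℝ (pd a fun x => V x b) p :=
    ((contDiffOn_pd hs (hV' b)).contDiffAt (hs.mem_nhds hp)).differentiableAt (by simp)
  change _ = pd a (fun x => pd 1 (fun x => V x 1) x + pd 2 (fun x => V x 2) x
    + pd 3 (fun x => V x 3) x) p
  rw [pd_add ((hd 1 1).fun_add (hd 2 2)) (hd 3 3), pd_add (hd 1 1) (hd 2 2)]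
  simp only [pd_comm (a := a) hs (hV' _) hp, spaceDiv, pdVec]

theorem contDiffOn_pdVec {s : Set Pt} (hs : IsOpen s) (hV : ContDiffOn ℝ ∞ V s) (a : Fin 4) :
    ContDiffOn ℝ ∞ (pdVec a V) s :=
  contDiffOn_pi.2 fun b => contDiffOn_pd hs (f := fun x => V x b) (by fun_prop)

theorem contDiffOn_curl {s : Set Pt} (hs : IsOpen s) (hV : ContDiffOn ℝ ∞ V s) :
    ContDiffOn ℝ ∞ (curl V) s := by
  have hd (a b : Fin 4) : ContDiffOn ℝ ∞ (fun x => pdVec a V x b) s :=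
    contDiffOn_pi.1 (contDiffOn_pdVec hs hV a) b
  refine contDiffOn_pi.2 fun a => ?_
  fin_cases a
  exacts [contDiffOn_const, (hd 2 3).sub (hd 3 2), (hd 3 1).sub (hd 1 3), (hd 1 2).sub (hd 2 1)]

end Divergence

namespace WaveSystem

variable {M : ℝ} {p : Pt} {u e h : Pt → Fin 4 → ℝ}

theorem spaceDiv_inv_rad_sq_smul_cross (hS : WaveSystem M u e h) (hM : 0 < M)
    (hp : p ∈ exterior M) :
    spaceDiv (fun x => (rad x ^ 2)⁻¹ • cross x (h x)) p
      = -(2 * lapse M p / rad p * radial p (u p)) := by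
  have hr := (rad_pos hM hp).ne'
  have hh := differentiableAt_of_contDiffOn_exterior hS.smooth_h hp
  have hasDerivAt_inv_sq :
      HasDerivAt (fun r : ℝ => (r ^ 2)⁻¹) (-(2 * (rad p ^ 3)⁻¹)) (rad p) := by
    refine ((hasDerivAt_pow 2 (rad p)).inv (pow_ne_zero 2 hr)).congr_deriv ?_
    field_simp
    ring
  have grad_inv_sq : grad (fun x => (rad x ^ 2)⁻¹) p = (-(2 * (rad p ^ 3)⁻¹)) • normal p := by
    ext a
    exact pd_comp_rad hr hasDerivAt_inv_sq a
  have hi : DifferentiableAt ℝ (fun x => (rad x ^ 2)⁻¹) p :=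
    ((differentiableAt_rad hr).pow 2).inv (pow_ne_zero 2 hr)
  have hrad := hS.radial_u hM hp
  rw [spaceDiv_smul hi (differentiableAt_cross differentiableAt_fun_id hh), grad_inv_sq, dot_comm,
    dot_smul, dot_comm, ← radial, radial_cross_coord hr, spaceDiv_cross differentiableAt_fun_id hh,
    curl_coord, dot_coord hr]
  simp only [dot, Pi.zero_apply]
  field_simp
  linear_combination 2 * rad p ^ 2 * hrad

theorem spaceDiv_raised (hS : WaveSystem M u e h) (hM : 0 < M) (hp : p ∈ exterior M) :
    spaceDiv (raised M u) p
      = (lapse M p)⁻¹ * pdVec 0 u p 0 + lapse M p / rad p * radial p (u p) := by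
  have hO := isOpen_exterior M
  have hr := (rad_pos hM hp).ne'
  have hf := differentiableAt_lapse_inv hM hp
  have he := differentiableAt_of_contDiffOn_exterior (contDiffOn_pdVec hO hS.smooth_e 0) hp
  have hh := differentiableAt_of_contDiffOn_exterior hS.smooth_h hp
  have hc := differentiableAt_of_contDiffOn_exterior (contDiffOn_curl hO hS.smooth_h) hp
  have hi : DifferentiableAt ℝ (fun x => (rad x ^ 2)⁻¹ • cross x (h x)) p :=
    (((differentiableAt_rad hr).pow 2).inv (pow_ne_zero 2 hr)).smul
      (differentiableAt_cross differentiableAt_fun_id hh)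
  have hfe : DifferentiableAt ℝ (fun x => (lapse M x)⁻¹ • pdVec 0 e x) p := hf.smul he
  have grad_f : dot (grad (fun x => (lapse M x)⁻¹) p) (pdVec 0 e p) = 0 := by
    have := hS.tangential_e.radial_pdVec hM hp
      (differentiableAt_of_contDiffOn_exterior hS.smooth_e hp) 0
    rw [if_pos rfl, radial_eq] at this
    simp only [dot, grad, pd_lapse_inv hM hp]
    linear_combination (-(lapse M p)⁻¹ ^ 2 * ((1 - lapse M p) / rad p)) * this
  have time_deriv : spaceDiv (pdVec 0 e) p = 2 * pdVec 0 u p 0 := by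
    rw [spaceDiv_pdVec hO hS.smooth_e hp,
      pd_congr hO hp (g := fun x => 2 * u x 0) fun x hx => by rw [hS.time x hx]; ring,
      pd_mul (differentiableAt_const _) (differentiableAt_pi.1
        (differentiableAt_of_contDiffOn_exterior hS.smooth_u hp) 0), pd_const, pdVec]
    ring
  rw [spaceDiv_congr hO hp (W := fun x => (1 / 2 : ℝ) • ((lapse M x)⁻¹ • pdVec 0 e x
      + (curl h x + -((rad x ^ 2)⁻¹ • cross x (h x))))) fun x hx a ha => by
      rw [hS.space x hx a ha, sub_eq_add_neg, add_assoc],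
    spaceDiv_smul (differentiableAt_const _) (hfe.fun_add (hc.fun_add hi.fun_neg)),
    spaceDiv_add hfe (hc.fun_add hi.fun_neg), spaceDiv_add hc hi.fun_neg, spaceDiv_neg,
    spaceDiv_curl hO hS.smooth_h hp, hS.spaceDiv_inv_rad_sq_smul_cross hM hp,
    spaceDiv_smul hf he, grad_f, time_deriv]
  simp only [dot, grad, pd_const]
  ring

theorem curl_u (hS : WaveSystem M u e h) (hp : p ∈ exterior M) :
    curl u p = -(rad p)⁻¹ • cross (normal p) (u p) := by
  ext a
  fin_cases a <;> simp [curl, cross, hS.closed p hp] <;> ring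

theorem pdVec_zero_u (hS : WaveSystem M u e h) (hp : p ∈ exterior M) (a : Fin 4) :
    pdVec 0 u p a = grad (fun x => u x 0) p a + normal p a * u p 0 / rad p := by
  have h1 := hS.closed p hp 0 a
  rw [normal_zero] at h1
  change _ = pdVec a u p 0 + _
  linear_combination h1

theorem grad_radial_u (hS : WaveSystem M u e h) (hM : 0 < M) (hp : p ∈ exterior M) (a : Fin 4) :
    grad (fun x => radial x (u x)) p a = normalDeriv u p a
      + if a = 0 then u p 0 / rad p else 2 / rad p * (u p a - normal p a * radial p (u p)) := by
  have hr := (rad_pos hM hp).ne'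
  have hn := normal_sq hr
  have dot_sphProj : dot (sphProj p a) (u p)
      = if a = 0 then 0 else u p a - normal p a * radial p (u p) := by
    simp only [dot, sphProj, radial_eq]
    fin_cases a <;> simp [normal_zero] <;> ring
  have radial_pdVec : radial p (pdVec a u p) = normalDeriv u p a
      + (u p a - normal p a * radial p (u p)) / rad p := by
    have h1 (b : Fin 4) := hS.closed p hp a b
    change _ = radial p (fun b => pdVec b u p a) + _
    simp only [radial_eq]
    field_simp at h1 ⊢
    linear_combination normal p 1 * h1 1 + normal p 2 * h1 2 + normal p 3 * h1 3 + u p a * hn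
  rw [grad, pd_radial hr (differentiableAt_of_contDiffOn_exterior hS.smooth_u hp), dot_sphProj,
    radial_pdVec]
  split_ifs with ha
  · rw [ha, normal_zero]; ring
  · ring

theorem radial_grad_radial_u (hS : WaveSystem M u e h) (hM : 0 < M) (hp : p ∈ exterior M) :
    radial p (grad (fun x => radial x (u x)) p) = radial p (normalDeriv u p) := by
  have hn := normal_sq (rad_pos hM hp).ne'
  rw [radial_eq, radial_eq, hS.grad_radial_u hM hp, hS.grad_radial_u hM hp, hS.grad_radial_u hM hp,
    radial_eq]
  simp only [Fin.reduceEq, if_false]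
  linear_combination (-(2 / rad p) * (normal p 1 * u p 1 + normal p 2 * u p 2
    + normal p 3 * u p 3)) * hn

end WaveSystem

/-! ### The fluxes of the Morawetz current and their divergences -/

section Flux

variable {M : ℝ} {p : Pt} {u e h : Pt → Fin 4 → ℝ}

/-- The square `g^{ab} w_a w_b` of a covector. -/
def sqLen (M : ℝ) (p : Pt) (w : Fin 4 → ℝ) : ℝ :=
  (lapse M p)⁻¹ * w 0 ^ 2 - dot w w - (lapse M p - 1) * radial p w ^ 2

/-- The vector field `T^a{}_b n^b` for the energy-momentum tensor `T_{ab} = u_a u_b - ½ g_{ab} u²`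
of a covector field and the Euclidean unit radial field `n^b`. -/
def waveFlux (M : ℝ) (u : Pt → Fin 4 → ℝ) (p : Pt) : Fin 4 → ℝ := fun a =>
  if a = 0 then (lapse M p)⁻¹ * (u p 0 * radial p (u p))
  else (-(radial p (u p) • raised M u p + (1 / 2 * sqLen M p (u p)) • normal p)) a

/-- The vector field `u_b Z^{ab}`, where `Z` has electric vector `e` and magnetic vector `h`. -/
def mixFlux (M : ℝ) (u e h : Pt → Fin 4 → ℝ) (p : Pt) : Fin 4 → ℝ := fun a =>
  if a = 0 then -((lapse M p)⁻¹ * dot (u p) (e p))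
  else ((lapse M p)⁻¹ * u p 0) • e p a + cross (u p) (h p) a

/-- The part of the Morawetz current that is quadratic in `Z`, without its radial profile. -/
def fieldFlux (M : ℝ) (e h : Pt → Fin 4 → ℝ) (p : Pt) : Fin 4 → ℝ := fun a =>
  if a = 0 then -(1 / 4) * ((lapse M p)⁻¹ * radial p (cross (e p) (h p)))
  else 1 / 8 * (dot (e p) (e p) + dot (h p) (h p)) * normal p a

theorem grad_const_mul {k : ℝ} {φ : Pt → ℝ} (hφ : DifferentiableAt ℝ φ p) :
    grad (fun x => k * φ x) p = k • grad φ p := by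
  ext a
  simp only [grad, Pi.smul_apply, smul_eq_mul]
  rw [pd_mul (differentiableAt_const _) hφ, pd_const]
  ring

theorem differentiableAt_raised (hM : 0 < M) (hp : p ∈ exterior M)
    (hu : DifferentiableAt ℝ u p) : DifferentiableAt ℝ (raised M u) p := by
  have hr := (rad_pos hM hp).ne'
  have hf := differentiableAt_lapse (M := M) hr
  have hn := differentiableAt_normal hr
  have hν := differentiableAt_radial hr hu
  unfold raised
  fun_prop

theorem differentiableAt_sqLen (hM : 0 < M) (hp : p ∈ exterior M) (hu : DifferentiableAt ℝ u p) :
    DifferentiableAt ℝ (fun x => sqLen M x (u x)) p := by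
  have hr := (rad_pos hM hp).ne'
  have hf := differentiableAt_lapse (M := M) hr
  have hg := differentiableAt_lapse_inv hM hp
  have hν := differentiableAt_radial hr hu
  have hd := differentiableAt_dot hu hu
  unfold sqLen
  fun_prop

theorem differentiableAt_waveFlux (hM : 0 < M) (hp : p ∈ exterior M)
    (hu : DifferentiableAt ℝ u p) : DifferentiableAt ℝ (waveFlux M u) p := by
  have hr := (rad_pos hM hp).ne'
  have hg := differentiableAt_lapse_inv hM hp
  have hν := differentiableAt_radial hr hu
  have hn := differentiableAt_normal hr
  have hs := differentiableAt_sqLen hM hp hu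
  have hρ := differentiableAt_raised hM hp hu
  refine differentiableAt_pi.2 fun a => ?_
  simp only [waveFlux, Pi.neg_apply, Pi.add_apply, Pi.smul_apply, smul_eq_mul]
  split_ifs <;> fun_prop

theorem differentiableAt_mixFlux (hM : 0 < M) (hp : p ∈ exterior M)
    (hu : DifferentiableAt ℝ u p) (he : DifferentiableAt ℝ e p) (hh : DifferentiableAt ℝ h p) :
    DifferentiableAt ℝ (mixFlux M u e h) p := by
  have hg := differentiableAt_lapse_inv hM hp
  have hd := differentiableAt_dot hu he
  have hc := differentiableAt_cross hu hh
  refine differentiableAt_pi.2 fun a => ?_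
  simp only [mixFlux, smul_eq_mul]
  split_ifs <;> fun_prop

theorem differentiableAt_fieldFlux (hM : 0 < M) (hp : p ∈ exterior M)
    (he : DifferentiableAt ℝ e p) (hh : DifferentiableAt ℝ h p) :
    DifferentiableAt ℝ (fieldFlux M e h) p := by
  have hr := (rad_pos hM hp).ne'
  have hg := differentiableAt_lapse_inv hM hp
  have hn := differentiableAt_normal hr
  have he2 := differentiableAt_dot he he
  have hh2 := differentiableAt_dot hh hh
  have hc := differentiableAt_radial hr (differentiableAt_cross he hh)
  refine differentiableAt_pi.2 fun a => ?_
  simp only [fieldFlux]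
  split_ifs <;> fun_prop

theorem radial_waveFlux (h : rad p ≠ 0) : radial p (waveFlux M u p)
    = -(1 / 2) * ((lapse M p)⁻¹ * u p 0 ^ 2 + lapse M p * radial p (u p) ^ 2)
      + 1 / 2 * (dot (u p) (u p) - radial p (u p) ^ 2) := by
  rw [radial, dot_congr (w := waveFlux M u p) (w' := -(radial p (u p) • raised M u p
      + (1 / 2 * sqLen M p (u p)) • normal p)) fun a ha => if_neg ha, dot_neg, dot_add, dot_smul,
    dot_smul, ← radial, ← radial, WaveSystem.radial_raised h, radial_normal h, sqLen]
  ring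

theorem radial_mixFlux (he : radial p (e p) = 0) :
    radial p (mixFlux M u e h p) = radial p (cross (u p) (h p)) := by
  rw [radial, dot_congr (w := mixFlux M u e h p)
    (w' := ((lapse M p)⁻¹ * u p 0) • e p + cross (u p) (h p)) fun a ha => if_neg ha,
    dot_add, dot_smul, ← radial, ← radial, he]
  ring

theorem radial_fieldFlux (hr : rad p ≠ 0) :
    radial p (fieldFlux M e h p) = 1 / 8 * (dot (e p) (e p) + dot (h p) (h p)) := by
  rw [radial, dot_congr (w := fieldFlux M e h p)
    (w' := (1 / 8 * (dot (e p) (e p) + dot (h p) (h p))) • normal p) fun a ha => if_neg ha,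
    dot_smul, ← radial, radial_normal hr, mul_one]

theorem fourDiv_fieldFlux (hM : 0 < M) (hp : p ∈ exterior M) (he : DifferentiableAt ℝ e p)
    (hh : DifferentiableAt ℝ h p) : fourDiv (fieldFlux M e h) p
      = -(1 / 4) * (lapse M p)⁻¹ * (radial p (cross (pdVec 0 e p) (h p))
          + radial p (cross (e p) (pdVec 0 h p)))
        + 1 / 8 * radial p (grad (fun x => dot (e x) (e x) + dot (h x) (h x)) p)
        + 1 / 4 * (dot (e p) (e p) + dot (h p) (h p)) / rad p := by
  have hr := (rad_pos hM hp).ne'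
  have hn := differentiableAt_normal hr
  have hg := differentiableAt_lapse_inv hM hp
  have hc := differentiableAt_radial hr (differentiableAt_cross he hh)
  have hd := (differentiableAt_dot he he).fun_add (differentiableAt_dot hh hh)
  have time : pdVec 0 (fieldFlux M e h) p 0 = -(1 / 4) * ((lapse M p)⁻¹
      * (radial p (cross (pdVec 0 e p) (h p)) + radial p (cross (e p) (pdVec 0 h p)))) := by
    change pd 0 (fun x => -(1 / 4) * ((lapse M x)⁻¹ * radial x (cross (e x) (h x)))) p = _
    rw [pd_mul (by fun_prop) (hg.fun_mul hc), pd_mul hg hc, pd_const, pd_lapse_inv hM hp,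
      pd_radial hr (differentiableAt_cross he hh), pdVec_cross he hh, radial_add]
    simp [normal_zero, sphProj, dot]
  have space : spaceDiv (fieldFlux M e h) p = spaceDiv
      (fun x => (1 / 8 * (dot (e x) (e x) + dot (h x) (h x))) • normal x) p :=
    spaceDiv_congr (isOpen_exterior M) hp fun x _ a ha => if_neg ha
  rw [fourDiv, time, space, spaceDiv_smul (hd.const_mul _) hn, spaceDiv_normal hr,
    grad_const_mul hd, dot_comm, ← radial, radial_smul]
  ring

theorem Tangential.dot_cross_normal_curl (hT : Tangential M h) (hM : 0 < M) (hp : p ∈ exterior M)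
    (hh : DifferentiableAt ℝ h p) : dot (cross (h p) (normal p)) (curl h p)
      = -(dot (h p) (h p) / rad p) - 1 / 2 * radial p (grad (fun x => dot (h x) (h x)) p) := by
  have radial_pdVec (a : Fin 4) := hT.radial_pdVec hM hp hh a
  have h1 := radial_pdVec 1
  have h2 := radial_pdVec 2
  have h3 := radial_pdVec 3
  simp only [radial_eq, Fin.reduceEq, if_false] at h1 h2 h3
  simp only [radial_eq, grad, pd_dot hh hh]
  simp only [dot, cross, curl, pdVec, Matrix.cons_val] at h1 h2 h3 ⊢
  linear_combination h p 1 * h1 + h p 2 * h2 + h p 3 * h3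

end Flux

namespace WaveSystem

variable {M : ℝ} {p : Pt} {u e h : Pt → Fin 4 → ℝ}

theorem radial_grad_sqLen (hS : WaveSystem M u e h) (hM : 0 < M) (hp : p ∈ exterior M) :
    radial p (grad (fun x => sqLen M x (u x)) p)
      = 2 * (lapse M p)⁻¹ * u p 0 * normalDeriv u p 0 - 2 * dot (u p) (normalDeriv u p)
        - 2 * (lapse M p - 1) * radial p (u p) * radial p (normalDeriv u p)
        - (1 - lapse M p) / rad p * (((lapse M p)⁻¹ * u p 0) ^ 2 + radial p (u p) ^ 2) := by
  have hr := (rad_pos hM hp).ne'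
  have hu := differentiableAt_of_contDiffOn_exterior hS.smooth_u hp
  have hf := differentiableAt_lapse (M := M) hr
  have hg := differentiableAt_lapse_inv hM hp
  have hν := differentiableAt_radial hr hu
  have hd := differentiableAt_dot hu hu
  have hu0 : DifferentiableAt ℝ (fun x => u x 0) p := by fun_prop
  have grad_sqLen (a : Fin 4) : grad (fun x => sqLen M x (u x)) p a
      = 2 * (lapse M p)⁻¹ * u p 0 * pdVec a u p 0 - 2 * dot (u p) (pdVec a u p)
        - 2 * (lapse M p - 1) * radial p (u p) * grad (fun x => radial x (u x)) p a
        - (1 - lapse M p) / rad p * (((lapse M p)⁻¹ * u p 0) ^ 2 + radial p (u p) ^ 2)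
          * normal p a := by
    simp only [sqLen, grad, sq]
    rw [pd_sub (by fun_prop) (by fun_prop), pd_sub (by fun_prop) hd, pd_mul hg (by fun_prop),
      pd_mul hu0 hu0, pd_mul (by fun_prop) (by fun_prop), pd_sub hf (by fun_prop), pd_mul hν hν,
      pd_dot hu hu, dot_comm (pdVec a u p), pd_lapse_inv hM hp, pd_lapse hr, pd_const]
    simp only [pdVec]
    ring
  rw [← hS.radial_grad_radial_u hM hp, radial_eq, grad_sqLen, grad_sqLen, grad_sqLen]
  simp only [dot, normalDeriv, radial_eq p (grad _ p)]
  simp only [grad, pdVec]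
  linear_combination (-(1 - lapse M p) / rad p * (((lapse M p)⁻¹ * u p 0) ^ 2
    + radial p (u p) ^ 2)) * normal_sq hr

theorem dot_grad_radial_u_raised (hS : WaveSystem M u e h) (hM : 0 < M) (hp : p ∈ exterior M) :
    dot (grad (fun x => radial x (u x)) p) (raised M u p) = dot (u p) (normalDeriv u p)
      + (lapse M p - 1) * radial p (u p) * radial p (normalDeriv u p)
      + 2 / rad p * (dot (u p) (u p) - radial p (u p) ^ 2) := by
  rw [raised, dot_add, dot_smul, dot_comm _ (normal p), ← radial, hS.radial_grad_radial_u hM hp]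
  simp only [dot, hS.grad_radial_u hM hp, Fin.reduceEq, if_false]
  simp only [radial_eq]
  ring

theorem fourDiv_waveFlux (hS : WaveSystem M u e h) (hM : 0 < M) (hp : p ∈ exterior M) :
    fourDiv (waveFlux M u) p = 1 / 2 * ((1 - lapse M p) / rad p) * (lapse M p)⁻¹
          * ((lapse M p)⁻¹ * u p 0 ^ 2 + lapse M p * radial p (u p) ^ 2)
        - (dot (u p) (u p) - radial p (u p) ^ 2) / rad p := by
  have hr := (rad_pos hM hp).ne'
  have hf := (lapse_pos hM hp).ne'
  have hu := differentiableAt_of_contDiffOn_exterior hS.smooth_u hp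
  have hn := differentiableAt_normal hr
  have hg := differentiableAt_lapse_inv hM hp
  have hν := differentiableAt_radial hr hu
  have hρ := differentiableAt_raised hM hp hu
  have hu0 : DifferentiableAt ℝ (fun x => u x 0) p := by fun_prop
  have hs : DifferentiableAt ℝ (fun x => 1 / 2 * sqLen M x (u x)) p :=
    (differentiableAt_sqLen hM hp hu).const_mul _
  have time : pdVec 0 (waveFlux M u) p 0 = (lapse M p)⁻¹ * (pdVec 0 u p 0 * radial p (u p)
      + u p 0 * (normalDeriv u p 0 + u p 0 / rad p)) := by
    change pd 0 (fun x => (lapse M x)⁻¹ * (u x 0 * radial x (u x))) p = _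
    have := hS.grad_radial_u hM hp 0
    rw [if_pos rfl, grad] at this
    rw [pd_mul hg (hu0.fun_mul hν), pd_mul hu0 hν, this, pd_lapse_inv hM hp, normal_zero, pdVec]
    ring
  have space : spaceDiv (waveFlux M u) p = spaceDiv (fun x => -(radial x (u x) • raised M u x
      + (1 / 2 * sqLen M x (u x)) • normal x)) p :=
    spaceDiv_congr (isOpen_exterior M) hp fun x _ a ha => if_neg ha
  have grad_half_sqLen : dot (grad (fun x => 1 / 2 * sqLen M x (u x)) p) (normal p)
      = 1 / 2 * radial p (grad (fun x => sqLen M x (u x)) p) := by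
    rw [grad_const_mul (differentiableAt_sqLen hM hp hu), dot_comm, dot_smul, radial]
  rw [fourDiv, time, space, spaceDiv_neg, spaceDiv_add (hν.fun_smul hρ) (hs.fun_smul hn),
    spaceDiv_smul hν hρ, spaceDiv_smul hs hn, hS.spaceDiv_raised hM hp, grad_half_sqLen,
    hS.dot_grad_radial_u_raised hM hp, hS.radial_grad_sqLen hM hp, spaceDiv_normal hr, sqLen]
  field_simp
  ring

theorem two_mul_dot_raised (hS : WaveSystem M u e h) (hM : 0 < M) (hp : p ∈ exterior M) :
    2 * dot (u p) (raised M u p) = (lapse M p)⁻¹ * dot (u p) (pdVec 0 e p)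
      + dot (u p) (curl h p) - (rad p)⁻¹ * dot (u p) (cross (normal p) (h p)) := by
  have hr := (rad_pos hM hp).ne'
  rw [dot_congr (hS.space p hp), dot_smul, dot_sub, dot_add, dot_smul, dot_smul, cross_coord hr,
    dot_smul]
  field_simp

theorem dot_pdVec_zero_u (hS : WaveSystem M u e h) (hp : p ∈ exterior M) :
    dot (pdVec 0 u p) (e p) = dot (grad (fun x => u x 0) p) (e p) := by
  have radial_e := hS.tangential_e p hp
  rw [radial_eq] at radial_e
  simp only [dot, hS.pdVec_zero_u hp]
  linear_combination u p 0 / rad p * radial_e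

theorem fourDiv_mixFlux (hS : WaveSystem M u e h) (hM : 0 < M) (hp : p ∈ exterior M) :
    fourDiv (mixFlux M u e h) p = 2 * sqLen M p (u p) := by
  have hu := differentiableAt_of_contDiffOn_exterior hS.smooth_u hp
  have he := differentiableAt_of_contDiffOn_exterior hS.smooth_e hp
  have hh := differentiableAt_of_contDiffOn_exterior hS.smooth_h hp
  have hg := differentiableAt_lapse_inv hM hp
  have hu0 : DifferentiableAt ℝ (fun x => u x 0) p := by fun_prop
  have time : pdVec 0 (mixFlux M u e h) p 0
      = -((lapse M p)⁻¹ * (dot (grad (fun x => u x 0) p) (e p) + dot (u p) (pdVec 0 e p))) := by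
    change pd 0 (fun x => -((lapse M x)⁻¹ * dot (u x) (e x))) p = _
    rw [pd_neg, pd_mul hg (differentiableAt_dot hu he), pd_lapse_inv hM hp, pd_dot hu he,
      normal_zero, hS.dot_pdVec_zero_u hp]
    ring
  have space : spaceDiv (mixFlux M u e h) p = spaceDiv
      (fun x => ((lapse M x)⁻¹ * u x 0) • e x + cross (u x) (h x)) p :=
    spaceDiv_congr (isOpen_exterior M) hp fun x _ a ha => if_neg ha
  have grad_coeff : dot (grad (fun x => (lapse M x)⁻¹ * u x 0) p) (e p)
      = (lapse M p)⁻¹ * dot (grad (fun x => u x 0) p) (e p) := by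
    have radial_e := hS.tangential_e p hp
    rw [radial_eq] at radial_e
    simp only [dot, grad, pd_mul hg hu0, pd_lapse_inv hM hp]
    linear_combination
      (-(lapse M p)⁻¹ ^ 2 * ((1 - lapse M p) / rad p)) * u p 0 * radial_e
  have triple : dot (h p) (cross (normal p) (u p)) = -dot (u p) (cross (normal p) (h p)) := by
    simp only [dot, cross, Matrix.cons_val]
    ring
  have dot_raised := hS.two_mul_dot_raised hM hp
  rw [raised, dot_add, dot_smul, dot_comm _ (normal p), ← radial] at dot_raised
  rw [fourDiv, time, space, spaceDiv_add ((hg.fun_mul hu0).fun_smul he)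
    (differentiableAt_cross hu hh), spaceDiv_smul (hg.fun_mul hu0) he, spaceDiv_cross hu hh,
    grad_coeff, hS.curl_u hp, dot_comm (-(rad p)⁻¹ • _), dot_smul, triple, sqLen]
  linear_combination dot_raised - 2 * (lapse M p)⁻¹ * u p 0 * hS.time p hp

theorem radial_cross_u (hS : WaveSystem M u e h) (hM : 0 < M) (hp : p ∈ exterior M) :
    radial p (cross (u p) (h p)) = 1 / 2 * (lapse M p)⁻¹ * radial p (cross (pdVec 0 e p) (h p))
      - 1 / 4 * radial p (grad (fun x => dot (h x) (h x)) p) := by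
  have hr := (rad_pos hM hp).ne'
  have hh := differentiableAt_of_contDiffOn_exterior hS.smooth_h hp
  have rotate (w : Fin 4 → ℝ) :
      radial p (cross w (h p)) = dot (cross (h p) (normal p)) w := by
    simp only [radial, dot, cross, Matrix.cons_val]
    ring
  have cross_raised : radial p (cross (u p) (h p))
      = dot (cross (h p) (normal p)) (raised M u p) := by
    simp only [radial, raised, dot, cross, Matrix.cons_val, Pi.add_apply, Pi.smul_apply,
      smul_eq_mul]
    ring
  have lagrange : dot (cross (h p) (normal p)) (cross (normal p) (h p))
      = -dot (h p) (h p) := by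
    have tangential := hS.tangential_h p hp
    rw [radial_eq] at tangential
    simp only [dot, cross, Matrix.cons_val]
    linear_combination -(h p 1 ^ 2 + h p 2 ^ 2 + h p 3 ^ 2) * normal_sq hr
      + (normal p 1 * h p 1 + normal p 2 * h p 2 + normal p 3 * h p 3) * tangential
  rw [cross_raised, dot_congr (hS.space p hp), dot_smul, dot_sub, dot_add, dot_smul, dot_smul,
    ← rotate, hS.tangential_h.dot_cross_normal_curl hM hp hh, cross_coord hr, dot_smul, lagrange]
  field_simp
  ring

end WaveSystem

/-! ### The Morawetz current as a vector field -/

/-- The pair of wave systems carried by a Maxwell field: `β = u + i v`, and `Z`, `*Z` have electric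
vectors `e`, `h`. -/
structure BetaSystem (M : ℝ) (F : Pt → Fin 4 → Fin 4 → ℝ) (u v e h : Pt → Fin 4 → ℝ) : Prop where
  re : WaveSystem M u e h
  im : WaveSystem M v h (fun x => -e x)
  fieldβ_eq : ∀ p ∈ exterior M, ∀ a, fieldβ M F p a = (u p a : ℂ) + Complex.I * (v p a : ℂ)
  fieldZ_eq : ∀ p ∈ exterior M, fieldZ M F p = emForm M p (e p) (h p)

section Current

variable {M : ℝ} {p : Pt} {F : Pt → Fin 4 → Fin 4 → ℝ}

theorem exists_betaSystem (hM : 0 < M) (hF : IsMaxwellField M F) :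
    ∃ u v e h, BetaSystem M F u v e h := by
  have hEC := maxwellPair_of_isMaxwellField hM hF
  refine ⟨potentialField fun p => F p 0, potentialField (magC M F), angular (magC M F),
    fun x => -angular (fun p => F p 0) x, hEC.waveSystem hM, ?_,
    fun p hp a => Schwarzschild.fieldβ_eq hM hF hp a, fun p hp => ?_⟩
  · have angular_neg : (angular fun x => -F x 0) = fun x => -angular (fun p => F p 0) x := by
      ext x a
      fin_cases a <;> simp [angular, cross] <;> ring
    rw [← angular_neg]
    exact hEC.dual.waveSystem hM
  · rw [fieldZ_eq_emForm hM hp (eq_emForm hM hF hp)]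
    simp only [angular, neg_smul]

section Square

variable {e h : Fin 4 → ℝ}

theorem squareZ_zero_zero (hM : 0 < M) (hp : p ∈ exterior M) (hZ : fieldZ M F p = emForm M p e h)
    (he : radial p e = 0) : squareZ M F p 0 0 = -dot e e := by
  simp only [squareZ, hZ, ← Finset.sum_mul, sum_invMetric_mul hM hp]
  simp only [Fin.sum_univ_four, radial_eq, emForm, twoForm, dot] at *
  simp
  linear_combination (1 - lapse M p) * (normal p 1 * e 1 + normal p 2 * e 2 + normal p 3 * e 3) * he

theorem normZ_eq (hM : 0 < M) (hp : p ∈ exterior M) (hZ : fieldZ M F p = emForm M p e h)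
    (he : radial p e = 0) (hh : radial p h = 0) :
    normZ M F p = -2 * (lapse M p)⁻¹ * (dot e e - dot h h) := by
  have contract : normZ M F p = ∑ a, ∑ d, emForm M p e h a d * twoForm (-stretch M p e) h a d := by
    simp only [normZ, squareZ, hZ, ← sum_raise_emForm hM hp, Finset.mul_sum]
    refine Finset.sum_congr rfl fun a _ => ?_
    conv_rhs => rw [Finset.sum_comm]
    refine Finset.sum_congr rfl fun b _ => ?_
    conv_rhs => rw [Finset.sum_comm]
    refine Finset.sum_congr rfl fun c _ => Finset.sum_congr rfl fun d _ => ?_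
    rw [invMetric_symm M p c d]
    ring
  rw [contract]
  simp only [Fin.sum_univ_four, emForm, twoForm, stretch_apply, Pi.neg_apply, he, hh, dot]
  simp
  ring

theorem sum_squareZ_mul_normal (hM : 0 < M) (hp : p ∈ exterior M)
    (hZ : fieldZ M F p = emForm M p e h) (he : radial p e = 0) (hh : radial p h = 0) (a : Fin 4) :
    ∑ b, squareZ M F p a b * normal p b = if a = 0 then -(lapse M p)⁻¹ * radial p (cross e h)
      else -(lapse M p)⁻¹ ^ 2 * dot h h * normal p a := by
  simp only [squareZ, hZ, ← Finset.sum_mul, sum_invMetric_mul hM hp]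
  simp only [Fin.sum_univ_four, emForm, twoForm, stretch_apply, hh]
  simp only [radial_eq, dot, cross] at *
  generalize (lapse M p)⁻¹ = g at *
  fin_cases a <;> simp [normal_zero] <;> grind

end Square

theorem current_re {u v : Fin 4 → ℝ}
    (hβ : ∀ a, fieldβ M F p a = (u a : ℂ) + Complex.I * (v a : ℂ))
    (A : Pt → Fin 4 → ℝ) (q : Pt → ℝ) (a : Fin 4) : current M F A q p a
      = ∑ b, (u a * u b + v a * v b - 1 / 2 * metric M p a b *
          ∑ c, ((∑ d, invMetric M p c d * u d) * u c + (∑ d, invMetric M p c d * v d) * v c))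
            * A p b
        + 1 / 2 * q p * (∑ b, (∑ c, invMetric M p b c * u c) * fieldZ M F p a b
          + ∑ b, (∑ c, invMetric M p b c * v c) * hodge M (fieldZ M F) p a b)
        + 1 / 16 * normZ M F p * pd a q p
        - 1 / 4 * ∑ b, squareZ M F p a b * ∑ d, invMetric M p b d * pd d q p := by
  have norm_re : ∑ c, ∑ d, (invMetric M p c d * u c * u d + invMetric M p c d * v c * v d)
      = ∑ c, ((∑ d, invMetric M p c d * u d) * u c + (∑ d, invMetric M p c d * v d) * v c) := by
    simp only [Finset.sum_mul, ← Finset.sum_add_distrib]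
    refine Finset.sum_congr rfl fun c _ => Finset.sum_congr rfl fun d _ => ?_
    ring
  have sym (x : Fin 4) :
      2⁻¹ * (u a * u x + v a * v x + (u x * u a + v x * v a)) = u a * u x + v a * v x := by ring
  simp only [current, currentℂ, superH, fieldβUp, hβ]
  simp only [one_div, star_add, RCLike.star_def, Complex.conj_ofReal, star_mul', Complex.conj_I,
    neg_mul, star_sum, Complex.ofReal_sum, Complex.ofReal_mul, Complex.sub_re, Complex.add_re,
    Complex.re_sum, Complex.mul_re, Complex.inv_re, Complex.re_ofNat, Complex.normSq_ofNat,
    div_self_mul_self', Complex.ofReal_re, Complex.I_re, zero_mul, Complex.I_im, Complex.ofReal_im,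
    mul_zero, sub_self, add_zero, Complex.neg_re, neg_zero, Complex.add_im, Complex.mul_im, one_mul,
    zero_add, Complex.neg_im, mul_neg, sub_neg_eq_add, Complex.inv_im, Complex.im_ofNat, zero_div,
    sub_zero, Complex.im_sum, Complex.sub_im, Finset.sum_neg_distrib, mul_one, zero_sub,
    Finset.sum_const_zero]
  rw [norm_re]
  simp only [sym, mul_assoc, ← Finset.mul_sum]
  ring

variable {u v e h : Pt → Fin 4 → ℝ}

theorem sum_invMetric_mul_self (hM : 0 < M) (hp : p ∈ exterior M) (w : Fin 4 → ℝ) :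
    ∑ c, (∑ d, invMetric M p c d * w d) * w c = sqLen M p w := by
  simp only [sum_invMetric_mul hM hp, Fin.sum_univ_four, Fin.reduceEq, if_true, if_false,
    radial_eq, sqLen, dot]
  ring

theorem metric_mulVec_waveFlux (hM : 0 < M) (hp : p ∈ exterior M) (a : Fin 4) :
    (metric M p).mulVec (waveFlux M u p) a = u p a * radial p (u p)
      - 1 / 2 * sqLen M p (u p) * (metric M p).mulVec (normal p) a := by
  have hr := (rad_pos hM hp).ne'
  have hf := (lapse_pos hM hp).ne'
  rw [metric_mulVec hr, metric_mulVec hr, radial_normal hr, radial_waveFlux hr]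
  simp only [waveFlux, raised, Pi.neg_apply, Pi.add_apply, Pi.smul_apply, smul_eq_mul, normal_zero]
  split_ifs with ha
  · subst ha
    field_simp
    ring
  · rw [sqLen]
    field_simp
    ring

theorem sum_up_mul_emForm (hM : 0 < M) (hp : p ∈ exterior M) (he : radial p (e p) = 0)
    (hh : radial p (h p) = 0) (a : Fin 4) :
    ∑ b, (∑ c, invMetric M p b c * u p c) * emForm M p (e p) (h p) a b
      = (metric M p).mulVec (mixFlux M u e h p) a := by
  have hr := (rad_pos hM hp).ne'
  have hff : lapse M p * (lapse M p)⁻¹ = 1 := mul_inv_cancel₀ (lapse_pos hM hp).ne'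
  rw [metric_mulVec hr, radial_mixFlux he]
  simp only [sum_invMetric_mul hM hp, Fin.sum_univ_four, emForm, twoForm, stretch_apply, hh,
    mixFlux, smul_eq_mul]
  simp only [radial_eq, dot, cross] at *
  generalize (lapse M p)⁻¹ = g at *
  fin_cases a <;> simp <;> grind [normal_sq hr]

theorem metric_mulVec_fieldFlux (hM : 0 < M) (hp : p ∈ exterior M)
    (hZ : fieldZ M F p = emForm M p (e p) (h p)) (he : radial p (e p) = 0)
    (hh : radial p (h p) = 0) (a : Fin 4) :
    (metric M p).mulVec (fieldFlux M e h p) a = 1 / 16 * normZ M F p * normal p a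
      + 1 / 4 * lapse M p * ∑ b, squareZ M F p a b * normal p b := by
  have hr := (rad_pos hM hp).ne'
  have hf := (lapse_pos hM hp).ne'
  rw [metric_mulVec hr, radial_fieldFlux hr, normZ_eq hM hp hZ he hh,
    sum_squareZ_mul_normal hM hp hZ he hh]
  simp only [fieldFlux]
  split_ifs with ha
  · subst ha
    rw [normal_zero]
    field_simp
    ring
  · field_simp
    ring

/-- The vector field `P^a` of the current of a multiplier `A = α(r) ∂_r` and a function `q(r)` with
derivative `q₁`. -/
def currentVec (M : ℝ) (u v e h : Pt → Fin 4 → ℝ) (α q q₁ : ℝ → ℝ) (p : Pt) : Fin 4 → ℝ :=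
  α (rad p) • (waveFlux M u p + waveFlux M v p)
    + ((1 / 2 * q (rad p)) • (mixFlux M u e h p + mixFlux M v h (fun x => -e x) p)
      + q₁ (rad p) • fieldFlux M e h p)

theorem BetaSystem.current_eq (hS : BetaSystem M F u v e h) (hM : 0 < M) (hp : p ∈ exterior M)
    {A : Pt → Fin 4 → ℝ} {Q : Pt → ℝ} {α q q₁ : ℝ → ℝ} (hA : A p = α (rad p) • normal p)
    (hQ : Q p = q (rad p)) (hQ' : ∀ a, pd a Q p = q₁ (rad p) * normal p a) :
    current M F A Q p = (metric M p).mulVec (currentVec M u v e h α q q₁ p) := by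
  have he := hS.re.tangential_e p hp
  have hh := hS.re.tangential_h p hp
  have hZ := hS.fieldZ_eq p hp
  ext a
  have squareZ_grad : ∑ b, squareZ M F p a b * ∑ d, invMetric M p b d * pd d Q p
      = -lapse M p * q₁ (rad p) * ∑ b, squareZ M F p a b * normal p b := by
    have up_grad (b : Fin 4) : ∑ d, invMetric M p b d * pd d Q p
        = q₁ (rad p) * (-lapse M p * normal p b) := by
      rw [← sum_invMetric_mul_normal hM hp, Finset.mul_sum]
      exact Finset.sum_congr rfl fun d _ => by rw [hQ']; ring
    simp only [up_grad, Finset.mul_sum]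
    exact Finset.sum_congr rfl fun d _ => by ring
  have wave (k : ℝ) : ∑ b, (u p a * u p b + v p a * v p b - 1 / 2 * metric M p a b * k) * A p b
      = α (rad p) * (u p a * radial p (u p) + v p a * radial p (v p)
        - 1 / 2 * k * (metric M p).mulVec (normal p) a) := by
    simp only [hA, Matrix.mulVec, dotProduct, Fin.sum_univ_four, radial_eq, normal_zero,
      Pi.smul_apply, smul_eq_mul]
    ring
  rw [current_re (hS.fieldβ_eq p hp), wave, Finset.sum_add_distrib,
    sum_invMetric_mul_self hM hp, sum_invMetric_mul_self hM hp, squareZ_grad, hodge_emForm hM hp hZ,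
    hZ, sum_up_mul_emForm hM hp he hh,
    sum_up_mul_emForm (e := h) (h := fun x => -e x) hM hp hh (hS.im.tangential_h p hp), hQ, hQ']
  simp only [currentVec, Matrix.mulVec_add, Matrix.mulVec_smul, Pi.add_apply, Pi.smul_apply,
    smul_eq_mul, metric_mulVec_waveFlux hM hp, metric_mulVec_fieldFlux hM hp hZ he hh]
  ring

end Current

/-! ### The divergence of the Morawetz current -/

theorem sum_pd_eq_fourDiv (V : Pt → Fin 4 → ℝ) (p : Pt) :
    ∑ a, pd a (fun x => V x a) p = fourDiv V p := by
  simp only [Fin.sum_univ_four, fourDiv, spaceDiv, pdVec]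
  ring

theorem lapse_eq {M : ℝ} {p : Pt} (h : rad p ≠ 0) : lapse M p = (rad p - 2 * M) / rad p := by
  unfold lapse
  field_simp

section Divergence

variable {M : ℝ} {p : Pt} {F : Pt → Fin 4 → Fin 4 → ℝ} {u v e h : Pt → Fin 4 → ℝ}

theorem WaveSystem.differentiableAt_waveFlux (hS : WaveSystem M u e h) (hM : 0 < M)
    (hp : p ∈ exterior M) : DifferentiableAt ℝ (waveFlux M u) p :=
  Schwarzschild.differentiableAt_waveFlux hM hp
    (differentiableAt_of_contDiffOn_exterior hS.smooth_u hp)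

theorem WaveSystem.differentiableAt_mixFlux (hS : WaveSystem M u e h) (hM : 0 < M)
    (hp : p ∈ exterior M) : DifferentiableAt ℝ (mixFlux M u e h) p :=
  Schwarzschild.differentiableAt_mixFlux hM hp
    (differentiableAt_of_contDiffOn_exterior hS.smooth_u hp)
    (differentiableAt_of_contDiffOn_exterior hS.smooth_e hp)
    (differentiableAt_of_contDiffOn_exterior hS.smooth_h hp)

theorem BetaSystem.differentiableAt_currentVec (hS : BetaSystem M F u v e h) (hM : 0 < M)
    (hp : p ∈ exterior M) {α q q₁ : ℝ → ℝ} (hα : DifferentiableAt ℝ α (rad p))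
    (hq : DifferentiableAt ℝ q (rad p)) (hq₁ : DifferentiableAt ℝ q₁ (rad p)) :
    DifferentiableAt ℝ (currentVec M u v e h α q q₁) p := by
  have dr := differentiableAt_rad (rad_pos hM hp).ne'
  have hu := hS.re.differentiableAt_waveFlux hM hp
  have hv := hS.im.differentiableAt_waveFlux hM hp
  have hue := hS.re.differentiableAt_mixFlux hM hp
  have hvh := hS.im.differentiableAt_mixFlux hM hp
  have hf := differentiableAt_fieldFlux hM hp
    (differentiableAt_of_contDiffOn_exterior hS.re.smooth_e hp)
    (differentiableAt_of_contDiffOn_exterior hS.re.smooth_h hp)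
  exact ((hα.comp p dr).fun_smul (hu.fun_add hv)).fun_add
    ((((hq.comp p dr).const_mul _).fun_smul (hue.fun_add hvh)).fun_add
      ((hq₁.comp p dr).fun_smul hf))

theorem radial_cross_neg (p : Pt) (a b : Fin 4 → ℝ) :
    radial p (cross a (-b)) = -radial p (cross a b) := by
  simp only [radial, dot, cross, Matrix.cons_val, Pi.neg_apply]
  ring

theorem BetaSystem.radial_cross_add (hS : BetaSystem M F u v e h) (hM : 0 < M)
    (hp : p ∈ exterior M) :
    radial p (cross (u p) (h p)) - radial p (cross (v p) (e p))
      = 1 / 2 * (lapse M p)⁻¹ * (radial p (cross (pdVec 0 e p) (h p))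
          + radial p (cross (e p) (pdVec 0 h p)))
        - 1 / 4 * radial p (grad (fun x => dot (e x) (e x) + dot (h x) (h x)) p) := by
  have he := differentiableAt_of_contDiffOn_exterior hS.re.smooth_e hp
  have hh := differentiableAt_of_contDiffOn_exterior hS.re.smooth_h hp
  have grad_add : radial p (grad (fun x => dot (e x) (e x) + dot (h x) (h x)) p)
      = radial p (grad (fun x => dot (e x) (e x)) p)
        + radial p (grad (fun x => dot (h x) (h x)) p) := by
    rw [← radial_add]
    congr 1
    ext a
    exact pd_add (differentiableAt_dot he he) (differentiableAt_dot hh hh)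
  have im := hS.im.radial_cross_u hM hp
  have cross_comm (a b : Fin 4 → ℝ) : radial p (cross a b) = -radial p (cross b a) := by
    simp only [radial, dot, cross, Matrix.cons_val]
    ring
  have dot_neg_neg (a : Fin 4 → ℝ) : dot (-a) (-a) = dot a a := by
    simp only [dot, Pi.neg_apply, neg_mul_neg]
  simp only [radial_cross_neg, dot_neg_neg] at im
  rw [cross_comm (pdVec 0 h p)] at im
  rw [grad_add]
  linear_combination hS.re.radial_cross_u hM hp + im

theorem BetaSystem.fourDiv_currentVec (hS : BetaSystem M F u v e h) (hM : 0 < M)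
    (hp : p ∈ exterior M) {α q q₁ : ℝ → ℝ} {α' q₂ : ℝ} (hα : HasDerivAt α α' (rad p))
    (hq : HasDerivAt q (q₁ (rad p)) (rad p)) (hq₁ : HasDerivAt q₁ q₂ (rad p)) :
    fourDiv (currentVec M u v e h α q q₁) p =
      1 / 2 * (α (rad p) * ((1 - lapse M p) / rad p) * (lapse M p)⁻¹ - α')
        * ((lapse M p)⁻¹ * (u p 0 ^ 2 + v p 0 ^ 2)
          + lapse M p * (radial p (u p) ^ 2 + radial p (v p) ^ 2))
      + (1 / 2 * α' - α (rad p) / rad p)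
        * (dot (u p) (u p) - radial p (u p) ^ 2 + (dot (v p) (v p) - radial p (v p) ^ 2))
      + q (rad p) * (sqLen M p (u p) + sqLen M p (v p))
      + 1 / 8 * (q₂ + 2 * q₁ (rad p) / rad p) * (dot (e p) (e p) + dot (h p) (h p)) := by
  have hr := (rad_pos hM hp).ne'
  have he := differentiableAt_of_contDiffOn_exterior hS.re.smooth_e hp
  have hh := differentiableAt_of_contDiffOn_exterior hS.re.smooth_h hp
  have du := hS.re.differentiableAt_waveFlux hM hp
  have dv := hS.im.differentiableAt_waveFlux hM hp
  have due := hS.re.differentiableAt_mixFlux hM hp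
  have dvh := hS.im.differentiableAt_mixFlux hM hp
  have df := differentiableAt_fieldFlux hM hp he hh
  have dα : DifferentiableAt ℝ (fun x => α (rad x)) p :=
    hα.differentiableAt.comp p (differentiableAt_rad hr)
  have dq : DifferentiableAt ℝ (fun x => 1 / 2 * q (rad x)) p :=
    (hq.differentiableAt.comp p (differentiableAt_rad hr)).const_mul _
  have dq₁ : DifferentiableAt ℝ (fun x => q₁ (rad x)) p :=
    hq₁.differentiableAt.comp p (differentiableAt_rad hr)
  have fluxes : fourDiv (currentVec M u v e h α q q₁) p
      = fourDiv (fun x => α (rad x) • (waveFlux M u x + waveFlux M v x)) p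
        + (fourDiv (fun x => (1 / 2 * q (rad x)) •
            (mixFlux M u e h x + mixFlux M v h (fun x => -e x) x)) p
          + fourDiv (fun x => q₁ (rad x) • fieldFlux M e h x) p) := by
    rw [← fourDiv_add (dq.fun_smul (due.fun_add dvh)) (dq₁.fun_smul df),
      ← fourDiv_add (dα.fun_smul (du.fun_add dv))
        ((dq.fun_smul (due.fun_add dvh)).fun_add (dq₁.fun_smul df))]
    rfl
  rw [fluxes, fourDiv_smul_comp_rad hr hα (du.fun_add dv),
    fourDiv_smul_comp_rad hr (φ := fun r => 1 / 2 * q r) (hq.const_mul _) (due.fun_add dvh),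
    fourDiv_smul_comp_rad hr hq₁ df, fourDiv_add du dv, fourDiv_add due dvh, radial_add, radial_add,
    radial_waveFlux hr, radial_waveFlux hr, radial_mixFlux (hS.re.tangential_e p hp),
    radial_mixFlux (hS.im.tangential_e p hp), radial_fieldFlux hr, hS.re.fourDiv_waveFlux hM hp,
    hS.im.fourDiv_waveFlux hM hp, hS.re.fourDiv_mixFlux hM hp, hS.im.fourDiv_mixFlux hM hp,
    fourDiv_fieldFlux hM hp he hh, radial_cross_neg p (v p) (e p)]
  linear_combination 1 / 2 * q₁ (rad p) * hS.radial_cross_add hM hp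

theorem BetaSystem.div1_current (hS : BetaSystem M F u v e h) (hM : 0 < M)
    (hp : p ∈ exterior M) {A : Pt → Fin 4 → ℝ} {Q : Pt → ℝ} {α q q₁ : ℝ → ℝ}
    (hA : ∀ x ∈ exterior M, A x = α (rad x) • normal x) (hQ : ∀ x, Q x = q (rad x))
    (hα : DifferentiableAt ℝ α (rad p)) (hq : ∀ r, r ≠ 0 → HasDerivAt q (q₁ r) r)
    (hq₁ : DifferentiableAt ℝ q₁ (rad p)) :
    div1 M (current M F A Q) p = fourDiv (currentVec M u v e h α q q₁) p := by
  have hd := hS.differentiableAt_currentVec hM hp hα (hq _ (rad_pos hM hp).ne').differentiableAt hq₁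
  obtain rfl : Q = fun x => q (rad x) := funext hQ
  rw [div1_eq_sum_pd hM hp (fun x hx => hS.current_eq hM hx (hA x hx) rfl
    (fun a => pd_comp_rad (rad_pos hM hx).ne' (hq _ (rad_pos hM hx).ne') a)) (by fun_prop),
    sum_pd_eq_fourDiv]

theorem hasDerivAt_morawetzA_profile {r : ℝ} (hr : r ≠ 0) :
    HasDerivAt (fun r => (r - 3 * M) * (r - 2 * M) / (2 * r ^ 2))
      (M * (5 * r - 12 * M) / (2 * r ^ 3)) r := by
  have hn := ((hasDerivAt_id' r).sub_const (3 * M)).fun_mul ((hasDerivAt_id' r).sub_const (2 * M))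
  have hd := (hasDerivAt_pow 2 r).const_mul 2
  refine (hn.fun_div hd (by positivity)).congr_deriv ?_
  field_simp
  ring

theorem hasDerivAt_morawetzq_profile {r : ℝ} (hr : r ≠ 0) :
    HasDerivAt (fun r => 9 * M ^ 2 * (r - 2 * M) * (2 * r - 3 * M) / (4 * r ^ 5))
      (-(9 * M ^ 2 * (3 * r - 5 * M) * (r - 3 * M)) / (2 * r ^ 6)) r := by
  have hn := (((hasDerivAt_id' r).sub_const (2 * M)).const_mul (9 * M ^ 2)).fun_mul
    (((hasDerivAt_id' r).const_mul 2).sub_const (3 * M))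
  have hd := (hasDerivAt_pow 5 r).const_mul 4
  refine (hn.fun_div hd (by positivity)).congr_deriv ?_
  field_simp
  ring

theorem hasDerivAt_deriv_morawetzq_profile {r : ℝ} (hr : r ≠ 0) :
    HasDerivAt (fun r => -(9 * M ^ 2 * (3 * r - 5 * M) * (r - 3 * M)) / (2 * r ^ 6))
      (9 * M ^ 2 * (6 * r ^ 2 - 35 * M * r + 45 * M ^ 2) / r ^ 7) r := by
  have hn := (((((hasDerivAt_id' r).const_mul 3).sub_const (5 * M)).const_mul
    (9 * M ^ 2)).fun_mul ((hasDerivAt_id' r).sub_const (3 * M))).fun_neg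
  have hd := (hasDerivAt_pow 6 r).const_mul 2
  refine (hn.fun_div hd (by positivity)).congr_deriv ?_
  field_simp
  ring

theorem BetaSystem.neg_div1_morawetzP (hS : BetaSystem M F u v e h) (hM : 0 < M)
    (hp : p ∈ exterior M) : -div1 M (morawetzP M F) p =
      3 * M * (rad p - 2 * M) * (rad p - 3 * M) ^ 2 / (4 * rad p ^ 5)
        * ((lapse M p)⁻¹ * (u p 0 ^ 2 + v p 0 ^ 2))
      + (3 * M * (rad p - 2 * M) / (4 * rad p ^ 3)
          + 9 * M ^ 2 * (rad p - 2 * M) * (2 * rad p - 3 * M) / (4 * rad p ^ 5))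
        * (lapse M p * (radial p (u p) ^ 2 + radial p (v p) ^ 2))
      + (rad p - 3 * M) ^ 2 * (2 * rad p ^ 2 - 3 * M * rad p + 6 * M ^ 2) / (4 * rad p ^ 5)
        * (dot (u p) (u p) - radial p (u p) ^ 2 + (dot (v p) (v p) - radial p (v p) ^ 2))
      - 27 / 8 * M ^ 2 * (rad p - 2 * M) * (rad p - 5 * M) / rad p ^ 7
        * (dot (e p) (e p) + dot (h p) (h p)) := by
  have hr := (rad_pos hM hp).ne'
  have hf := (lapse_pos hM hp).ne'
  rw [lapse_eq hr] at hf
  have hf' : rad p - 2 * M ≠ 0 := (div_ne_zero_iff.1 hf).1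
  have hα := hasDerivAt_morawetzA_profile (M := M) hr
  have hq₁ := hasDerivAt_deriv_morawetzq_profile (M := M) hr
  rw [morawetzP, hS.div1_current hM hp (A := morawetzA M) (Q := morawetzq M)
    (fun x _ => funext fun _ => rfl) (fun _ => rfl)
    hα.differentiableAt (fun _ => hasDerivAt_morawetzq_profile) hq₁.differentiableAt,
    hS.fourDiv_currentVec hM hp hα (hasDerivAt_morawetzq_profile hr) hq₁]
  simp only [sqLen, lapse_eq hr]
  field_simp
  ring

end Divergence

/-! ### The bulk term -/

theorem radial_sq_le {p : Pt} (h : rad p ≠ 0) (w : Fin 4 → ℝ) : radial p w ^ 2 ≤ dot w w := by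
  have lagrange : dot w w - radial p w ^ 2 = (normal p 1 * w 2 - normal p 2 * w 1) ^ 2
      + (normal p 2 * w 3 - normal p 3 * w 2) ^ 2 + (normal p 3 * w 1 - normal p 1 * w 3) ^ 2 := by
    simp only [radial, dot]
    linear_combination -(w 1 * w 1 + w 2 * w 2 + w 3 * w 3) * normal_sq h
  have : 0 ≤ dot w w - radial p w ^ 2 := lagrange ▸ by positivity
  linarith

theorem sq_frame_add_sq_radial {p : Pt} (h : rad p ≠ 0) (ha : axisDist p ≠ 0) (w : Fin 4 → ℝ) :
    (∑ a, w a * frameX p a) ^ 2 + (∑ a, w a * frameY p a) ^ 2 + radial p w ^ 2 = dot w w := by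
  obtain ⟨c, hc⟩ : ∃ c, c = p 1 / axisDist p := ⟨_, rfl⟩
  obtain ⟨s, hs⟩ : ∃ s, s = p 2 / axisDist p := ⟨_, rfl⟩
  obtain ⟨σ, hσ⟩ : ∃ σ, σ = axisDist p / rad p := ⟨_, rfl⟩
  have azimuth : c ^ 2 + s ^ 2 = 1 := by
    have : axisDist p ^ 2 = p 1 ^ 2 + p 2 ^ 2 := Real.sq_sqrt (by positivity)
    rw [hc, hs, div_pow, div_pow, ← add_div, ← this, div_self (pow_ne_zero 2 ha)]
  have n₁ : normal p 1 = σ * c := by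
    rw [hc, hσ, normal, if_neg (by decide)]
    field_simp
  have n₂ : normal p 2 = σ * s := by
    rw [hs, hσ, normal, if_neg (by decide)]
    field_simp
  have n₃ : normal p 3 = p 3 / rad p := if_neg (by decide)
  have polar := normal_sq h
  rw [n₁, n₂] at polar
  have polar' : σ ^ 2 + normal p 3 ^ 2 = 1 := by linear_combination polar - σ ^ 2 * azimuth
  simp only [Fin.sum_univ_four, frameX, frameY, radial, dot, n₁, n₂, ← n₃, ← hc, ← hs, ← hσ]
  simp
  linear_combination (w 1 ^ 2 + w 2 ^ 2) * azimuth + ((w 1 * c + w 2 * s) ^ 2 + w 3 ^ 2) * polar'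

theorem sq_frame_le {p : Pt} (h : rad p ≠ 0) (w : Fin 4 → ℝ) :
    (∑ a, w a * frameX p a) ^ 2 + (∑ a, w a * frameY p a) ^ 2 ≤ dot w w - radial p w ^ 2 := by
  by_cases ha : axisDist p = 0
  · simpa [Fin.sum_univ_four, frameX, frameY, ha] using radial_sq_le h w
  · linarith [sq_frame_add_sq_radial h ha w]

section Bulk

variable {M : ℝ} {p : Pt} {F : Pt → Fin 4 → Fin 4 → ℝ} {u v e h : Pt → Fin 4 → ℝ}

theorem BetaSystem.norm_βAlong_sq (hS : BetaSystem M F u v e h) (hp : p ∈ exterior M)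
    (ν : Fin 4 → ℝ) :
    ‖βAlong M F p ν‖ ^ 2 = (∑ a, u p a * ν a) ^ 2 + (∑ a, v p a * ν a) ^ 2 := by
  have re_im : βAlong M F p ν
      = ((∑ a, u p a * ν a : ℝ) : ℂ) + ((∑ a, v p a * ν a : ℝ) : ℂ) * Complex.I := by
    simp only [βAlong, hS.fieldβ_eq p hp]
    push_cast
    rw [Finset.sum_mul, ← Finset.sum_add_distrib]
    exact Finset.sum_congr rfl fun a _ => by ring
  rw [re_im, ← Complex.normSq_eq_norm_sq, Complex.normSq_add_mul_I]

theorem BetaSystem.norm_βAlong_frameZ_sq (hS : BetaSystem M F u v e h) (hM : 0 < M)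
    (hp : p ∈ exterior M) : ‖βAlong M F p (frameZ M p)‖ ^ 2
      = lapse M p * (radial p (u p) ^ 2 + radial p (v p) ^ 2) := by
  have component (w : Fin 4 → ℝ) :
      ∑ a, w a * frameZ M p a = Real.sqrt (lapse M p) * radial p w := by
    simp [Fin.sum_univ_four, frameZ, lapse, radial, dot, normal]
    ring
  rw [hS.norm_βAlong_sq hp, component, component, mul_pow, mul_pow,
    Real.sq_sqrt (lapse_pos hM hp).le, mul_add]

theorem BetaSystem.norm_βAlong_frameT_sq (hS : BetaSystem M F u v e h) (hM : 0 < M)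
    (hp : p ∈ exterior M) :
    ‖βAlong M F p (frameT M p)‖ ^ 2 = (lapse M p)⁻¹ * (u p 0 ^ 2 + v p 0 ^ 2) := by
  have component (w : Fin 4 → ℝ) :
      ∑ a, w a * frameT M p a = w 0 * (Real.sqrt (lapse M p))⁻¹ := by
    simp [Fin.sum_univ_four, frameT, lapse]
  rw [hS.norm_βAlong_sq hp, component, component, mul_pow, mul_pow, inv_pow,
    Real.sq_sqrt (lapse_pos hM hp).le]
  ring

theorem BetaSystem.normΘ_eq (hS : BetaSystem M F u v e h) (hM : 0 < M) (hp : p ∈ exterior M) :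
    normΘ M F p = 1 / 4 * (dot (e p) (e p) + dot (h p) (h p)) := by
  have hr := (rad_pos hM hp).ne'
  have hf := lapse_pos hM hp
  have hff : lapse M p * (lapse M p)⁻¹ = 1 := mul_inv_cancel₀ hf.ne'
  have time_component : ∑ a, ∑ b, superW M F p a b * frameT M p a * frameT M p b
      = superW M F p 0 0 * ((Real.sqrt (lapse M p))⁻¹ * (Real.sqrt (lapse M p))⁻¹) := by
    simp [Fin.sum_univ_four, frameT, lapse]
    ring
  rw [normΘ, time_component, ← mul_inv, Real.mul_self_sqrt hf.le, superW,
    squareZ_zero_zero hM hp (hS.fieldZ_eq p hp) (hS.re.tangential_e p hp),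
    normZ_eq hM hp (hS.fieldZ_eq p hp) (hS.re.tangential_e p hp) (hS.re.tangential_h p hp),
    metric_apply hr, normal_zero, ← lapse_eq hr]
  simp
  linear_combination (1 / 2 * dot (e p) (e p) - 1 / 4 * (dot (e p) (e p) - dot (h p) (h p))
    * (lapse M p * (lapse M p)⁻¹ + 1)) * hff

theorem BetaSystem.morawetzBulk_le (hS : BetaSystem M F u v e h) (hM : 0 < M)
    (hp : p ∈ exterior M) :
    morawetzBulk M F p ≤ 1 / 8 * ((rad p - 3 * M) ^ 2 / rad p ^ 3
          * (dot (u p) (u p) - radial p (u p) ^ 2 + (dot (v p) (v p) - radial p (v p) ^ 2))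
        + M * (rad p - 2 * M) / rad p ^ 3
          * (lapse M p * (radial p (u p) ^ 2 + radial p (v p) ^ 2))
        + M * (rad p - 3 * M) ^ 2 * (rad p - 2 * M) / rad p ^ 5
          * ((lapse M p)⁻¹ * (u p 0 ^ 2 + v p 0 ^ 2)))
      + M / (400 * rad p ^ 4) * (dot (e p) (e p) + dot (h p) (h p)) := by
  have hr := rad_pos hM hp
  have angular : ‖βAlong M F p (frameX p)‖ ^ 2 + ‖βAlong M F p (frameY p)‖ ^ 2
      ≤ dot (u p) (u p) - radial p (u p) ^ 2 + (dot (v p) (v p) - radial p (v p) ^ 2) := by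
    rw [hS.norm_βAlong_sq hp, hS.norm_βAlong_sq hp]
    linarith [sq_frame_le hr.ne' (u p), sq_frame_le hr.ne' (v p)]
  have hΘ : M / (100 * rad p ^ 4) * (1 / 4 * (dot (e p) (e p) + dot (h p) (h p)))
      = M / (400 * rad p ^ 4) * (dot (e p) (e p) + dot (h p) (h p)) := by
    field_simp
    ring
  rw [morawetzBulk, normβDeg, hS.norm_βAlong_frameZ_sq hM hp, hS.norm_βAlong_frameT_sq hM hp,
    hS.normΘ_eq hM hp, hΘ]
  gcongr

theorem BetaSystem.morawetzBulk_nonneg (hS : BetaSystem M F u v e h) (hM : 0 < M)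
    (hp : p ∈ exterior M) : 0 ≤ morawetzBulk M F p := by
  have hr := rad_pos hM hp
  have hr2 : 0 ≤ rad p - 2 * M := (sub_pos.2 hp).le
  rw [morawetzBulk, normβDeg, hS.normΘ_eq hM hp]
  simp only [dot, ← sq]
  positivity

end Bulk

/-! ### The Hodge estimate on the spheres -/

/-- The derivative along the generator `x^j ∂_k - x^k ∂_j` of rotations. -/
def rot (j k : Fin 4) (f : Pt → ℝ) (p : Pt) : ℝ := p j * pd k f p - p k * pd j f p

section Rot

variable {M : ℝ} {p : Pt} {i j k : Fin 4} {f g : Pt → ℝ}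

theorem rot_add (hf : DifferentiableAt ℝ f p) (hg : DifferentiableAt ℝ g p) :
    rot j k (fun x => f x + g x) p = rot j k f p + rot j k g p := by
  simp only [rot, pd_add hf hg]
  ring

theorem rot_sub (hf : DifferentiableAt ℝ f p) (hg : DifferentiableAt ℝ g p) :
    rot j k (fun x => f x - g x) p = rot j k f p - rot j k g p := by
  simp only [rot, pd_sub hf hg]
  ring

theorem rot_mul (hf : DifferentiableAt ℝ f p) (hg : DifferentiableAt ℝ g p) :
    rot j k (fun x => f x * g x) p = rot j k f p * g p + f p * rot j k g p := by
  simp only [rot, pd_mul hf hg]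
  ring

theorem rot_const {c : ℝ} : rot j k (fun _ => c) p = 0 := by
  simp only [rot, pd_const]
  ring

theorem rot_comp_rad (hj : j ≠ 0) (hk : k ≠ 0) {φ : ℝ → ℝ} (h : rad p ≠ 0)
    (hφ : DifferentiableAt ℝ φ (rad p)) : rot j k (fun x => φ (rad x)) p = 0 := by
  simp only [rot, pd_comp_rad h hφ.hasDerivAt, coord_eq h hj, coord_eq h hk]
  ring

theorem contDiffOn_rot {s : Set Pt} (hs : IsOpen s) (hf : ContDiffOn ℝ ∞ f s) :
    ContDiffOn ℝ ∞ (rot j k f) s := by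
  have hj := contDiffOn_pd (a := j) hs hf
  have hk := contDiffOn_pd (a := k) hs hf
  unfold rot
  fun_prop

theorem pd_rot {a : Fin 4} (hj : DifferentiableAt ℝ (pd j f) p)
    (hk : DifferentiableAt ℝ (pd k f) p) :
    pd a (rot j k f) p = (if j = a then 1 else 0) * pd k f p + p j * pd a (pd k f) p
      - (if k = a then 1 else 0) * pd j f p - p k * pd a (pd j f) p := by
  unfold rot
  rw [pd_sub (by fun_prop) (by fun_prop), pd_mul (by fun_prop) hk, pd_mul (by fun_prop) hj,
    pd_coord, pd_coord]
  ring

theorem rot_comm {s : Set Pt} (hs : IsOpen s) (hf : ContDiffOn ℝ ∞ f s) (hp : p ∈ s)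
    (hij : i ≠ j) (hjk : j ≠ k) (hki : k ≠ i) :
    rot j k (rot k i f) p - rot k i (rot j k f) p = -rot i j f p := by
  have d (a : Fin 4) : DifferentiableAt ℝ (pd a f) p :=
    ((contDiffOn_pd hs hf).contDiffAt (hs.mem_nhds hp)).differentiableAt (by simp)
  simp only [rot.eq_1 j k (rot k i f), rot.eq_1 k i (rot j k f), pd_rot (d _) (d _),
    rot.eq_1 i j f, pd_comm hs hf hp (a := k) (b := i), pd_comm hs hf hp (a := j) (b := i),
    pd_comm hs hf hp (a := k) (b := j), if_neg hij, if_neg hjk, if_neg hki, if_neg hij.symm,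
    if_neg hjk.symm, if_neg hki.symm, if_true]
  ring

end Rot

/-- The flux whose rotational divergence relates the divergence and the curl of a vector field on
the spheres to its square. -/
def rotFlux (e : Pt → Fin 4 → ℝ) (i j k : Fin 4) (p : Pt) : ℝ :=
  e p i * rot k i (fun x => e x j) p - e p k * rot i j (fun x => e x i) p + 1 / 2 * (e p j * e p k)

/-- The sum of the rotational derivatives of the components of a flux. -/
def rotDiv (g : Fin 4 → Fin 4 → Fin 4 → Pt → ℝ) (p : Pt) : ℝ :=
  rot 2 3 (g 1 2 3) p + rot 3 1 (g 2 3 1) p + rot 1 2 (g 3 1 2) p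

/-- The matrix `∂_i V_j` of the spatial derivatives of the spatial part of a vector field. -/
def jacobian (V : Pt → Fin 4 → ℝ) (p : Pt) : Matrix (Fin 3) (Fin 3) ℝ :=
  .of fun i j => pdVec i.succ V p j.succ

section Hodge

variable {M : ℝ} {p : Pt} {e : Pt → Fin 4 → ℝ}

theorem contDiffOn_rotFlux {s : Set Pt} (hs : IsOpen s) (he : ContDiffOn ℝ ∞ e s) (i j k : Fin 4) :
    ContDiffOn ℝ ∞ (rotFlux e i j k) s := by
  have he' := contDiffOn_pi.1 he
  have hei := he' i
  have hej := he' j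
  have hek := he' k
  have hkij := contDiffOn_rot (j := k) (k := i) hs hej
  have hiji := contDiffOn_rot (j := i) (k := j) hs hei
  unfold rotFlux
  fun_prop

theorem rot_rotFlux {s : Set Pt} (hs : IsOpen s) (he : ContDiffOn ℝ ∞ e s) (hp : p ∈ s)
    (i j k : Fin 4) : rot j k (rotFlux e i j k) p =
      rot j k (fun x => e x i) p * rot k i (fun x => e x j) p
      + e p i * rot j k (rot k i fun x => e x j) p
      - rot j k (fun x => e x k) p * rot i j (fun x => e x i) p
      - e p k * rot j k (rot i j fun x => e x i) p
      + 1 / 2 * (rot j k (fun x => e x j) p * e p k + e p j * rot j k (fun x => e x k) p) := by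
  have differentiableAt {f : Pt → ℝ} (hf : ContDiffOn ℝ ∞ f s) : DifferentiableAt ℝ f p :=
    (hf.contDiffAt (hs.mem_nhds hp)).differentiableAt (by simp)
  have he' := contDiffOn_pi.1 he
  have di := differentiableAt (he' i)
  have dj := differentiableAt (he' j)
  have dk := differentiableAt (he' k)
  have drj := differentiableAt (contDiffOn_rot (j := k) (k := i) hs (he' j))
  have dri := differentiableAt (contDiffOn_rot (j := i) (k := j) hs (he' i))
  unfold rotFlux
  rw [rot_add ((di.fun_mul drj).fun_sub (dk.fun_mul dri)) ((dj.fun_mul dk).const_mul _),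
    rot_sub (di.fun_mul drj) (dk.fun_mul dri), rot_mul di drj, rot_mul dk dri,
    rot_mul (differentiableAt_const _) (dj.fun_mul dk), rot_mul dj dk, rot_const]
  ring

theorem rotDiv_rotFlux {s : Set Pt} (hs : IsOpen s) (he : ContDiffOn ℝ ∞ e s) (hp : p ∈ s) :
    rotDiv (rotFlux e) p =
      rot 2 3 (fun x => e x 1) p * rot 3 1 (fun x => e x 2) p
      - rot 3 1 (fun x => e x 1) p * rot 2 3 (fun x => e x 2) p
      + rot 3 1 (fun x => e x 2) p * rot 1 2 (fun x => e x 3) p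
      - rot 1 2 (fun x => e x 2) p * rot 3 1 (fun x => e x 3) p
      + rot 1 2 (fun x => e x 3) p * rot 2 3 (fun x => e x 1) p
      - rot 2 3 (fun x => e x 3) p * rot 1 2 (fun x => e x 1) p
      + 1 / 2 * (e p 1 * (rot 3 1 (fun x => e x 3) p - rot 1 2 (fun x => e x 2) p)
        + e p 2 * (rot 1 2 (fun x => e x 1) p - rot 2 3 (fun x => e x 3) p)
        + e p 3 * (rot 2 3 (fun x => e x 2) p - rot 3 1 (fun x => e x 1) p)) := by
  have he' := contDiffOn_pi.1 he
  have comm₁ := rot_comm (i := 3) (j := 1) (k := 2) hs (he' 1) hp (by simp) (by simp) (by simp)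
  have comm₂ := rot_comm (i := 1) (j := 2) (k := 3) hs (he' 2) hp (by simp) (by simp) (by simp)
  have comm₃ := rot_comm (i := 2) (j := 3) (k := 1) hs (he' 3) hp (by simp) (by simp) (by simp)
  simp only [rotDiv, rot_rotFlux hs he hp]
  linear_combination e p 1 * comm₂ + e p 2 * comm₃ + e p 3 * comm₁

open Matrix in
theorem trace_sq_add_sq_sub_four_mul_adjugate {n v : Fin 3 → ℝ} {D : Matrix (Fin 3) (Fin 3) ℝ}
    (hv : ∀ i, v i = 1 / 2 * ∑ j, (D i j + D j i) * n j) :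
    D.trace ^ 2 + (n 0 * (D 1 2 - D 2 1) + n 1 * (D 2 0 - D 0 2) + n 2 * (D 0 1 - D 1 0)) ^ 2
      - 4 * (n ⬝ᵥ D.adjugate *ᵥ n)
      = D.trace ^ 2 - 4 * ∑ i, v i ^ 2 + 4 * D.trace * ∑ i, n i * v i
        - 2 * (D.trace ^ 2 - 1 / 4 * ∑ i, ∑ j, (D i j + D j i) ^ 2) * ∑ i, n i ^ 2 := by
  rw [adjugate_fin_three]
  simp [hv, dotProduct, mulVec, Fin.sum_univ_three, trace]
  ring

/- With `v` the image of `n` under the symmetric part of `D`, the difference of the two sides is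
half the squared norm of `2 (sym D - n vᵀ - v nᵀ)`, made trace-free on the plane orthogonal to
`n`. -/
open Matrix in
theorem four_mul_adjugate_le {n : Fin 3 → ℝ} {D : Matrix (Fin 3) (Fin 3) ℝ}
    (hn : n 0 ^ 2 + n 1 ^ 2 + n 2 ^ 2 = 1) (hD : n ⬝ᵥ D *ᵥ n = 0) :
    4 * (n ⬝ᵥ D.adjugate *ᵥ n) ≤ D.trace ^ 2
      + (n 0 * (D 1 2 - D 2 1) + n 1 * (D 2 0 - D 0 2) + n 2 * (D 0 1 - D 1 0)) ^ 2 := by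
  obtain ⟨v, hv⟩ : ∃ v : Fin 3 → ℝ, ∀ i, v i = 1 / 2 * ∑ j, (D i j + D j i) * n j :=
    ⟨_, fun _ => rfl⟩
  have v_orthogonal : n 0 * v 0 + n 1 * v 1 + n 2 * v 2 = 0 := by
    rw [← hD]
    simp only [hv, dotProduct, mulVec, Fin.sum_univ_three]
    ring
  rw [← sub_nonneg, trace_sq_add_sq_sub_four_mul_adjugate hv]
  have h₀ := hv 0
  have h₁ := hv 1
  have h₂ := hv 2
  have sum_sq : D.trace ^ 2 - 4 * ∑ i, v i ^ 2 + 4 * D.trace * ∑ i, n i * v i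
      - 2 * (D.trace ^ 2 - 1 / 4 * ∑ i, ∑ j, (D i j + D j i) ^ 2) * ∑ i, n i ^ 2
      = 1 / 2 * ∑ i, ∑ j, (D i j + D j i - 2 * n i * v j
        - 2 * v i * n j - D.trace * ((if i = j then 1 else 0) - n i * n j)) ^ 2 := by
    simp [Fin.sum_univ_three, trace] at h₀ h₁ h₂ ⊢
    linear_combination (1 / 2 * ((D 0 0 + D 0 0) ^ 2 + (D 1 1 + D 1 1) ^ 2 + (D 2 2 + D 2 2) ^ 2
        + 2 * ((D 0 1 + D 1 0) ^ 2 + (D 0 2 + D 2 0) ^ 2 + (D 1 2 + D 2 1) ^ 2))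
        - 2 * (D 0 0 + D 1 1 + D 2 2) ^ 2 - 4 * (v 0 ^ 2 + v 1 ^ 2 + v 2 ^ 2)
        - 1 / 2 * (D 0 0 + D 1 1 + D 2 2) ^ 2 * (n 0 ^ 2 + n 1 ^ 2 + n 2 ^ 2 - 1)) * hn
      + (-4 * (n 0 * v 0 + n 1 * v 1 + n 2 * v 2) - 2 * (D 0 0 + D 1 1 + D 2 2)
        + 4 * (n 0 ^ 2 + n 1 ^ 2 + n 2 ^ 2) * (D 0 0 + D 1 1 + D 2 2)) * v_orthogonal
      + (2 * (D 0 0 + D 1 1 + D 2 2) * n 0 - 8 * v 0) * h₀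
      + (2 * (D 0 0 + D 1 1 + D 2 2) * n 1 - 8 * v 1) * h₁
      + (2 * (D 0 0 + D 1 1 + D 2 2) * n 2 - 8 * v 2) * h₂
  rw [sum_sq]
  positivity

open Matrix in
theorem Tangential.rotDiv_rotFlux (hV : Tangential M e) (hM : 0 < M)
    (he : ContDiffOn ℝ ∞ e (exterior M)) (hp : p ∈ exterior M) :
    rotDiv (rotFlux e) p = rad p ^ 2 * ((fun i : Fin 3 => normal p i.succ) ⬝ᵥ
      (jacobian e p).adjugate *ᵥ fun i : Fin 3 => normal p i.succ) - 1 / 2 * dot (e p) (e p) := by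
  have hr := (rad_pos hM hp).ne'
  have hd := differentiableAt_of_contDiffOn_exterior he hp
  have t₀ := hV p hp
  have t₁ := hV.radial_pdVec hM hp hd 1
  have t₂ := hV.radial_pdVec hM hp hd 2
  have t₃ := hV.radial_pdVec hM hp hd 3
  rw [Schwarzschild.rotDiv_rotFlux (isOpen_exterior M) he hp, adjugate_fin_three]
  simp [rot, coord_eq hr, radial, dot, pdVec, jacobian, dotProduct, mulVec,
    Fin.sum_univ_three] at t₀ t₁ t₂ t₃ ⊢
  linear_combination rad p / 2 * (e p 1 * t₁ + e p 2 * t₂ + e p 3 * t₃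
    - (pd 1 (fun x => e x 1) p + pd 2 (fun x => e x 2) p + pd 3 (fun x => e x 3) p) * t₀)
    - 1 / 2 * (e p 1 ^ 2 + e p 2 ^ 2 + e p 3 ^ 2) * mul_inv_cancel₀ hr

theorem Tangential.hodge_le (hV : Tangential M e) (hM : 0 < M)
    (he : ContDiffOn ℝ ∞ e (exterior M)) (hp : p ∈ exterior M) :
    rotDiv (rotFlux e) p + 1 / 2 * dot (e p) (e p)
      ≤ rad p ^ 2 / 4 * (spaceDiv e p ^ 2 + radial p (curl e p) ^ 2) := by
  have hr := (rad_pos hM hp).ne'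
  have hd := differentiableAt_of_contDiffOn_exterior he hp
  have t₀ := hV p hp
  have t₁ := hV.radial_pdVec hM hp hd 1
  have t₂ := hV.radial_pdVec hM hp hd 2
  have t₃ := hV.radial_pdVec hM hp hd 3
  have jacobian_normal : (fun i : Fin 3 => normal p i.succ) ⬝ᵥ
      (jacobian e p).mulVec (fun i : Fin 3 => normal p i.succ) = 0 := by
    simp [radial, dot, jacobian, dotProduct, Matrix.mulVec, Fin.sum_univ_three] at t₀ t₁ t₂ t₃ ⊢
    linear_combination normal p 1 * t₁ + normal p 2 * t₂ + normal p 3 * t₃ - (rad p)⁻¹ * t₀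
  have key := four_mul_adjugate_le (normal_sq hr) jacobian_normal
  rw [hV.rotDiv_rotFlux hM he hp]
  have trace_eq : (jacobian e p).trace = spaceDiv e p := by
    simp [jacobian, Matrix.trace, Fin.sum_univ_three, spaceDiv]
  rw [trace_eq] at key
  have := mul_le_mul_of_nonneg_left key (by positivity : 0 ≤ rad p ^ 2 / 4)
  simp [radial, dot, curl, jacobian] at this ⊢
  linarith

end Hodge

/-! ### The pointwise inequality -/

section Pointwise

variable {M : ℝ} {F : Pt → Fin 4 → Fin 4 → ℝ} {u v e h : Pt → Fin 4 → ℝ} {p : Pt}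

theorem BetaSystem.hodge_le (hS : BetaSystem M F u v e h) (hM : 0 < M) (hp : p ∈ exterior M) :
    rotDiv (rotFlux e) p + rotDiv (rotFlux h) p + 1 / 2 * (dot (e p) (e p) + dot (h p) (h p))
      ≤ rad p * (rad p - 2 * M) * ((lapse M p)⁻¹ * (u p 0 ^ 2 + v p 0 ^ 2)
        + lapse M p * (radial p (u p) ^ 2 + radial p (v p) ^ 2)) := by
  have hr := rad_pos hM hp
  have hf := lapse_pos hM hp
  have hodge_e := hS.re.tangential_e.hodge_le hM hS.re.smooth_e hp
  have hodge_h := hS.re.tangential_h.hodge_le hM hS.re.smooth_h hp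
  have time_u := hS.re.time p hp
  have time_v : v p 0 = 1 / 2 * spaceDiv h p := hS.im.time p hp
  have radial_u := hS.re.radial_u hM hp
  have radial_v : lapse M p * radial p (v p) = -(1 / 2 * radial p (curl e p)) := by
    rw [hS.im.radial_u hM hp, curl_neg]
    simp [radial, dot_neg]
  have lapse_mul : rad p - 2 * M = rad p * lapse M p := by
    rw [lapse_eq hr.ne', mul_div_cancel₀ _ hr.ne']
  calc _ ≤ rad p ^ 2 * ((1 / 2 * spaceDiv e p) ^ 2 + (1 / 2 * spaceDiv h p) ^ 2
        + ((1 / 2 * radial p (curl h p)) ^ 2 + (-(1 / 2 * radial p (curl e p))) ^ 2)) := by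
        linarith
    _ = rad p ^ 2 * (u p 0 ^ 2 + v p 0 ^ 2
        + ((lapse M p * radial p (u p)) ^ 2 + (lapse M p * radial p (v p)) ^ 2)) := by
        rw [time_u, time_v, radial_u, radial_v]
    _ = _ := by
        rw [lapse_mul]
        field_simp

/-- The coefficient of the rotational derivatives in the pointwise Morawetz inequality. It is
chosen so that the time components of `β` cancel there. -/
def rotCoeff (M r : ℝ) : ℝ := 5 / 8 * M * (r - 3 * M) ^ 2 / r ^ 6

theorem rotCoeff_nonneg (hM : 0 ≤ M) (r : ℝ) : 0 ≤ rotCoeff M r := by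
  unfold rotCoeff
  positivity

theorem time_coeff_eq {r : ℝ} (hr : r ≠ 0) :
    1 / 8 * (M * (r - 3 * M) ^ 2 * (r - 2 * M) / r ^ 5) + rotCoeff M r * (r * (r - 2 * M))
      = 3 * M * (r - 2 * M) * (r - 3 * M) ^ 2 / (4 * r ^ 5) := by
  unfold rotCoeff
  field_simp
  ring

theorem radial_coeff_le {r : ℝ} (hM : 0 < M) (hr : 2 * M < r) :
    1 / 8 * (M * (r - 2 * M) / r ^ 3) + rotCoeff M r * (r * (r - 2 * M))
      ≤ 3 * M * (r - 2 * M) / (4 * r ^ 3)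
        + 9 * M ^ 2 * (r - 2 * M) * (2 * r - 3 * M) / (4 * r ^ 5) := by
  have hr₀ : 0 < r := by linarith
  have : 0 ≤ (r - 2 * M) * (2 * r - 3 * M) := mul_nonneg (by linarith) (by linarith)
  rw [← sub_nonneg]
  calc 0 ≤ 33 / 8 * M ^ 2 * ((r - 2 * M) * (2 * r - 3 * M)) / r ^ 5 := by positivity
    _ = _ := by
      unfold rotCoeff
      field_simp
      ring

theorem angular_coeff_le {r : ℝ} (hr : 0 < r) :
    1 / 8 * ((r - 3 * M) ^ 2 / r ^ 3)
      ≤ (r - 3 * M) ^ 2 * (2 * r ^ 2 - 3 * M * r + 6 * M ^ 2) / (4 * r ^ 5) := by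
  rw [← sub_nonneg]
  calc 0 ≤ (r - 3 * M) ^ 2 * (3 * (r - M) ^ 2 + 9 * M ^ 2) / (8 * r ^ 5) := by positivity
    _ = _ := by
      field_simp
      ring

theorem zeroth_order_coeff_le {r : ℝ} (hM : 0 < M) (hr : 2 * M < r) :
    27 / 8 * M ^ 2 * (r - 2 * M) * (r - 5 * M) / r ^ 7 + M / (400 * r ^ 4)
      ≤ 1 / 2 * rotCoeff M r := by
  have hr₀ : 0 < r := by linarith
  have : 0 ≤ 124 * r - 240 * M := by linarith
  rw [← sub_nonneg]
  calc 0 ≤ M / (400 * r ^ 7) * ((124 * r - 240 * M) * (r - 15 / 2 * M) ^ 2) := by positivity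
    _ = _ := by
      unfold rotCoeff
      field_simp
      ring

theorem differentiableAt_rotCoeff {r : ℝ} (hr : r ≠ 0) : DifferentiableAt ℝ (rotCoeff M) r := by
  unfold rotCoeff
  exact DifferentiableAt.fun_div (by fun_prop) (by fun_prop) (pow_ne_zero _ hr)

theorem contDiffOn_rotCoeff (hM : 0 < M) :
    ContDiffOn ℝ ∞ (fun x => rotCoeff M (rad x)) (exterior M) := by
  have h := contDiffOn_rad hM
  unfold rotCoeff
  exact ContDiffOn.div (by fun_prop) (h.pow 6) fun x hx => pow_ne_zero _ (rad_pos hM hx).ne'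

/-- The weighted rotational flux of a pair of fields in the pointwise Morawetz inequality. -/
def weightedFlux (M : ℝ) (e h : Pt → Fin 4 → ℝ) (i j k : Fin 4) (p : Pt) : ℝ :=
  rotCoeff M (rad p) * (rotFlux e i j k p + rotFlux h i j k p)

theorem contDiffOn_weightedFlux (hM : 0 < M) (he : ContDiffOn ℝ ∞ e (exterior M))
    (hh : ContDiffOn ℝ ∞ h (exterior M)) (i j k : Fin 4) :
    ContDiffOn ℝ ∞ (weightedFlux M e h i j k) (exterior M) :=
  (contDiffOn_rotCoeff hM).mul ((contDiffOn_rotFlux (isOpen_exterior M) he i j k).add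
    (contDiffOn_rotFlux (isOpen_exterior M) hh i j k))

theorem rotDiv_weightedFlux (hM : 0 < M) (he : ContDiffOn ℝ ∞ e (exterior M))
    (hh : ContDiffOn ℝ ∞ h (exterior M)) (hp : p ∈ exterior M) :
    rotDiv (weightedFlux M e h) p
      = rotCoeff M (rad p) * (rotDiv (rotFlux e) p + rotDiv (rotFlux h) p) := by
  have hr := (rad_pos hM hp).ne'
  have rot_eq (i j k : Fin 4) (hj : j ≠ 0) (hk : k ≠ 0) : rot j k (weightedFlux M e h i j k) p
      = rotCoeff M (rad p) * (rot j k (rotFlux e i j k) p + rot j k (rotFlux h i j k) p) := by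
    have de := differentiableAt_of_contDiffOn_exterior
      (contDiffOn_rotFlux (isOpen_exterior M) he i j k) hp
    have dh := differentiableAt_of_contDiffOn_exterior
      (contDiffOn_rotFlux (isOpen_exterior M) hh i j k) hp
    unfold weightedFlux
    rw [rot_mul (differentiableAt_of_contDiffOn_exterior (contDiffOn_rotCoeff hM) hp)
      (de.fun_add dh), rot_comp_rad hj hk hr (differentiableAt_rotCoeff hr), rot_add de dh]
    ring
  simp only [rotDiv, rot_eq 1 2 3 (by simp) (by simp), rot_eq 2 3 1 (by simp) (by simp),
    rot_eq 3 1 2 (by simp) (by simp)]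
  ring

theorem BetaSystem.morawetzBulk_add_rotDiv_le (hS : BetaSystem M F u v e h) (hM : 0 < M)
    (hp : p ∈ exterior M) :
    morawetzBulk M F p + rotDiv (weightedFlux M e h) p ≤ -div1 M (morawetzP M F) p := by
  have hr := rad_pos hM hp
  have hf := lapse_pos hM hp
  have bulk_le := hS.morawetzBulk_le hM hp
  have hodge := mul_le_mul_of_nonneg_left (hS.hodge_le hM hp) (rotCoeff_nonneg hM.le (rad p))
  have angular_nonneg : 0 ≤ dot (u p) (u p) - radial p (u p) ^ 2
      + (dot (v p) (v p) - radial p (v p) ^ 2) := by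
    linarith [radial_sq_le hr.ne' (u p), radial_sq_le hr.ne' (v p)]
  have field_nonneg : 0 ≤ dot (e p) (e p) + dot (h p) (h p) := by
    simp only [dot]
    linarith [sq_nonneg (e p 1), sq_nonneg (e p 2), sq_nonneg (e p 3), sq_nonneg (h p 1),
      sq_nonneg (h p 2), sq_nonneg (h p 3)]
  have radial_nonneg : 0 ≤ lapse M p * (radial p (u p) ^ 2 + radial p (v p) ^ 2) := by positivity
  have angular := mul_le_mul_of_nonneg_right (angular_coeff_le (M := M) hr) angular_nonneg
  have radial := mul_le_mul_of_nonneg_right (radial_coeff_le hM hp) radial_nonneg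
  have zeroth := mul_le_mul_of_nonneg_right (zeroth_order_coeff_le hM hp) field_nonneg
  rw [rotDiv_weightedFlux hM hS.re.smooth_e hS.re.smooth_h hp, hS.neg_div1_morawetzP hM hp,
    ← time_coeff_eq hr.ne']
  linarith

end Pointwise

/-! ### Rotations -/

/-- The rotation by the angle `θ` in the `(x^j, x^k)` plane. -/
def rotate (j k : Fin 4) (θ : ℝ) (x : Pt) : Pt := fun a =>
  if a = j then Real.cos θ * x j - Real.sin θ * x k
  else if a = k then Real.sin θ * x j + Real.cos θ * x k else x a

/-- The matrix of `rotate`. -/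
def rotateMatrix (j k : Fin 4) (θ : ℝ) : Matrix (Fin 4) (Fin 4) ℝ :=
  .of fun a b => rotate j k θ (Pi.single b 1) a

section Rotate

variable {j k : Fin 4}

theorem toLin'_rotateMatrix (hjk : j ≠ k) (θ : ℝ) :
    ⇑(Matrix.toLin' (rotateMatrix j k θ)) = rotate j k θ := by
  ext x a
  rw [Matrix.toLin'_apply, Matrix.mulVec, dotProduct]
  fin_cases j <;> fin_cases k <;> simp only [ne_eq, not_true_eq_false] at hjk <;> fin_cases a <;>
    simp [rotateMatrix, rotate, Fin.sum_univ_four] <;> ring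

theorem det_rotateMatrix (hj : j ≠ 0) (hk : k ≠ 0) (hjk : j ≠ k) (θ : ℝ) :
    (rotateMatrix j k θ).det = 1 := by
  have h := Real.sin_sq_add_cos_sq θ
  fin_cases j <;> fin_cases k <;> simp at hj hk hjk <;>
    simp [rotateMatrix, rotate, Matrix.det_succ_row_zero, Fin.sum_univ_succ, Fin.succAbove] <;>
    linear_combination h

theorem continuous_rotate (j k : Fin 4) (θ : ℝ) : Continuous (rotate j k θ) := by
  unfold rotate
  refine continuous_pi fun a => ?_
  split_ifs <;> fun_prop

theorem measurePreserving_rotate (hj : j ≠ 0) (hk : k ≠ 0) (hjk : j ≠ k) (θ : ℝ) :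
    MeasurePreserving (rotate j k θ) := by
  have hd := det_rotateMatrix hj hk hjk θ
  have := Real.map_matrix_volume_pi_eq_smul_volume_pi (M := rotateMatrix j k θ) (by simp [hd])
  rw [toLin'_rotateMatrix hjk, hd] at this
  exact ⟨(continuous_rotate j k θ).measurable, by simpa using this⟩

theorem rotate_neg_rotate (hjk : j ≠ k) (θ : ℝ) (x : Pt) :
    rotate j k (-θ) (rotate j k θ x) = x := by
  have h := Real.sin_sq_add_cos_sq θ
  ext a
  simp only [rotate, if_true, if_neg hjk.symm, Real.cos_neg, Real.sin_neg]
  split_ifs with haj hak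
  · subst haj
    linear_combination x a * h
  · subst hak
    linear_combination x a * h
  · rfl

theorem measurableEmbedding_rotate (hjk : j ≠ k) (θ : ℝ) : MeasurableEmbedding (rotate j k θ) :=
  (continuous_rotate j k θ).measurableEmbedding
    (Function.LeftInverse.injective (rotate_neg_rotate hjk θ))

theorem rotate_apply_zero (hj : j ≠ 0) (hk : k ≠ 0) (θ : ℝ) (x : Pt) : rotate j k θ x 0 = x 0 := by
  simp [rotate, hj.symm, hk.symm]

theorem rad_rotate (hj : j ≠ 0) (hk : k ≠ 0) (hjk : j ≠ k) (θ : ℝ) (x : Pt) :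
    rad (rotate j k θ x) = rad x := by
  have h := Real.sin_sq_add_cos_sq θ
  unfold rad
  congr 1
  fin_cases j <;> fin_cases k <;> simp at hj hk hjk <;> simp [rotate] <;> grind

theorem rotate_zero (x : Pt) : rotate j k 0 x = x := by
  ext a
  simp only [rotate, Real.cos_zero, Real.sin_zero]
  grind

theorem hasDerivAt_rotate (hjk : j ≠ k) (θ : ℝ) (x : Pt) :
    HasDerivAt (fun t => rotate j k t x) (rotate j k θ x j • Pi.single k (1 : ℝ)
      - rotate j k θ x k • Pi.single j (1 : ℝ)) θ := by
  have hc := Real.hasDerivAt_cos θ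
  have hs := Real.hasDerivAt_sin θ
  rw [hasDerivAt_pi]
  intro a
  by_cases haj : a = j
  · subst haj
    simp only [rotate, if_true, if_neg hjk.symm]
    refine ((hc.mul_const (x a)).sub (hs.mul_const (x k))).congr_deriv ?_
    simp [hjk]
    ring
  · by_cases hak : a = k
    · subst hak
      simp only [rotate, if_true, if_neg haj]
      refine ((hs.mul_const (x j)).add (hc.mul_const (x a))).congr_deriv ?_
      simp [hjk.symm]
      ring
    · simp only [rotate, if_neg haj, if_neg hak]
      refine (hasDerivAt_const θ (x a)).congr_deriv ?_
      simp [haj, hak, hjk.symm]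

theorem hasDerivAt_comp_rotate (hjk : j ≠ k) {G : Pt → ℝ} {θ : ℝ} {x : Pt}
    (hG : DifferentiableAt ℝ G (rotate j k θ x)) :
    HasDerivAt (fun t => G (rotate j k t x)) (rot j k G (rotate j k θ x)) θ := by
  refine (hG.hasFDerivAt.comp_hasDerivAt θ (hasDerivAt_rotate hjk θ x)).congr_deriv ?_
  simp [rot, pd]

end Rotate

namespace SphericallySymmetric

variable {B : Set Pt} {j k : Fin 4}

theorem inter {A : Set Pt} (hA : SphericallySymmetric A) (hB : SphericallySymmetric B) :
    SphericallySymmetric (A ∩ B) :=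
  fun p q h₀ hr hp => ⟨hA p q h₀ hr hp.1, hB p q h₀ hr hp.2⟩

theorem rotate_mem (hsym : SphericallySymmetric B) (hj : j ≠ 0) (hk : k ≠ 0) (hjk : j ≠ k) (θ : ℝ)
    {x : Pt} (hx : x ∈ B) : rotate j k θ x ∈ B :=
  hsym x _ (rotate_apply_zero hj hk θ x).symm (rad_rotate hj hk hjk θ x).symm hx

theorem setIntegral_comp_rotate (hsym : SphericallySymmetric B) (hj : j ≠ 0) (hk : k ≠ 0)
    (hjk : j ≠ k) (θ : ℝ) (G : Pt → ℝ) : ∫ x in B, G (rotate j k θ x) = ∫ x in B, G x := by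
  have preimage_eq : rotate j k θ ⁻¹' B = B := Set.ext fun x =>
    ⟨hsym _ _ (rotate_apply_zero hj hk θ x) (rad_rotate hj hk hjk θ x),
      hsym.rotate_mem hj hk hjk θ⟩
  have := (measurePreserving_rotate hj hk hjk θ).setIntegral_preimage_emb
    (measurableEmbedding_rotate hjk θ) G B
  rwa [preimage_eq] at this

variable {s K : Set Pt} {G : Pt → ℝ}

theorem hasDerivAt_setIntegral_comp_rotate (hK : SphericallySymmetric K) (hKc : IsCompact K)
    (hs : IsOpen s) (hKs : K ⊆ s) (hB : MeasurableSet B) (hBK : B ⊆ K) (hj : j ≠ 0) (hk : k ≠ 0)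
    (hjk : j ≠ k) (hG : ContDiffOn ℝ ∞ G s) :
    HasDerivAt (fun θ => ∫ x in B, G (rotate j k θ x)) (∫ x in B, rot j k G x) 0 := by
  have continuousOn_rot : ContinuousOn (rot j k G) s := (contDiffOn_rot hs hG).continuousOn
  obtain ⟨C, norm_rot_le⟩ := hKc.exists_bound_of_continuousOn (continuousOn_rot.mono hKs)
  have aestronglyMeasurable (θ : ℝ) :
      AEStronglyMeasurable (fun x => G (rotate j k θ x)) (volume.restrict B) :=
    (hG.continuousOn.comp (continuous_rotate j k θ).continuousOn
      fun x hx => hKs (hK.rotate_mem hj hk hjk θ (hBK hx))).aestronglyMeasurable hB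
  have integrable_bound : IntegrableOn (fun _ => C) B :=
    integrableOn_const ((measure_mono hBK).trans_lt hKc.measure_lt_top).ne
  have hasDerivAt := hasDerivAt_integral_of_dominated_loc_of_deriv_le (μ := volume.restrict B)
    (F := fun θ x => G (rotate j k θ x)) (F' := fun θ x => rot j k G (rotate j k θ x))
    (x₀ := (0 : ℝ)) (bound := fun _ => C) (s := Set.univ) Filter.univ_mem
    (.of_forall aestronglyMeasurable) ?_ ?_ ?_ integrable_bound ?_
  · simpa only [rotate_zero] using hasDerivAt.2
  · simp only [rotate_zero]
    exact ((hG.continuousOn.mono hKs).integrableOn_compact hKc).mono_set hBK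
  · simp only [rotate_zero]
    exact (continuousOn_rot.mono (hBK.trans hKs)).aestronglyMeasurable hB
  · filter_upwards [ae_restrict_mem hB] with x hx θ _ using
      norm_rot_le _ (hK.rotate_mem hj hk hjk θ (hBK hx))
  · filter_upwards [ae_restrict_mem hB] with x hx θ _
    have hmem := hKs (hK.rotate_mem hj hk hjk θ (hBK hx))
    exact hasDerivAt_comp_rotate hjk
      ((hG.contDiffAt (hs.mem_nhds hmem)).differentiableAt (by simp))

theorem setIntegral_rot_eq_zero (hsym : SphericallySymmetric B) (hK : SphericallySymmetric K)
    (hKc : IsCompact K) (hs : IsOpen s) (hKs : K ⊆ s) (hB : MeasurableSet B) (hBK : B ⊆ K)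
    (hj : j ≠ 0) (hk : k ≠ 0) (hjk : j ≠ k) (hG : ContDiffOn ℝ ∞ G s) :
    ∫ x in B, rot j k G x = 0 := by
  have h := hK.hasDerivAt_setIntegral_comp_rotate hKc hs hKs hB hBK hj hk hjk hG
  simp only [hsym.setIntegral_comp_rotate hj hk hjk] at h
  exact h.unique (hasDerivAt_const 0 _)

theorem setIntegral_rotDiv_eq_zero (hsym : SphericallySymmetric B) (hK : SphericallySymmetric K)
    (hKc : IsCompact K) (hs : IsOpen s) (hKs : K ⊆ s) (hB : MeasurableSet B) (hBK : B ⊆ K)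
    {g : Fin 4 → Fin 4 → Fin 4 → Pt → ℝ} (hg : ∀ i j k, ContDiffOn ℝ ∞ (g i j k) s) :
    IntegrableOn (rotDiv g) B ∧ ∫ x in B, rotDiv g x = 0 := by
  have integrableOn (i j k : Fin 4) : IntegrableOn (rot j k (g i j k)) B :=
    (((contDiffOn_rot hs (hg i j k)).continuousOn.mono hKs).integrableOn_compact hKc).mono_set hBK
  have integral_eq_zero (i : Fin 4) {j k : Fin 4} (hj : j ≠ 0) (hk : k ≠ 0) (hjk : j ≠ k) :
      ∫ x in B, rot j k (g i j k) x = 0 :=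
    hsym.setIntegral_rot_eq_zero hK hKc hs hKs hB hBK hj hk hjk (hg i j k)
  have integrableOn_add :
      IntegrableOn (fun x => rot 2 3 (g 1 2 3) x + rot 3 1 (g 2 3 1) x) B :=
    (integrableOn 1 2 3).add (integrableOn 2 3 1)
  refine ⟨integrableOn_add.add (integrableOn 3 1 2), ?_⟩
  calc ∫ x in B, rotDiv g x
      = ∫ x in B, rot 2 3 (g 1 2 3) x + rot 3 1 (g 2 3 1) x + rot 1 2 (g 3 1 2) x := rfl
    _ = 0 := by
      rw [integral_add integrableOn_add (integrableOn 3 1 2),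
        integral_add (integrableOn 1 2 3) (integrableOn 2 3 1)]
      simp [integral_eq_zero]

end SphericallySymmetric

/-- The compact region `|t| ≤ n`, `2M + 1/(n+1) ≤ r ≤ n`; these regions exhaust the exterior. -/
def cutoff (M : ℝ) (n : ℕ) : Set Pt :=
  {x | |x 0| ≤ n ∧ 2 * M + 1 / ((n : ℝ) + 1) ≤ rad x ∧ rad x ≤ n}

theorem cutoff_subset_exterior (M : ℝ) (n : ℕ) : cutoff M n ⊆ exterior M := fun _ hx =>
  (lt_add_of_pos_right _ (by positivity)).trans_le hx.2.1

theorem isClosed_cutoff (M : ℝ) (n : ℕ) : IsClosed (cutoff M n) :=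
  (isClosed_le (continuous_apply 0).abs continuous_const).inter
    ((isClosed_le continuous_const continuous_rad).inter
      (isClosed_le continuous_rad continuous_const))

theorem isCompact_cutoff (M : ℝ) (n : ℕ) : IsCompact (cutoff M n) := by
  refine Metric.isCompact_of_isClosed_isBounded (isClosed_cutoff M n) ?_
  refine (Metric.isBounded_closedBall (x := (0 : Pt)) (r := n)).subset fun x hx => ?_
  rw [mem_closedBall_zero_iff, pi_norm_le_iff_of_nonneg (by positivity)]
  have hrad := rad_sq x
  have norm_le {a : Fin 4} (ha : x a ^ 2 ≤ rad x ^ 2) : ‖x a‖ ≤ n :=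
    (abs_le_of_sq_le_sq ha (rad_nonneg x)).trans hx.2.2
  intro a
  fin_cases a
  · exact hx.1
  · exact norm_le (a := 1) (by rw [hrad]; linarith [sq_nonneg (x 2), sq_nonneg (x 3)])
  · exact norm_le (a := 2) (by rw [hrad]; linarith [sq_nonneg (x 1), sq_nonneg (x 3)])
  · exact norm_le (a := 3) (by rw [hrad]; linarith [sq_nonneg (x 1), sq_nonneg (x 2)])

theorem sphericallySymmetric_cutoff (M : ℝ) (n : ℕ) : SphericallySymmetric (cutoff M n) := by
  intro p q h₀ hr hp
  simpa only [cutoff, Set.mem_ofPred_eq, ← h₀, ← hr] using hp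

theorem monotone_cutoff (M : ℝ) : Monotone (cutoff M) := by
  intro m n hmn x hx
  have h : (m : ℝ) ≤ n := by exact_mod_cast hmn
  have hinv : 1 / ((n : ℝ) + 1) ≤ 1 / ((m : ℝ) + 1) := by gcongr
  exact ⟨hx.1.trans h, by linarith [hx.2.1], hx.2.2.trans h⟩

theorem exterior_subset_iUnion_cutoff (M : ℝ) : exterior M ⊆ ⋃ n, cutoff M n := by
  intro x hx
  have hpos : 0 < rad x - 2 * M := sub_pos.2 hx
  obtain ⟨n, hn⟩ := exists_nat_ge (max |x 0| (max (rad x) (1 / (rad x - 2 * M))))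
  simp only [max_le_iff] at hn
  have : 1 / ((n : ℝ) + 1) ≤ rad x - 2 * M := by
    rw [one_div_le (by positivity) hpos]
    linarith [hn.2.2]
  exact Set.mem_iUnion.2 ⟨n, hn.1, by linarith, hn.2.1⟩

/-! ### Integration -/

section Lintegral

variable {X : Type*} [MeasurableSpace X] {μ : Measure X} {b d : X → ℝ}

theorem integral_add_integral_le_iff_lintegral (hb : Integrable b μ) (hd : Integrable d μ)
    (hb₀ : 0 ≤ᵐ[μ] b) :
    ((∫⁻ x, ENNReal.ofReal (b x) ∂μ) + (∫⁻ x, ENNReal.ofReal (d x) ∂μ)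
      ≤ ∫⁻ x, ENNReal.ofReal (-d x) ∂μ) ↔ ∫ x, b x ∂μ ≤ ∫ x, -d x ∂μ := by
  have hpos := hd.lintegral_lt_top.ne
  have hneg := hd.neg.lintegral_lt_top.ne
  simp only [Pi.neg_apply] at hneg
  rw [integral_neg, integral_eq_lintegral_pos_part_sub_lintegral_neg_part hd,
    ← ofReal_integral_eq_lintegral_ofReal hb hb₀, ← ENNReal.ofReal_toReal hpos,
    ← ENNReal.ofReal_toReal hneg,
    ← ENNReal.ofReal_add (integral_nonneg_of_ae hb₀) ENNReal.toReal_nonneg,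
    ENNReal.ofReal_le_ofReal_iff ENNReal.toReal_nonneg]
  simp only [ENNReal.ofReal_toReal hpos, ENNReal.ofReal_toReal hneg]
  rw [neg_sub, le_sub_iff_add_le]

theorem integrable_of_lintegral_add_le (hb : AEStronglyMeasurable b μ) (hd : Integrable d μ)
    (hb₀ : 0 ≤ᵐ[μ] b) (h : (∫⁻ x, ENNReal.ofReal (b x) ∂μ) + (∫⁻ x, ENNReal.ofReal (d x) ∂μ)
      ≤ ∫⁻ x, ENNReal.ofReal (-d x) ∂μ) : Integrable b μ :=
  ⟨hb, (hasFiniteIntegral_iff_ofReal hb₀).2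
    ((le_self_add.trans h).trans_lt hd.neg.lintegral_lt_top)⟩

end Lintegral

theorem vol_restrict {M : ℝ} (hM : 0 < M) {Ω : Set Pt} (hΩ : MeasurableSet Ω)
    (hext : Ω ⊆ exterior M) : (vol M).restrict Ω = volume.restrict Ω := by
  have density : (fun p => ENNReal.ofReal (Real.sqrt |(metric M p).det|))
      =ᵐ[volume.restrict Ω] 1 := by
    filter_upwards [ae_restrict_mem hΩ] with p hp
    simp [sqrt_det_metric hM (hext hp)]
  rw [vol, restrict_withDensity hΩ, withDensity_congr_ae density, withDensity_one]

theorem measurable_axisDist : Measurable axisDist := by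
  unfold axisDist
  fun_prop

theorem measurable_frameX : Measurable frameX := by
  have hr := continuous_rad.measurable
  have ha := measurable_axisDist
  refine measurable_pi_lambda _ fun a => ?_
  fin_cases a <;> simp only [frameX] <;> fun_prop

theorem measurable_frameY : Measurable frameY := by
  have ha := measurable_axisDist
  refine measurable_pi_lambda _ fun a => ?_
  fin_cases a <;> simp only [frameY] <;> fun_prop

theorem measurable_frameZ (M : ℝ) : Measurable (frameZ M) := by
  have hr := continuous_rad.measurable
  refine measurable_pi_lambda _ fun a => ?_
  unfold frameZ
  split_ifs <;> fun_prop

theorem measurable_frameT (M : ℝ) : Measurable (frameT M) := by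
  have hr := continuous_rad.measurable
  refine measurable_pi_lambda _ fun a => ?_
  fin_cases a <;> simp only [frameT] <;> fun_prop

namespace BetaSystem

variable {M : ℝ} {F : Pt → Fin 4 → Fin 4 → ℝ} {u v e h : Pt → Fin 4 → ℝ}

theorem continuousOn_div1 (hS : BetaSystem M F u v e h) (hM : 0 < M) :
    ContinuousOn (div1 M (morawetzP M F)) (exterior M) := by
  have hr := continuous_rad.continuousOn (s := exterior M)
  have hf := (contDiffOn_lapse hM).continuousOn
  have hn := continuousOn_pi.1 (contDiffOn_normal hM).continuousOn
  have hu := continuousOn_pi.1 hS.re.smooth_u.continuousOn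
  have hv := continuousOn_pi.1 hS.im.smooth_u.continuousOn
  have he := continuousOn_pi.1 hS.re.smooth_e.continuousOn
  have hh := continuousOn_pi.1 hS.re.smooth_h.continuousOn
  rw [← continuousOn_neg_iff]
  refine ContinuousOn.congr ?_ fun p hp => hS.neg_div1_morawetzP hM hp
  simp only [radial, dot]
  have hr₀ : ∀ p ∈ exterior M, rad p ≠ 0 := fun p hp => (rad_pos hM hp).ne'
  have hf₀ : ∀ p ∈ exterior M, lapse M p ≠ 0 := fun p hp => (lapse_pos hM hp).ne'
  simp only [div_eq_mul_inv, mul_inv, ← inv_pow]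
  fun_prop (disch := assumption)

theorem aemeasurable_norm_βAlong_sq (hS : BetaSystem M F u v e h) {ν : Pt → Fin 4 → ℝ}
    (hν : Measurable ν) :
    AEMeasurable (fun p => ‖βAlong M F p (ν p)‖ ^ 2) (volume.restrict (exterior M)) := by
  have hext := (isOpen_exterior M).measurableSet
  have hν' := measurable_pi_iff.1 hν
  have hu := aemeasurable_pi_iff.1 (hS.re.smooth_u.continuousOn.aemeasurable (μ := volume) hext)
  have hv := aemeasurable_pi_iff.1 (hS.im.smooth_u.continuousOn.aemeasurable (μ := volume) hext)
  refine AEMeasurable.congr (f := fun p => (∑ a, u p a * ν p a) ^ 2 + (∑ a, v p a * ν p a) ^ 2)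
    (by fun_prop) ?_
  filter_upwards [ae_restrict_mem hext] with p hp using (hS.norm_βAlong_sq hp (ν p)).symm

theorem aemeasurable_normΘ (hS : BetaSystem M F u v e h) (hM : 0 < M) :
    AEMeasurable (normΘ M F) (volume.restrict (exterior M)) := by
  have hext := (isOpen_exterior M).measurableSet
  have he := aemeasurable_pi_iff.1 (hS.re.smooth_e.continuousOn.aemeasurable (μ := volume) hext)
  have hh := aemeasurable_pi_iff.1 (hS.re.smooth_h.continuousOn.aemeasurable (μ := volume) hext)
  refine AEMeasurable.congr (f := fun p => 1 / 4 * (dot (e p) (e p) + dot (h p) (h p))) ?_ ?_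
  · unfold dot
    fun_prop
  · filter_upwards [ae_restrict_mem hext] with p hp using (hS.normΘ_eq hM hp).symm

theorem aemeasurable_morawetzBulk (hS : BetaSystem M F u v e h) (hM : 0 < M) :
    AEMeasurable (morawetzBulk M F) (volume.restrict (exterior M)) := by
  have hr := continuous_rad.measurable
  have hΘ := hS.aemeasurable_normΘ hM
  have hX := hS.aemeasurable_norm_βAlong_sq measurable_frameX
  have hY := hS.aemeasurable_norm_βAlong_sq measurable_frameY
  have hZ := hS.aemeasurable_norm_βAlong_sq (measurable_frameZ M)
  have hT := hS.aemeasurable_norm_βAlong_sq (measurable_frameT M)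
  unfold morawetzBulk normβDeg
  fun_prop

variable {B Ω : Set Pt} {n : ℕ}

theorem integrableOn_div1_of_subset_cutoff (hS : BetaSystem M F u v e h) (hM : 0 < M)
    (hBn : B ⊆ cutoff M n) : IntegrableOn (div1 M (morawetzP M F)) B :=
  (((hS.continuousOn_div1 hM).mono (cutoff_subset_exterior M n)).integrableOn_compact
    (isCompact_cutoff M n)).mono_set hBn

theorem lintegral_le_of_subset_cutoff (hS : BetaSystem M F u v e h) (hM : 0 < M)
    (hB : MeasurableSet B) (hBn : B ⊆ cutoff M n) (hsym : SphericallySymmetric B) :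
    (∫⁻ p in B, ENNReal.ofReal (morawetzBulk M F p))
        + (∫⁻ p in B, ENNReal.ofReal (div1 M (morawetzP M F) p))
      ≤ ∫⁻ p in B, ENNReal.ofReal (-div1 M (morawetzP M F) p) := by
  have hext := hBn.trans (cutoff_subset_exterior M n)
  have hdiv := hS.integrableOn_div1_of_subset_cutoff hM hBn
  obtain ⟨hrot, integral_rot⟩ := hsym.setIntegral_rotDiv_eq_zero
    (sphericallySymmetric_cutoff M n) (isCompact_cutoff M n) (isOpen_exterior M)
    (cutoff_subset_exterior M n) hB hBn
    (contDiffOn_weightedFlux hM hS.re.smooth_e hS.re.smooth_h)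
  have bulk_nonneg : 0 ≤ᵐ[volume.restrict B] morawetzBulk M F := by
    filter_upwards [ae_restrict_mem hB] with p hp using hS.morawetzBulk_nonneg hM (hext hp)
  have bulk_le : ∀ᵐ p ∂volume.restrict B, morawetzBulk M F p
      ≤ -div1 M (morawetzP M F) p - rotDiv (weightedFlux M e h) p := by
    filter_upwards [ae_restrict_mem hB] with p hp
    linarith [hS.morawetzBulk_add_rotDiv_le hM (hext hp)]
  have hbulk : IntegrableOn (morawetzBulk M F) B := by
    refine Integrable.mono' (hdiv.neg.sub hrot)
      ((hS.aemeasurable_morawetzBulk hM).mono_set hext).aestronglyMeasurable ?_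
    filter_upwards [bulk_nonneg, bulk_le] with p h₀ hle
    exact (Real.norm_of_nonneg h₀).trans_le hle
  refine (integral_add_integral_le_iff_lintegral hbulk hdiv bulk_nonneg).2 ?_
  calc ∫ p in B, morawetzBulk M F p
      ≤ ∫ p in B, (-div1 M (morawetzP M F) p - rotDiv (weightedFlux M e h) p) :=
        integral_mono_ae hbulk (hdiv.neg.sub hrot) bulk_le
    _ = ∫ p in B, -div1 M (morawetzP M F) p := by
        rw [integral_sub hdiv.fun_neg hrot, integral_rot, sub_zero]

theorem lintegral_le (hS : BetaSystem M F u v e h) (hM : 0 < M) (hΩ : MeasurableSet Ω)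
    (hext : Ω ⊆ exterior M) (hsym : SphericallySymmetric Ω) :
    (∫⁻ p in Ω, ENNReal.ofReal (morawetzBulk M F p))
        + (∫⁻ p in Ω, ENNReal.ofReal (div1 M (morawetzP M F) p))
      ≤ ∫⁻ p in Ω, ENNReal.ofReal (-div1 M (morawetzP M F) p) := by
  have monotone_inter : Monotone fun n => Ω ∩ cutoff M n := fun _ _ hmn =>
    Set.inter_subset_inter_right _ (monotone_cutoff M hmn)
  have iUnion_inter : ⋃ n, Ω ∩ cutoff M n = Ω := by
    rw [← Set.inter_iUnion, Set.inter_eq_left.2 (hext.trans (exterior_subset_iUnion_cutoff M))]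
  have lintegral_eq_iSup (f : Pt → ENNReal) :
      ∫⁻ p in Ω, f p = ⨆ n, ∫⁻ p in Ω ∩ cutoff M n, f p := by
    conv_lhs => rw [← iUnion_inter]
    exact setLIntegral_iUnion_of_directed f monotone_inter.directed_le
  rw [lintegral_eq_iSup, lintegral_eq_iSup, ENNReal.iSup_add_iSup_of_monotone
    (fun _ _ hmn => lintegral_mono_set (monotone_inter hmn))
    (fun _ _ hmn => lintegral_mono_set (monotone_inter hmn))]
  refine iSup_le fun n => (hS.lintegral_le_of_subset_cutoff hM
    (hΩ.inter (isClosed_cutoff M n).measurableSet) Set.inter_subset_right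
    (hsym.inter (sphericallySymmetric_cutoff M n))).trans
      (lintegral_mono_set Set.inter_subset_left)

end BetaSystem

end Schwarzschild

end

theorem mainTheorem2 (M : ℝ) (hM : 0 < M)
    (F : Schwarzschild.Pt → Fin 4 → Fin 4 → ℝ) (hF : Schwarzschild.IsMaxwellField M F)
    (Ω : Set Schwarzschild.Pt) (hΩ : MeasurableSet Ω)
    (hext : Ω ⊆ Schwarzschild.exterior M) (hsym : Schwarzschild.SphericallySymmetric Ω) :
    ((∫⁻ p in Ω, ENNReal.ofReal (Schwarzschild.morawetzBulk M F p) ∂(Schwarzschild.vol M))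
        + (∫⁻ p in Ω, ENNReal.ofReal (Schwarzschild.div1 M (Schwarzschild.morawetzP M F) p)
            ∂(Schwarzschild.vol M))
      ≤ ∫⁻ p in Ω, ENNReal.ofReal (-Schwarzschild.div1 M (Schwarzschild.morawetzP M F) p)
            ∂(Schwarzschild.vol M))
    ∧ (IntegrableOn (fun p => Schwarzschild.div1 M (Schwarzschild.morawetzP M F) p) Ω
          (Schwarzschild.vol M) →
        IntegrableOn (fun p => Schwarzschild.morawetzBulk M F p) Ω (Schwarzschild.vol M) ∧
        ∫ p in Ω, Schwarzschild.morawetzBulk M F p ∂(Schwarzschild.vol M)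
          ≤ ∫ p in Ω, -Schwarzschild.div1 M (Schwarzschild.morawetzP M F) p
              ∂(Schwarzschild.vol M)) := by
  obtain ⟨u, v, e, h, hS⟩ := Schwarzschild.exists_betaSystem hM hF
  have key := hS.lintegral_le hM hΩ hext hsym
  have bulk_nonneg : 0 ≤ᵐ[volume.restrict Ω] Schwarzschild.morawetzBulk M F := by
    filter_upwards [ae_restrict_mem hΩ] with p hp using hS.morawetzBulk_nonneg hM (hext hp)
  simp only [IntegrableOn, Schwarzschild.vol_restrict hM hΩ hext]
  refine ⟨key, fun hdiv => ?_⟩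
  have hbulk := Schwarzschild.integrable_of_lintegral_add_le
    ((hS.aemeasurable_morawetzBulk hM).mono_set hext).aestronglyMeasurable hdiv bulk_nonneg key
  exact ⟨hbulk, (Schwarzschild.integral_add_integral_le_iff_lintegral hbulk hdiv bulk_nonneg).1 key⟩
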